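/- **Setting.** Let $p$ be a prime, $R$ a complete local noetherian domain with finite residue field of characteristic $p$ (hence canonically a $\mathbb Z_p$-algebra), and $\mathcal R$ its normalization, i.e. its integral closure in $\operatorname{Frac}(R)$. Let $S$ be a finite set of primes containing $p$ and $G_{\mathbb Q,S}$ the Galois group of the maximal Galois extension of $\mathbb Q$ unramified outside $S\cup\{\infty\}$. Let $\mathcal F$ be the $p$-adic family attached to a continuous $n$-dimensional determinant $D: R[G_{\mathbb Q,S}]\to R$, i.e. a multiplicative $R$-polynomial law, homogeneous of degree $n$, for which the coefficients of $\chi(D,g)=D(1-Xg)$ are continuous functions of $g\in G_{\mathbb Q,S}$. For a ring morphism $f$ from $R$ or $\mathcal R$ to a ring $A$, write $D_f=f\circ D$ for the base-changed determinant (for $f$ defined on $\mathcal R$, first extend $D$ to $\mathcal R$), and $\mathcal F_f$ for the family attached to $D_f$. Fix a prime $\ell\neq p$ and an embedding $\bar{\mathbb Q}\hookrightarrow\bar{\mathbb Q}_\ell$, which defines $G_{\mathbb Q_\ell}\to G_{\mathbb Q,S}$; let $I_\ell\subset G_{\mathbb Q_\ell}$ be the inertia subgroup and $\operatorname{Fr}(\ell)\in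 G_{\mathbb Q_\ell}/I_\ell$ the geometric Frobenius. *Local factors.* Let $A$ be a normal domain and $D_A$ the base change of $D$ to $A$ along a ring morphism. Let $(V,\rho)$ be the semisimple representation of $G_{\mathbb Q,S}$ over an algebraic closure $\bar K$ of $\operatorname{Frac}(A)$ such that $\det\circ\rho=D_A$ (it is unique up to isomorphism), and let $D_A^{I_\ell}$ be the determinant of the action of $G_{\mathbb Q_\ell}/I_\ell$ on $V^{I_\ell}$. The algebraic local Euler factor of the corresponding family is $\operatorname{Eul}_\ell(X)=\chi(D_A^{I_\ell},\operatorname{Fr}(\ell))=\det(1-X\operatorname{Fr}(\ell)\mid V^{I_\ell})$, a priori in $\bar K[X]$. When it lies in $A[X]$, the algebraic local polynomial determinant $\mathcal L_\ell(X)$ is the determinant $\operatorname{Det}_{A[X]}$ of the complex $A[X]\to A[X]$, in degrees $0$ and $1$, given by multiplication by $\operatorname{Eul}_\ell(X)$. It has a canonical $A[X]$-linear injection into $A[X]$, with image the ideal generated by $\operatorname{Eul}_\ell(X)$ (induced by the canonical trivialization of the determinant of the same complex over $\operatorname{Frac}(A[X])$, where it is acyclic). *Purity.* A $\mathbb Z_p$-algebra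 morphism $\psi:\mathcal R\to\bar{\mathbb Q}_p$ is a specialization of $\mathcal F$ that is pure at $\ell$ if the semisimple representation $\rho_\psi$ of $G_{\mathbb Q,S}$ over $\bar{\mathbb Q}_p$ with $\det\circ\rho_\psi=D_\psi$ satisfies the following: there is an integer $w$ such that, for every $j\in\mathbb Z$ and every lift $\sigma\in G_{\mathbb Q_\ell}$ of $\operatorname{Fr}(\ell)$, the eigenvalues of $\sigma$ on the $j$-th graded part of the monodromy filtration of $\rho_\psi|_{G_{\mathbb Q_\ell}}$ are $\ell$-Weil numbers of weight $w+j$. **Theorem.** Let $\psi$ be a specialization of $\mathcal F$ that is pure at $\ell$, and let $\varphi:\mathcal R\to\mathcal S$ be a ring morphism to a normal domain $\mathcal S$ such that $\ker\varphi\subset\ker\psi$. Then $\operatorname{Eul}_\ell(\mathcal F,X)\in\mathcal R[X]$ and $\operatorname{Eul}_\ell(\mathcal F_\varphi,X)\in\mathcal S[X]$, there is a canonical isomorphism of $\mathcal S[X]$-modules $$\mathcal L_\ell(\mathcal F_\varphi,X)\simeq\mathcal L_\ell(\mathcal F,X)\otimes_{\mathcal R,\varphi}\mathcal S$$ (the unique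 isomorphism that is compatible, via $\varphi:\mathcal R[X]\to\mathcal S[X]$, with the canonical maps from the two determinants to $\mathcal R[X]$ and $\mathcal S[X]$), and $$\operatorname{Eul}_\ell(\mathcal F_\varphi,X)=\varphi\bigl(\operatorname{Eul}_\ell(\mathcal F,X)\bigr).$$ -/

import Mathlib

open scoped TensorProduct MonoidAlgebra Polynomial

universe u v w

namespace Determinant

/-- The canonical map `S[G] → S ⊗_A A[G]` (an isomorphism). -/
noncomputable def toTensor (A : Type u) (S : Type v) (G : Type*) [CommRing A] [CommSemiring S]
    [Algebra A S] [Group G] : S[G] →ₐ[S] S ⊗[A] A[G] :=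
  MonoidAlgebra.lift S (S ⊗[A] A[G]) G
    ((Algebra.TensorProduct.includeRight : A[G] →ₐ[A] S ⊗[A] A[G]).toMonoidHom.comp
      (MonoidAlgebra.of A G))

/-- The canonical map `S ⊗_A A[G] → S[G]` (inverse to `toTensor`). -/
noncomputable def ofTensor (A : Type u) (S : Type v) (G : Type*) [CommRing A] [CommSemiring S]
    [Algebra A S] [Group G] : S ⊗[A] A[G] →ₐ[S] S[G] :=
  Algebra.TensorProduct.lift (Algebra.ofId S S[G]) (MonoidAlgebra.mapAlgHom G (Algebra.ofId A S))
    (fun s _ => Algebra.commutes s _)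

section
variable {A : Type u} {S : Type v} {G : Type*} [CommRing A] [CommSemiring S]
    [Algebra A S] [Group G]
theorem ofTensor_tmul (s : S) (x : A[G]) :
    ofTensor A S G (s ⊗ₜ x) = s • MonoidAlgebra.mapAlgHom G (Algebra.ofId A S) x := by
  rw [Algebra.smul_def]
  exact Algebra.TensorProduct.lift_tmul _ _ _ s x

theorem toTensor_single (g : G) (s : S) :
    toTensor A S G (MonoidAlgebra.single g s) = s ⊗ₜ MonoidAlgebra.single g 1 := by
  simp [toTensor, TensorProduct.smul_tmul']

theorem ofTensor_toTensor (x : S[G]) : ofTensor A S G (toTensor A S G x) = x := by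
  have : (ofTensor A S G).comp (toTensor A S G) = AlgHom.id S _ := by
    ext g : 2
    simp [ofTensor_tmul, toTensor_single]
  exact DFunLike.congr_fun this x

theorem toTensor_ofTensor (x : S ⊗[A] A[G]) : toTensor A S G (ofTensor A S G x) = x := by
  have : (toTensor A S G).comp (ofTensor A S G) = AlgHom.id S _ := by
    ext g : 3
    simp [ofTensor_tmul, toTensor_single]
  exact DFunLike.congr_fun this x

theorem toTensor_map {T : Type*} [CommSemiring T] [Algebra A T] (f : S →ₐ[A] T) (x : S[G]) :
    toTensor A T G (MonoidAlgebra.mapAlgHom G f x) =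
      LinearMap.rTensor A[G] f.toLinearMap (toTensor A S G x) := by
  have : ((toTensor A T G).restrictScalars A).comp (MonoidAlgebra.mapAlgHom G f) =
      (Algebra.TensorProduct.map f (AlgHom.id A A[G])).comp ((toTensor A S G).restrictScalars A) := by
    ext g <;> simp [toTensor, TensorProduct.smul_tmul', Algebra.TensorProduct.map_tmul]
  exact DFunLike.congr_fun this x
theorem ofTensor_map {T : Type*} [CommSemiring T] [Algebra A T] (f : S →ₐ[A] T)
    (x : S ⊗[A] A[G]) :
    ofTensor A T G (LinearMap.rTensor A[G] f.toLinearMap x) =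
      MonoidAlgebra.mapAlgHom G f (ofTensor A S G x) := by
  obtain ⟨y, rfl⟩ : ∃ y, toTensor A S G y = x := ⟨_, toTensor_ofTensor x⟩
  rw [← toTensor_map, ofTensor_toTensor, ofTensor_toTensor]
end

end Determinant

/-- An `n`-dimensional `A`-valued determinant on the group `G`: a multiplicative `A`-polynomial law
`A[G] → A`, homogeneous of degree `n`. -/
structure Determinant (A : Type u) [CommRing A] (G : Type v) [Group G] (n : ℕ)
    extends PolynomialLaw A A[G] A where
  map_one' : ∀ (S : Type u) [CommSemiring S] [Algebra A S], toFun' S 1 = 1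
  map_mul' : ∀ (S : Type u) [CommSemiring S] [Algebra A S] (x y : S ⊗[A] A[G]),
    toFun' S (x * y) = toFun' S x * toFun' S y
  homogeneous' : ∀ (S : Type u) [CommSemiring S] [Algebra A S] (s : S) (x : S ⊗[A] A[G]),
    toFun' S (s • x) = s ^ n • toFun' S x

namespace Determinant

section
variable {A : Type u} [CommRing A] {G : Type v} [Group G] {n : ℕ}

/-- The values of a determinant on `S[G] = S ⊗_A A[G]`, for any commutative `A`-algebra `S`. -/
noncomputable def eval (D : Determinant A G n) (S : Type w) [CommSemiring S] [Algebra A S]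
    (x : S[G]) : S :=
  Algebra.TensorProduct.rid A S S (D.toPolynomialLaw.toFun S (toTensor A S G x))

theorem eval_map (D : Determinant A G n) {S : Type*} {T : Type*} [CommSemiring S] [Algebra A S]
    [CommSemiring T] [Algebra A T] (f : S →ₐ[A] T) (x : S[G]) :
    D.eval T (MonoidAlgebra.mapAlgHom G f x) = f (D.eval S x) := by
  rw [eval, toTensor_map, ← PolynomialLaw.isCompat_apply, eval]
  generalize PolynomialLaw.toFun S D.toPolynomialLaw (toTensor A S G x) = y
  induction y with
  | zero => simp
  | add a b ha hb => simp only [map_add, ha, hb]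
  | tmul s a => simp

theorem exists_lift₂ {S : Type*} [CommSemiring S] [Algebra A S] (s : S) (x y : S[G]) :
    ∃ (B : Type u) (_ : CommSemiring B) (_ : Algebra A B) (f : B →ₐ[A] S) (s' : B) (x' y' : B[G]),
      f s' = s ∧ MonoidAlgebra.mapAlgHom G f x' = x ∧ MonoidAlgebra.mapAlgHom G f y' = y := by
  obtain ⟨n₁, f₁, p₁, q₁, h₁, hq⟩ := PolynomialLaw.exists_lift' (R := A) (toTensor A S G x) s
  obtain ⟨n₂, f₂, p₂, h₂⟩ := PolynomialLaw.exists_lift (R := A) (toTensor A S G y)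
  let i₁ : MvPolynomial (Fin n₁) A →ₐ[A] MvPolynomial (Fin n₁ ⊕ Fin n₂) A :=
    MvPolynomial.rename Sum.inl
  let i₂ : MvPolynomial (Fin n₂) A →ₐ[A] MvPolynomial (Fin n₁ ⊕ Fin n₂) A :=
    MvPolynomial.rename Sum.inr
  let f : MvPolynomial (Fin n₁ ⊕ Fin n₂) A →ₐ[A] S :=
    MvPolynomial.aeval (Sum.elim (fun i => f₁ (MvPolynomial.X i)) (fun i => f₂ (MvPolynomial.X i)))
  have e₁ : f.comp i₁ = f₁ := by ext i; simp [f, i₁]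
  have e₂ : f.comp i₂ = f₂ := by ext i; simp [f, i₂]
  have hr (m : ℕ) (i : MvPolynomial (Fin m) A →ₐ[A] MvPolynomial (Fin n₁ ⊕ Fin n₂) A)
      (z : MvPolynomial (Fin m) A ⊗[A] A[G]) :
      LinearMap.rTensor A[G] (f.comp i).toLinearMap z =
        LinearMap.rTensor A[G] f.toLinearMap (LinearMap.rTensor A[G] i.toLinearMap z) := by
    rw [AlgHom.comp_toLinearMap, LinearMap.rTensor_comp, LinearMap.comp_apply]
  refine ⟨MvPolynomial (Fin n₁ ⊕ Fin n₂) A, inferInstance, inferInstance, f, i₁ q₁,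
    ofTensor A _ G (LinearMap.rTensor A[G] i₁.toLinearMap p₁),
    ofTensor A _ G (LinearMap.rTensor A[G] i₂.toLinearMap p₂), ?_, ?_, ?_⟩
  · rw [← hq, ← e₁, AlgHom.comp_apply]
  · rw [← ofTensor_map, ← hr, e₁, h₁, ofTensor_toTensor]
  · rw [← ofTensor_map, ← hr, e₂, h₂, ofTensor_toTensor]

theorem eval_mul (D : Determinant A G n) {S : Type*} [CommSemiring S] [Algebra A S] (x y : S[G]) :
    D.eval S (x * y) = D.eval S x * D.eval S y := by
  obtain ⟨B, _, _, f, _, x, y, -, rfl, rfl⟩ := exists_lift₂ (A := A) 1 x y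
  rw [← map_mul, eval_map, eval_map, eval_map, ← map_mul]
  congr 1
  simp only [eval, ← PolynomialLaw.toFun'_eq_toFun, map_mul, D.map_mul']

theorem eval_one (D : Determinant A G n) {S : Type*} [CommSemiring S] [Algebra A S] :
    D.eval S (1 : S[G]) = 1 := by
  rw [← map_one (MonoidAlgebra.mapAlgHom G (Algebra.ofId A S)), eval_map]
  simp only [eval, ← PolynomialLaw.toFun'_eq_toFun, map_one, D.map_one']

theorem eval_smul (D : Determinant A G n) {S : Type*} [CommSemiring S] [Algebra A S] (s : S)
    (x : S[G]) : D.eval S (s • x) = s ^ n * D.eval S x := by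
  obtain ⟨B, _, _, f, s, x, _, rfl, rfl, -⟩ := exists_lift₂ (A := A) s x x
  have key : f s • MonoidAlgebra.mapAlgHom G f x = MonoidAlgebra.mapAlgHom G f (s • x) := by
    ext; simp
  rw [key, eval_map, eval_map, ← map_pow, ← map_mul]
  congr 1
  simp only [eval, ← PolynomialLaw.toFun'_eq_toFun, map_smul, D.homogeneous', smul_eq_mul]

/-- The determinant with given values on all `S[G]`. -/
noncomputable def ofEval (E : ∀ (S : Type u) [CommSemiring S] [Algebra A S], S[G] → S)
    (E_map : ∀ (S T : Type u) [CommSemiring S] [Algebra A S] [CommSemiring T] [Algebra A T]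
      (f : S →ₐ[A] T) (x : S[G]), E T (MonoidAlgebra.mapAlgHom G f x) = f (E S x))
    (E_one : ∀ (S : Type u) [CommSemiring S] [Algebra A S], E S 1 = 1)
    (E_mul : ∀ (S : Type u) [CommSemiring S] [Algebra A S] (x y : S[G]),
      E S (x * y) = E S x * E S y)
    (E_smul : ∀ (S : Type u) [CommSemiring S] [Algebra A S] (s : S) (x : S[G]),
      E S (s • x) = s ^ n * E S x) : Determinant A G n where
  toFun' S _ _ x := E S (ofTensor A S G x) ⊗ₜ 1
  isCompat' f := by
    ext x
    simp [ofTensor_map, E_map]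
  map_one' S _ _ := by rw [map_one, E_one, Algebra.TensorProduct.one_def]
  map_mul' S _ _ x y := by rw [map_mul, E_mul, Algebra.TensorProduct.tmul_mul_tmul, one_mul]
  homogeneous' S _ _ s x := by
    rw [map_smul, E_smul, TensorProduct.smul_tmul', smul_eq_mul]

theorem eval_ofEval {E : ∀ (S : Type u) [CommSemiring S] [Algebra A S], S[G] → S}
    {h₁ h₂ h₃ h₄} (S : Type u) [CommSemiring S] [Algebra A S] (x : S[G]) :
    (ofEval (n := n) E h₁ h₂ h₃ h₄).eval S x = E S x := by
  simp only [eval, ← PolynomialLaw.toFun'_eq_toFun, ofEval, ofTensor_toTensor]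
  simp

/-- A `B`-algebra `S` as an `A`-algebra, through `φ : A → B`. -/
abbrev algebraAlong {B : Type*} [CommRing B] (φ : A →+* B) (S : Type*) [CommSemiring S]
    [Algebra B S] : Algebra A S :=
  ((algebraMap B S).comp φ).toAlgebra

/-- The values on `S[G]`, for a `B`-algebra `S`, of the base change of `D` along `φ : A → B`: they
are those of `D`. -/
noncomputable def evalAlong (D : Determinant A G n) {B : Type*} [CommRing B] (φ : A →+* B)
    (S : Type*) [CommSemiring S] [Algebra B S] (x : S[G]) : S :=
  @eval A _ G _ n D S _ (algebraAlong φ S) x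

theorem evalAlong_map (D : Determinant A G n) {B : Type*} [CommRing B] (φ : A →+* B)
    {S T : Type*} [CommSemiring S] [Algebra B S] [CommSemiring T] [Algebra B T]
    (f : S →ₐ[B] T) (x : S[G]) :
    D.evalAlong φ T (MonoidAlgebra.mapAlgHom G f x) = f (D.evalAlong φ S x) := by
  let := algebraAlong φ S
  let := algebraAlong φ T
  exact D.eval_map (⟨f.toRingHom, fun a => f.commutes (φ a)⟩ : S →ₐ[A] T) x

theorem evalAlong_one (D : Determinant A G n) {B : Type*} [CommRing B] (φ : A →+* B)
    {S : Type*} [CommSemiring S] [Algebra B S] : D.evalAlong φ S 1 = 1 :=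
  @eval_one A _ G _ n D S _ (algebraAlong φ S)

theorem evalAlong_mul (D : Determinant A G n) {B : Type*} [CommRing B] (φ : A →+* B)
    {S : Type*} [CommSemiring S] [Algebra B S] (x y : S[G]) :
    D.evalAlong φ S (x * y) = D.evalAlong φ S x * D.evalAlong φ S y :=
  @eval_mul A _ G _ n D S _ (algebraAlong φ S) x y

theorem evalAlong_smul (D : Determinant A G n) {B : Type*} [CommRing B] (φ : A →+* B)
    {S : Type*} [CommSemiring S] [Algebra B S] (s : S) (x : S[G]) :
    D.evalAlong φ S (s • x) = s ^ n * D.evalAlong φ S x :=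
  @eval_smul A _ G _ n D S _ (algebraAlong φ S) s x

/-- Base change of a determinant along a ring morphism `φ : A → B`: the determinant `φ ∘ D`. -/
noncomputable def baseChange (D : Determinant A G n) {B : Type w} [CommRing B] (φ : A →+* B) :
    Determinant B G n :=
  ofEval (fun S _ _ => D.evalAlong φ S) (fun _ _ _ _ _ _ => D.evalAlong_map φ)
    (fun _ _ _ => D.evalAlong_one φ) (fun _ _ _ => D.evalAlong_mul φ)
    (fun _ _ _ => D.evalAlong_smul φ)

/-- The characteristic polynomial `χ(D, g) = D(1 - X g)`. -/
noncomputable def charpoly (D : Determinant A G n) (g : G) : A[X] :=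
  D.eval A[X] (1 - MonoidAlgebra.single g Polynomial.X)

end

section
variable {K : Type u} [Field K] {G : Type v} [Group G] {V : Type w} [AddCommGroup V] [Module K V]

/-- The action of `S[G]` on `S ⊗_K V`. -/
noncomputable def actionOn (ρ : Representation K G V) (S : Type*) [CommSemiring S] [Algebra K S] :
    S[G] →ₐ[S] Module.End S (S ⊗[K] V) :=
  MonoidAlgebra.lift S _ G ((Module.End.baseChangeHom K S V).toMonoidHom.comp ρ)

theorem actionOn_single (ρ : Representation K G V) {S : Type*} [CommSemiring S] [Algebra K S]
    (g : G) (s : S) :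
    actionOn ρ S (MonoidAlgebra.single g s) = s • (ρ g).baseChange S := by
  simp only [actionOn, MonoidAlgebra.lift_single]
  rfl

theorem det_actionOn_map [Module.Finite K V] (ρ : Representation K G V) {S T : Type*} [CommRing S]
    [CommRing T] [Algebra K S] [Algebra K T] (f : S →ₐ[K] T) (x : S[G]) :
    LinearMap.det (actionOn ρ T (MonoidAlgebra.mapAlgHom G f x)) =
      f (LinearMap.det (actionOn ρ S x)) := by
  let b := Module.finBasis K V
  have h : ∀ x : S[G],
      LinearMap.toMatrix (b.baseChange T) (b.baseChange T)
        (actionOn ρ T (MonoidAlgebra.mapAlgHom G f x)) =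
      (LinearMap.toMatrix (b.baseChange S) (b.baseChange S) (actionOn ρ S x)).map f := by
    intro x
    induction x using MonoidAlgebra.induction_linear with
    | zero => ext; simp
    | add x y hx hy => simp only [map_add, hx, hy]; ext; simp
    | single g s =>
      rw [show MonoidAlgebra.mapAlgHom G f (MonoidAlgebra.single g s) =
        MonoidAlgebra.single g (f s) by simp, actionOn_single, actionOn_single]
      ext i j
      simp [LinearMap.toMatrix_apply]
  rw [← LinearMap.det_toMatrix (b.baseChange T), h, ← LinearMap.det_toMatrix (b.baseChange S)]
  exact (RingHom.map_det f.toRingHom _).symm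

/-- A commutative semiring that is an algebra over a commutative ring is a commutative ring. -/
abbrev commRingOfAlgebra (K S : Type*) [CommRing K] [CommSemiring S] [Algebra K S] : CommRing S :=
  { (inferInstance : CommSemiring S), Algebra.semiringToRing K with }

/-- The determinant `det ∘ ρ` of a representation `ρ` of `G` on a finite-dimensional vector space
`V`: its value at `x ∈ S[G]` is the determinant of `x` acting on `S ⊗_K V`. -/
noncomputable def ofRepresentation [Module.Finite K V] (ρ : Representation K G V) :
    Determinant K G (Module.finrank K V) :=
  ofEval
    (fun S _ _ x =>
      letI : CommRing S := commRingOfAlgebra K S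
      LinearMap.det (actionOn ρ S x))
    (fun S T _ _ _ _ f x => by
      let : CommRing S := commRingOfAlgebra K S
      let : CommRing T := commRingOfAlgebra K T
      exact det_actionOn_map ρ f x)
    (fun S _ _ => by simp)
    (fun S _ _ x y => by simp)
    (fun S _ _ s x => by
      let : CommRing S := commRingOfAlgebra K S
      nontriviality S
      simp)

end
end Determinant

section LocalGalois

variable (ℓ : ℕ) [Fact ℓ.Prime]

/-- The absolute Galois group of `ℚ_ℓ`. -/
abbrev LocalGaloisGroup := Gal(PadicAlgCl ℓ/ℚ_[ℓ])

theorem PadicAlgCl.norm_galois (σ : LocalGaloisGroup ℓ) (x : PadicAlgCl ℓ) : ‖σ x‖ = ‖x‖ :=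
  (spectralNorm_eq_of_equiv (K := ℚ_[ℓ]) σ x).symm

/-- The inertia subgroup: the automorphisms that act trivially on the residue field of the ring of
integers of the algebraic closure of `ℚ_ℓ`. -/
def inertiaGroup : Subgroup (LocalGaloisGroup ℓ) where
  carrier := {σ | ∀ x : PadicAlgCl ℓ, ‖x‖ ≤ 1 → ‖σ x - x‖ < 1}
  one_mem' := by intro x _; simp
  mul_mem' := by
    intro σ τ hσ hτ x hx
    have h : (σ * τ) x - x = (σ (τ x) - τ x) + (τ x - x) := by
      rw [AlgEquiv.mul_apply]; ring
    rw [h]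
    exact (PadicAlgCl.isNonarchimedean ℓ _ _).trans_lt
      (max_lt (hσ _ (by rwa [PadicAlgCl.norm_galois])) (hτ x hx))
  inv_mem' := by
    intro σ hσ x hx
    have h := hσ (σ⁻¹ x) (by rwa [PadicAlgCl.norm_galois])
    rw [← AlgEquiv.mul_apply, mul_inv_cancel, AlgEquiv.one_apply] at h
    rwa [norm_sub_rev]

instance : (inertiaGroup ℓ).Normal where
  conj_mem := by
    intro τ hτ σ x hx
    have h := hτ (σ⁻¹ x) (by rwa [PadicAlgCl.norm_galois])
    rw [← PadicAlgCl.norm_galois ℓ σ, map_sub, ← AlgEquiv.mul_apply σ σ⁻¹, mul_inv_cancel] at h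
    exact h

variable {ℓ} in
/-- `σ` lifts the geometric Frobenius `Fr(ℓ)`: its inverse induces `x ↦ x ^ ℓ` on the residue
field. -/
def IsGeometricFrobenius (σ : LocalGaloisGroup ℓ) : Prop :=
  ∀ x : PadicAlgCl ℓ, ‖x‖ ≤ 1 → ‖σ⁻¹ x - x ^ ℓ‖ < 1

variable {ℓ} in
/-- `t : I_ℓ → ℤ_p` is the tame character attached to some compatible systems of primitive
`p ^ k`-th roots of unity `ζ k` and of `p ^ k`-th roots `ϖ k` of `ℓ`. -/
def IsTameCharacter {p : ℕ} [Fact p.Prime] (t : inertiaGroup ℓ → ℤ_[p]) : Prop :=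
  ∃ ζ ϖ : ℕ → PadicAlgCl ℓ,
    (∀ k, IsPrimitiveRoot (ζ k) (p ^ k)) ∧ (∀ k, ζ (k + 1) ^ p = ζ k) ∧
    ϖ 0 = (ℓ : PadicAlgCl ℓ) ∧ (∀ k, ϖ (k + 1) ^ p = ϖ k) ∧
    ∀ (τ : inertiaGroup ℓ) (k : ℕ),
      (τ : LocalGaloisGroup ℓ) (ϖ k) = ζ k ^ (PadicInt.toZModPow k (t τ)).val * ϖ k

end LocalGalois

section GlobalGalois

open NumberField

/-- `K` is unramified at all the primes that lie above a prime number outside `S`. -/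
def IsUnramifiedOutside (S : Finset ℕ) (K : IntermediateField ℚ (AlgebraicClosure ℚ)) : Prop :=
  ∀ q : ℕ, q.Prime → q ∉ S → ∀ (P : Ideal (𝓞 K)) [P.IsPrime], (q : 𝓞 K) ∈ P →
    Algebra.IsUnramifiedAt ℤ P

/-- The maximal Galois extension of `ℚ` unramified outside `S` and infinity: the compositum of all
the finite Galois extensions of `ℚ` that are unramified outside `S`. -/
noncomputable def maxUnramifiedOutside (S : Finset ℕ) :
    IntermediateField ℚ (AlgebraicClosure ℚ) :=
  ⨆ K : {K : IntermediateField ℚ (AlgebraicClosure ℚ) //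
    FiniteDimensional ℚ K ∧ IsGalois ℚ K ∧ IsUnramifiedOutside S K}, K.1

instance (S : Finset ℕ) : Normal ℚ (maxUnramifiedOutside S) := by
  have h (K : {K : IntermediateField ℚ (AlgebraicClosure ℚ) //
      FiniteDimensional ℚ K ∧ IsGalois ℚ K ∧ IsUnramifiedOutside S K}) : Normal ℚ K.1 :=
    K.2.2.1.to_normal
  exact IntermediateField.normal_iSup (h := h)

/-- The Galois group `G_{ℚ,S}`, with its Krull topology. -/
abbrev GlobalGaloisGroup (S : Finset ℕ) := Gal(maxUnramifiedOutside S/ℚ)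

/-- The morphism `G_{ℚ_ℓ} → G_{ℚ,S}` attached to an embedding of algebraic closures. -/
noncomputable def localToGlobal {ℓ : ℕ} [Fact ℓ.Prime] (S : Finset ℕ)
    (ι : AlgebraicClosure ℚ →ₐ[ℚ] PadicAlgCl ℓ) : LocalGaloisGroup ℓ →* GlobalGaloisGroup S :=
  letI : Algebra (maxUnramifiedOutside S) (PadicAlgCl ℓ) :=
    (ι.comp (maxUnramifiedOutside S).val).toRingHom.toAlgebra
  haveI : IsScalarTower ℚ (maxUnramifiedOutside S) (PadicAlgCl ℓ) :=
    IsScalarTower.of_algebraMap_eq fun x =>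
      ((ι.comp (maxUnramifiedOutside S).val).commutes x).symm
  (AlgEquiv.restrictNormalHom (maxUnramifiedOutside S)).comp (AlgEquiv.restrictScalarsHom ℚ)

theorem localToGlobal_commutes {ℓ : ℕ} [Fact ℓ.Prime] (S : Finset ℕ)
    (ι : AlgebraicClosure ℚ →ₐ[ℚ] PadicAlgCl ℓ) (σ : LocalGaloisGroup ℓ)
    (x : maxUnramifiedOutside S) : ι (localToGlobal S ι σ x) = σ (ι x) := by
  let : Algebra (maxUnramifiedOutside S) (PadicAlgCl ℓ) :=
    (ι.comp (maxUnramifiedOutside S).val).toRingHom.toAlgebra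
  have : IsScalarTower ℚ (maxUnramifiedOutside S) (PadicAlgCl ℓ) :=
    IsScalarTower.of_algebraMap_eq fun x =>
      ((ι.comp (maxUnramifiedOutside S).val).commutes x).symm
  exact AlgEquiv.restrictNormal_commutes (σ.restrictScalars ℚ) (maxUnramifiedOutside S) x

end GlobalGalois

section Purity

/-- `N` is the monodromy operator of the representation `r` of `G_{ℚ_ℓ}`, with respect to the tame
character `t`: it is nilpotent and `r(τ) = exp(t(τ) N)` for all `τ` in an open subgroup of `I_ℓ`. -/
def IsMonodromyOperator {ℓ p : ℕ} [Fact ℓ.Prime] [Fact p.Prime] {K : Type*} [Field K]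
    [Algebra ℤ_[p] K] {V : Type*} [AddCommGroup V] [Module K V]
    (r : Representation K (LocalGaloisGroup ℓ) V) (t : inertiaGroup ℓ → ℤ_[p])
    (N : Module.End K V) : Prop :=
  IsNilpotent N ∧ ∃ U : Subgroup (inertiaGroup ℓ), IsOpen (U : Set (inertiaGroup ℓ)) ∧ ∀ τ ∈ U,
    r τ = ∑ i ∈ Finset.range (Module.finrank K V),
      ((algebraMap ℤ_[p] K (t τ)) ^ i / (i.factorial : K)) • N ^ i

/-- `M` is the monodromy filtration of the nilpotent endomorphism `N`: the finite increasing
filtration such that `N M_j ⊆ M_{j-2}` and such that `N ^ k` induces an isomorphism from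
`M_k / M_{k-1}` to `M_{-k} / M_{-k-1}` for all `k ≥ 0`. -/
structure IsMonodromyFiltration {K : Type*} [Field K] {V : Type*} [AddCommGroup V] [Module K V]
    (N : Module.End K V) (M : ℤ → Submodule K V) : Prop where
  monotone : Monotone M
  exists_eq_bot : ∃ a, M a = ⊥
  exists_eq_top : ∃ b, M b = ⊤
  map_le : ∀ j, (M j).map N ≤ M (j - 2)
  injective : ∀ (k : ℕ), ∀ x ∈ M k, (N ^ k) x ∈ M (-k - 1) → x ∈ M (k - 1)
  surjective : ∀ (k : ℕ), M (-k) ≤ (M k).map (N ^ k) ⊔ M (-k - 1)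

/-- `α` is an `ℓ`-Weil number of weight `m`: it is algebraic over `ℚ` and all its complex conjugates
have absolute value `ℓ ^ (m / 2)`. -/
def IsWeilNumber (ℓ : ℕ) (m : ℤ) {K : Type*} [Field K] [Algebra ℚ K] (α : K) : Prop :=
  IsAlgebraic ℚ α ∧ ∀ z ∈ (minpoly ℚ α).aroots ℂ, ‖z‖ = (ℓ : ℝ) ^ ((m : ℝ) / 2)

/-- The representation `r` of `G_{ℚ_ℓ}` is pure: for some weight `w`, the eigenvalues of any lift of
the geometric Frobenius on the `j`-th graded part of the monodromy filtration are Weil numbers of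
weight `w + j`. -/
def IsPure {ℓ p : ℕ} [Fact ℓ.Prime] [Fact p.Prime] {V : Type*} [AddCommGroup V]
    [Module (PadicAlgCl p) V] (r : Representation (PadicAlgCl p) (LocalGaloisGroup ℓ) V) : Prop :=
  ∃ (t : inertiaGroup ℓ → ℤ_[p]) (N : Module.End (PadicAlgCl p) V)
    (M : ℤ → Submodule (PadicAlgCl p) V) (w : ℤ),
    IsTameCharacter t ∧ IsMonodromyOperator r t N ∧ IsMonodromyFiltration N M ∧
    ∀ σ : LocalGaloisGroup ℓ, IsGeometricFrobenius σ → ∀ (j : ℤ) (α : PadicAlgCl p),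
      (∃ x ∈ M j, x ∉ M (j - 1) ∧ r σ x - α • x ∈ M (j - 1)) → IsWeilNumber ℓ (w + j) α

end Purity

section Families

open IsLocalRing

/-- The normalization of a domain: its integral closure in its fraction field. -/
abbrev Normalization (R : Type*) [CommRing R] [IsDomain R] := integralClosure R (FractionRing R)

/-- An algebraic closure of the fraction field of a domain. -/
abbrev GeometricField (A : Type*) [CommRing A] [IsDomain A] := AlgebraicClosure (FractionRing A)

/-- A determinant with values in a local ring is continuous, for the adic topology, if the
coefficients of the characteristic polynomials of the elements of the group are continuous. -/
def Determinant.IsContinuous {A : Type*} [CommRing A] [IsLocalRing A] {G : Type*} [Group G]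
    [TopologicalSpace G] {n : ℕ} (D : Determinant A G n) : Prop :=
  ∀ i : ℕ, @Continuous G A inferInstance (maximalIdeal A).adicTopology
    fun g => (D.charpoly g).coeff i

/-- `ρ` is the semisimple representation attached to the `A`-valued determinant `D`: `D`, seen with
values in the `A`-field `K`, is equal to `det ∘ ρ`. -/
structure Determinant.IsAttachedTo {A : Type*} [CommRing A] {G : Type*} [Group G] {n : ℕ}
    (D : Determinant A G n) {K : Type*} [Field K] [Algebra A K] {V : Type*} [AddCommGroup V]
    [Module K V] [Module.Finite K V] (ρ : Representation K G V) : Prop where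
  isSemisimple : ρ.IsSemisimpleRepresentation
  eq_det : (D.baseChange (algebraMap A K)).toPolynomialLaw =
    (Determinant.ofRepresentation ρ).toPolynomialLaw

/-- The specialization `ψ` of the family attached to `D` is pure at `ℓ`: the semisimple
representation attached to `D_ψ = ψ ∘ D` is pure after restriction to `G_{ℚ_ℓ}`. -/
def Determinant.IsPureSpecialization {ℓ p : ℕ} [Fact ℓ.Prime] [Fact p.Prime] {S : Finset ℕ}
    (ι : AlgebraicClosure ℚ →ₐ[ℚ] PadicAlgCl ℓ) {A : Type*} [CommRing A] {n : ℕ}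
    (D : Determinant A (GlobalGaloisGroup S) n) (ψ : A →+* PadicAlgCl p) : Prop :=
  ∃ ρ : Representation (PadicAlgCl p) (GlobalGaloisGroup S) (Fin n → PadicAlgCl p),
    (D.baseChange ψ).IsAttachedTo ρ ∧ IsPure (ρ.comp (localToGlobal S ι))

end Families

section EulerFactors

variable {ℓ : ℕ} [Fact ℓ.Prime]

/-- The determinant `D^{I_ℓ}` on `G_{ℚ_ℓ} / I_ℓ`: the determinant of the action of
`G_{ℚ_ℓ} / I_ℓ` on the `I_ℓ`-invariants of the representation `r`. -/
noncomputable def inertiaDeterminant {K : Type*} [Field K] {V : Type*} [AddCommGroup V] [Module K V]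
    [Module.Finite K V] (r : Representation K (LocalGaloisGroup ℓ) V) :
    Determinant K (LocalGaloisGroup ℓ ⧸ inertiaGroup ℓ)
      (Module.finrank K (Representation.invariants (r.comp (inertiaGroup ℓ).subtype))) :=
  Determinant.ofRepresentation (r.quotientToInvariants (inertiaGroup ℓ))

/-- `P ∈ A[X]` is the algebraic local Euler factor of the representation `r` with coefficients in
the `A`-field `K`: it is the characteristic polynomial `χ(D^{I_ℓ}, Fr(ℓ))`, where `σ` is a lift of
`Fr(ℓ)`. -/
def IsEulerFactor {A : Type*} [CommRing A] {K : Type*} [Field K] [Algebra A K] {V : Type*}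
    [AddCommGroup V] [Module K V] [Module.Finite K V]
    (r : Representation K (LocalGaloisGroup ℓ) V) (σ : LocalGaloisGroup ℓ) (P : A[X]) : Prop :=
  P.map (algebraMap A K) =
    (inertiaDeterminant r).charpoly (σ : LocalGaloisGroup ℓ ⧸ inertiaGroup ℓ)

open Classical in
/-- The algebraic local Euler factor, as a polynomial with coefficients in `A` (with value `0` if
`χ(D^{I_ℓ}, Fr(ℓ))` does not have coefficients in `A`). -/
noncomputable def eulerFactor (A : Type*) [CommRing A] {K : Type*} [Field K] [Algebra A K]
    {V : Type*} [AddCommGroup V] [Module K V] [Module.Finite K V]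
    (r : Representation K (LocalGaloisGroup ℓ) V) (σ : LocalGaloisGroup ℓ) : A[X] :=
  if h : ∃ P : A[X], IsEulerFactor r σ P then h.choose else 0

end EulerFactors

section LocalDeterminants

/-- The determinant `Λ^r M₀ ⊗ (Λ^r M₁)⁻¹` of a complex `f : M₀ → M₁` of projective modules of
constant rank `r` placed in degrees 0 and 1. -/
abbrev TwoTermDet {A : Type*} [CommRing A] (r : ℕ) {M₀ M₁ : Type*} [AddCommGroup M₀] [Module A M₀]
    [AddCommGroup M₁] [Module A M₁] (_f : M₀ →ₗ[A] M₁) :=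
  (⋀[A]^r M₀) ⊗[A] Module.Dual A (⋀[A]^r M₁)

/-- The canonical map from the determinant of `f : M₀ → M₁` to `A`, which sends `x ⊗ u` to
`u (Λ^r f x)`. If `f` is an isomorphism over the total ring of fractions `Q(A)`, its composition with
`A → Q(A)` is the map induced by the canonical trivialization of the determinant of the acyclic
complex `f ⊗ Q(A)`. -/
noncomputable def TwoTermDet.can {A : Type*} [CommRing A] (r : ℕ) {M₀ M₁ : Type*}
    [AddCommGroup M₀] [Module A M₀] [AddCommGroup M₁] [Module A M₁] (f : M₀ →ₗ[A] M₁) :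
    TwoTermDet r f →ₗ[A] A :=
  contractRight A (⋀[A]^r M₁) ∘ₗ TensorProduct.map (exteriorPower.map r f) LinearMap.id

/-- The determinant over `A[X]` of the complex `A[X] → A[X]`, in degrees 0 and 1, given by
multiplication by `P`. For `P` the algebraic local Euler factor at `ℓ`, this is the algebraic local
polynomial determinant at `ℓ`. -/
abbrev PolynomialDet {A : Type*} [CommRing A] (P : A[X]) :=
  TwoTermDet 1 (LinearMap.mulLeft A[X] P)

/-- The canonical map from `PolynomialDet P` to `A[X]`. -/
noncomputable abbrev PolynomialDet.can {A : Type*} [CommRing A] (P : A[X]) :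
    PolynomialDet P →ₗ[A[X]] A[X] :=
  TwoTermDet.can 1 (LinearMap.mulLeft A[X] P)

/-- There is one and only one isomorphism between `PolynomialDet Q` and the base change along
`φ : A → B` of `PolynomialDet P` that is compatible with the canonical maps of these determinants to
`B[X]` and `A[X]`. -/
def PolynomialDet.HasCanonicalIso {A B : Type*} [CommRing A] [CommRing B] (φ : A →+* B) (P : A[X])
    (Q : B[X]) : Prop :=
  letI : Algebra A[X] B[X] := (Polynomial.mapRingHom φ).toAlgebra
  ∃! θ : PolynomialDet Q ≃ₗ[B[X]] B[X] ⊗[A[X]] PolynomialDet P,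
    ∀ x : PolynomialDet P,
      PolynomialDet.can Q (θ.symm (1 ⊗ₜ[A[X]] x)) = (PolynomialDet.can P x).map φ

end LocalDeterminants

/-! The proof takes place in the image `E` of the group algebra `R[G]` under the generic
representation. Traces embed `E` in a finite free `R`-module, so `E` is a finite `R`-algebra in
which the group maps continuously. Moreover `E` acts on every specialization: the rank of an element
of the group algebra cannot increase under specialization (`finrank_range_act_le`), so an element
that acts as zero generically acts as zero everywhere (`ker_act_le`).

Let `t : I_ℓ → ℤ_p` be a tame character. Its kernel has order prime to `p` and acts on `E` through a
finite group. On the part fixed by this kernel, inertia is governed by one element `τ`, and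
conjugation by Frobenius raises `τ` to the power `ℓ`, so that `τ` is quasi-unipotent. Hence there is
an element `ε` of `E`, in the image of `ℤ[I_ℓ]`, which at every point is a nonzero integer multiple
`m` of the projector onto the part `W` where inertia is unipotent (`exists_isUnipotentProjector`).
The ranks of `ε` and of `m - ε` do not increase, so `dim W` is constant and the eigenvalues of
Frobenius on `W` specialize. The invariants of inertia are the kernel in `W` of the logarithm `N` of
`τ`; their dimension can only grow under specialization.

Let `s` be the action of Frobenius on `W`. As `N s = ℓ s N`, the operator `N` maps the sum `W_S` of
the generalized eigenspaces for the eigenvalues in a set `S` to `W_S'`, where `S' = {β | ℓ β ∈ S}`.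
Hence `dim ker N ≥ dim W_S - dim W_S'`. At a pure point equality holds for the set `S` of Weil
numbers of weight at most `w`. The Frobenius eigenvalues lie in the integral closure of the
normalization in an algebraic closure, and those whose image at the pure point lies in `S` can be
selected at any point between the generic one and the pure one. Semicontinuity of `dim ker N` forces
equality at all these points. Then `ker N` is the kernel of a surjection `W_S → W_S'`, so the
eigenvalues on the invariants are those of `W_S` with `ℓ` times those of `W_S'` removed. This
description is the same at all these points, so the Euler factors specialize.

Galois conjugation of the generic point is a particular case; therefore the generic Euler factor is
Galois invariant and descends to the normal domain. The polynomial determinants are free of rank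
one, with canonical maps that amount to multiplication by Euler factors of constant term one; this
gives the isomorphism and its uniqueness. -/

namespace Determinant

/-! ### Values of determinants and attached representations, along a ring morphism -/

section Attached

variable {A : Type u} [CommRing A] {G : Type v} [Group G] {n : ℕ}

theorem mapAlgHom_eq_mapRingHom {S T : Type*} [CommSemiring S] [Algebra A S] [CommSemiring T]
    [Algebra A T] (f : S →ₐ[A] T) (x : S[G]) :
    MonoidAlgebra.mapAlgHom G f x = MonoidAlgebra.mapRingHom G f.toRingHom x := by
  induction x using MonoidAlgebra.induction_linear with
  | zero => simp
  | add x y hx hy => simp only [map_add, hx, hy]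
  | single g s => simp

/-- The values of a base change, over an algebra in any universe. -/
theorem eval_baseChange (D : Determinant A G n) {B : Type w} [CommRing B] (φ : A →+* B)
    {S : Type*} [CommSemiring S] [Algebra B S] (x : S[G]) :
    (D.baseChange φ).eval S x = D.evalAlong φ S x := by
  -- The values of `baseChange` are prescribed only in the universe of `B`. Every element of `S[G]`
  -- comes from an algebra in that universe, and both sides are natural.
  obtain ⟨C, _, _, f, _, x, _, -, rfl, -⟩ := exists_lift₂ (A := B) (1 : S) x x
  rw [eval_map, evalAlong_map]
  congr 1
  exact eval_ofEval C x

theorem evalAlong_baseChange (D : Determinant A G n) {B : Type w} [CommRing B] (φ : A →+* B)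
    {C : Type*} [CommRing C] (χ : B →+* C) {S : Type*} [CommSemiring S] [Algebra C S] (x : S[G]) :
    (D.baseChange φ).evalAlong χ S x = D.evalAlong (χ.comp φ) S x := by
  let := algebraAlong χ S
  exact eval_baseChange D φ x

/-- Naturality for a commutative square of ring morphisms, so that no `A`-algebra structure has to
be fixed on `S`. -/
theorem evalAlong_mapRingHom (D : Determinant A G n) {K : Type*} [CommRing K] (f : A →+* K)
    {S : Type*} [CommRing S] [Algebra K S] {B : Type*} [CommRing B] [Algebra A B] (h : B →+* S)
    (hh : h.comp (algebraMap A B) = (algebraMap K S).comp f) (x : B[G]) :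
    D.evalAlong f S (MonoidAlgebra.mapRingHom G h x) = h (D.eval B x) := by
  let := algebraAlong f S
  let h' : B →ₐ[A] S := ⟨h, fun a => DFunLike.congr_fun hh a⟩
  have := D.eval_map h' x
  rw [mapAlgHom_eq_mapRingHom] at this
  exact this

theorem eval_ofRepresentation {K : Type w} [Field K] {V : Type*} [AddCommGroup V] [Module K V]
    [Module.Finite K V] (ρ : Representation K G V) (S : Type w) [CommRing S] [Algebra K S]
    (x : S[G]) : (ofRepresentation ρ).eval S x = LinearMap.det (actionOn ρ S x) := by
  rw [ofRepresentation, eval_ofEval]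
  -- `ofRepresentation` computes with the ring structure `commRingOfAlgebra K S`. Naturality along
  -- the identity, with this structure on the target and the given one on the source, removes it.
  have h := @det_actionOn_map K _ G _ V _ _ _ ρ S S _ (commRingOfAlgebra K S) _ _
    (AlgHom.id K S) x
  have e : MonoidAlgebra.mapAlgHom G (AlgHom.id K S) x = x := by ext; simp
  rw [e] at h
  exact h

/-- `ρ` is a semisimple representation over `K` whose determinant is that of `D` along `f`. -/
structure IsAttachedAlong (D : Determinant A G n) {K : Type w} [Field K] (f : A →+* K)
    {V : Type*} [AddCommGroup V] [Module K V] [Module.Finite K V] (ρ : Representation K G V) :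
    Prop where
  isSemisimple : ρ.IsSemisimpleRepresentation
  det_eq : ∀ (S : Type w) [CommRing S] [Algebra K S] (x : S[G]),
    LinearMap.det (actionOn ρ S x) = D.evalAlong f S x

theorem IsAttachedTo.isAttachedAlong {D : Determinant A G n} {K : Type w} [Field K] [Algebra A K]
    {V : Type*} [AddCommGroup V] [Module K V] [Module.Finite K V] {ρ : Representation K G V}
    (h : D.IsAttachedTo ρ) : D.IsAttachedAlong (algebraMap A K) ρ where
  isSemisimple := h.isSemisimple
  det_eq S _ _ x := by
    have e : (D.baseChange (algebraMap A K)).eval S x = (ofRepresentation ρ).eval S x := by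
      simp only [eval, h.eq_det]
    rw [eval_baseChange] at e
    rw [e, eval_ofRepresentation]

theorem IsAttachedAlong.of_baseChange {D : Determinant A G n} {B : Type*} [CommRing B]
    {φ : A →+* B} {K : Type w} [Field K] {f : B →+* K}
    {V : Type*} [AddCommGroup V] [Module K V] [Module.Finite K V] {ρ : Representation K G V}
    (h : (D.baseChange φ).IsAttachedAlong f ρ) : D.IsAttachedAlong (f.comp φ) ρ where
  isSemisimple := h.isSemisimple
  det_eq S _ _ x := by rw [h.det_eq, evalAlong_baseChange]

theorem IsAttachedAlong.det_actionOn {D : Determinant A G n} {K : Type w} [Field K] {f : A →+* K}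
    {V : Type*} [AddCommGroup V] [Module K V] [Module.Finite K V] {ρ : Representation K G V}
    (hρ : D.IsAttachedAlong f ρ) {S : Type w} [CommRing S] [Algebra K S] {B : Type*} [CommRing B]
    [Algebra A B] (h : B →+* S) (hh : h.comp (algebraMap A B) = (algebraMap K S).comp f)
    (x : B[G]) :
    LinearMap.det (actionOn ρ S (MonoidAlgebra.mapRingHom G h x)) = h (D.eval B x) := by
  rw [hρ.det_eq, evalAlong_mapRingHom D f h hh]

end Attached

end Determinant

/-! ### The rank of an endomorphism, read off the degree of a determinant -/

section RankFactorization

variable {K : Type*} [Field K] {V : Type*} [AddCommGroup V] [Module K V] [Module.Finite K V]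
  {ι : Type*} [Fintype ι] [DecidableEq ι]

/-- The matrix of an endomorphism of rank `r` factors through `K ^ r`. -/
theorem LinearMap.exists_toMatrix_eq_mul (b : Module.Basis ι K V) (x : Module.End K V) :
    ∃ (B : Matrix ι (Fin (Module.finrank K x.range)) K)
      (C : Matrix (Fin (Module.finrank K x.range)) ι K),
      LinearMap.toMatrix b b x = B * C ∧ (IsIdempotentElem x → C * B = 1) := by
  classical
  let c := Module.finBasis K x.range
  refine ⟨LinearMap.toMatrix c b x.range.subtype, LinearMap.toMatrix b c x.rangeRestrict, ?_, ?_⟩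
  · rw [← LinearMap.toMatrix_comp b c b]
    rfl
  · intro hx
    rw [← LinearMap.toMatrix_comp c b c, ← LinearMap.toMatrix_id c]
    congr 1
    ext ⟨_, v, rfl⟩
    exact DFunLike.congr_fun hx v

/-- `det (1 + X B C) = det (1 + X C B)`, and the second determinant has size `r`. -/
theorem Matrix.natDegree_det_one_add_X_smul_mul_le {R : Type*} [CommRing R] {r : ℕ}
    (B : Matrix ι (Fin r) R) (C : Matrix (Fin r) ι R) :
    (1 + (Polynomial.X : R[X]) • (B * C).map Polynomial.C).det.natDegree ≤ r := by
  have h : (1 + (Polynomial.X : R[X]) • (B * C).map Polynomial.C).det =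
      ((Polynomial.X : R[X]) • (C * B).map Polynomial.C +
        (1 : Matrix (Fin r) (Fin r) R).map Polynomial.C).det := by
    rw [Matrix.map_mul, Matrix.map_mul, Matrix.map_one _ (map_zero _) (map_one _),
      ← Matrix.smul_mul, Matrix.det_one_add_mul_comm, Matrix.mul_smul, add_comm]
  rw [h]
  simpa using Polynomial.natDegree_det_X_add_C_le (C * B) 1

theorem Matrix.det_one_add_X_smul_mul_of_mul_eq_one {R : Type*} [CommRing R] {r : ℕ}
    (B : Matrix ι (Fin r) R) (C : Matrix (Fin r) ι R) (h : C * B = 1) :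
    (1 + (Polynomial.X : R[X]) • (B * C).map Polynomial.C).det = (1 + Polynomial.X) ^ r := by
  rw [Matrix.map_mul, ← Matrix.smul_mul, Matrix.det_one_add_mul_comm, Matrix.mul_smul,
    ← Matrix.map_mul, h, Matrix.map_one _ (map_zero _) (map_one _),
    ← one_smul R[X] (1 : Matrix (Fin r) (Fin r) R[X]), smul_smul, ← add_smul, Matrix.det_smul]
  simp

end RankFactorization

namespace Representation

variable {K : Type w} [Field K] {G : Type v} [Group G] {V : Type*} [AddCommGroup V] [Module K V]

/-- The image of the group algebra under a semisimple representation is von Neumann regular. -/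
theorem IsSemisimpleRepresentation.exists_mul_mul_eq [Module.Finite K V]
    {ρ : Representation K G V} (hρ : ρ.IsSemisimpleRepresentation) (x : K[G]) :
    ∃ y : K[G], ρ.asAlgebraHom (x * y * x) = ρ.asAlgebraHom x := by
  have : IsSemisimpleModule K[G] ρ.asModule :=
    isSemisimpleRepresentation_iff_isSemisimpleModule_asModule ρ |>.1 hρ
  let b := Module.finBasis K V
  -- `ev` sends an element to its action on a basis, so its range is the image of `K[G]`, a
  -- semisimple left module. Decompose `1 = y x + q` in it, with `q` in a complement of `K[G] x`.
  -- Then `x - x y x = x q` lies both in `K[G] x` and in the complement, hence vanishes.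
  let ev : K[G] →ₗ[K[G]] (Fin (Module.finrank K V) → ρ.asModule) :=
    LinearMap.toSpanSingleton K[G] _ fun i => ρ.asModuleEquiv.symm (b i)
  let P : Submodule K[G] (LinearMap.range ev) :=
    (Submodule.span K[G] {x}).map ev.rangeRestrict
  obtain ⟨Q, hQ⟩ := exists_isCompl P
  obtain ⟨p, hp, q, hq, hpq⟩ := Submodule.mem_sup.1
    (hQ.sup_eq_top ▸ Submodule.mem_top : ev.rangeRestrict 1 ∈ P ⊔ Q)
  obtain ⟨_, hz, rfl⟩ := hp
  obtain ⟨y, rfl⟩ := Submodule.mem_span_singleton.1 hz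
  refine ⟨y, ?_⟩
  have h1 : ev.rangeRestrict x - ev.rangeRestrict (x * y * x) = x • q := by
    have := congrArg (x • ·) hpq
    simp only [smul_add, ← map_smul, smul_eq_mul, mul_one] at this
    rw [← this, mul_assoc, add_sub_cancel_left]
  have h2 : x • q ∈ P := by
    rw [← h1, ← map_sub]
    refine Submodule.mem_map_of_mem (Submodule.sub_mem _ (Submodule.mem_span_singleton_self x) ?_)
    exact Submodule.mem_span_singleton.2 ⟨x * y, rfl⟩
  have h3 : x • q = 0 := by
    have := hQ.disjoint.le_bot (show x • q ∈ P ⊓ Q from ⟨h2, Q.smul_mem x hq⟩)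
    simpa using this
  rw [h3, sub_eq_zero] at h1
  refine (b.ext fun i => ?_).symm
  have h4 := congrFun (congrArg Subtype.val h1) i
  exact h4

end Representation

/-! ### Ranks of elements of the group algebra under specialization -/

namespace Determinant

section Action

variable {A : Type u} [CommRing A] {G : Type v} [Group G] {n : ℕ}
  {K : Type w} [Field K] {V : Type*} [AddCommGroup V] [Module K V]

/-- The action on `V` of the group algebra with coefficients in `A`, along `f : A → K`. -/
noncomputable def act (f : A →+* K) (ρ : Representation K G V) : A[G] →+* Module.End K V :=
  ρ.asAlgebraHom.toRingHom.comp (MonoidAlgebra.mapRingHom G f)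

theorem act_single (f : A →+* K) (ρ : Representation K G V) (g : G) (a : A) :
    act f ρ (MonoidAlgebra.single g a) = f a • ρ g := by
  simp [act]

variable [Module.Finite K V]

/-- The matrix by which an element of `S[G]` acts on `S ⊗ V`. -/
noncomputable def matrixOn {ι : Type*} [Fintype ι] [DecidableEq ι] (b : Module.Basis ι K V)
    (ρ : Representation K G V) (S : Type*) [CommRing S] [Algebra K S] :
    S[G] →ₐ[S] Matrix ι ι S :=
  (LinearMap.toMatrixAlgEquiv (b.baseChange S)).toAlgHom.comp (actionOn ρ S)

omit [Module.Finite K V] in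
theorem det_matrixOn {ι : Type*} [Fintype ι] [DecidableEq ι] (b : Module.Basis ι K V)
    (ρ : Representation K G V) {S : Type*} [CommRing S] [Algebra K S] (x : S[G]) :
    (matrixOn b ρ S x).det = LinearMap.det (actionOn ρ S x) :=
  LinearMap.det_toMatrix (b.baseChange S) _

omit [Module.Finite K V] in
theorem matrixOn_single {ι : Type*} [Fintype ι] [DecidableEq ι] (b : Module.Basis ι K V)
    (ρ : Representation K G V) {S : Type*} [CommRing S] [Algebra K S] (g : G) (s : S) :
    matrixOn b ρ S (MonoidAlgebra.single g s) =
      s • (LinearMap.toMatrix b b (ρ g)).map (algebraMap K S) := by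
  ext i j
  simp [matrixOn, actionOn_single, LinearMap.toMatrixAlgEquiv_apply, LinearMap.toMatrix_apply,
    Algebra.algebraMap_eq_smul_one]

omit [Module.Finite K V] in
theorem matrixOn_map {ι : Type*} [Fintype ι] [DecidableEq ι] (b : Module.Basis ι K V)
    (ρ : Representation K G V) {S : Type*} [CommRing S] [Algebra K S] {S' : Type*} [CommRing S']
    [Algebra K S'] (h : S →+* S') (hh : h.comp (algebraMap K S) = algebraMap K S') (x : S[G]) :
    matrixOn b ρ S' (MonoidAlgebra.mapRingHom G h x) = (matrixOn b ρ S x).map h := by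
  induction x using MonoidAlgebra.induction_linear with
  | zero => ext; simp
  | add x y hx hy => simp only [map_add, hx, hy]; ext; simp
  | single g s =>
    simp only [MonoidAlgebra.mapRingHom_single, matrixOn_single]
    ext i j
    simp [← hh]

omit [Module.Finite K V] in
theorem matrixOn_act {ι : Type*} [Fintype ι] [DecidableEq ι] (b : Module.Basis ι K V)
    (ρ : Representation K G V) {S : Type*} [CommRing S] [Algebra K S] (f : A →+* K) (x : A[G]) :
    matrixOn b ρ S (MonoidAlgebra.mapRingHom G ((algebraMap K S).comp f) x) =
      (LinearMap.toMatrix b b (act f ρ x)).map (algebraMap K S) := by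
  induction x using MonoidAlgebra.induction_linear with
  | zero => ext; simp
  | add x y hx hy => simp only [map_add, hx, hy]; ext; simp
  | single g s =>
    simp only [MonoidAlgebra.mapRingHom_single, matrixOn_single, act_single]
    ext i j
    simp

end Action

section Specialization

variable {A : Type u} [CommRing A] {G : Type v} [Group G] {n : ℕ} {D : Determinant A G n}
  {K : Type w} [Field K] {f : A →+* K} {V : Type*} [AddCommGroup V] [Module K V]
  [Module.Finite K V] {ρ : Representation K G V}

/-- The characteristic polynomial of an element of the group algebra. -/
noncomputable def algebraCharpoly (D : Determinant A G n) (x : A[G]) : A[X] :=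
  D.eval A[X] (MonoidAlgebra.single 1 Polynomial.X - MonoidAlgebra.mapRingHom G Polynomial.C x)

theorem IsAttachedAlong.charpoly_act (hρ : D.IsAttachedAlong f ρ) (x : A[G]) :
    (act f ρ x).charpoly = (D.algebraCharpoly x).map f := by
  classical
  rw [algebraCharpoly]
  let b := Module.finBasis K V
  have h := hρ.det_actionOn (S := K[X]) (Polynomial.mapRingHom f)
    (by ext; simp [Polynomial.algebraMap_eq])
    (MonoidAlgebra.single 1 Polynomial.X - MonoidAlgebra.mapRingHom G Polynomial.C x)
  rw [Polynomial.coe_mapRingHom] at h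
  rw [← h, ← det_matrixOn b, map_sub, map_sub, ← RingHom.comp_apply, ← MonoidAlgebra.mapRingHom_comp,
    MonoidAlgebra.mapRingHom_single, matrixOn_single,
    show (Polynomial.mapRingHom f).comp Polynomial.C = (algebraMap K K[X]).comp f by
      ext; simp [Polynomial.algebraMap_eq], matrixOn_act, ← LinearMap.charpoly_toMatrix _ b,
    Matrix.charpoly, Matrix.charmatrix]
  congr 1
  ext i j
  simp [Polynomial.algebraMap_eq, Matrix.scalar_apply, Matrix.one_apply, Matrix.diagonal_apply,
    LinearMap.toMatrix_one]

omit [Group G] in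
theorem exists_sum_single {K : Type*} [Semiring K] (y : K[G]) :
    ∃ (m : ℕ) (g : Fin m → G) (c : Fin m → K), y = ∑ i, MonoidAlgebra.single (g i) (c i) := by
  induction y using MonoidAlgebra.induction_linear with
  | zero => exact ⟨0, Fin.elim0, Fin.elim0, by simp⟩
  | single g s => exact ⟨1, fun _ => g, fun _ => s, by simp⟩
  | add x y hx hy =>
    obtain ⟨m, g, c, rfl⟩ := hx
    obtain ⟨m', g', c', rfl⟩ := hy
    exact ⟨m + m', Fin.append g g', Fin.append c c', by simp [Fin.sum_univ_add]⟩

/-- Specialization does not increase the rank of the elements of the group algebra. -/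
theorem finrank_range_act_le (hρ : D.IsAttachedAlong f ρ)
    {K' : Type*} [Field K'] {f' : A →+* K'} {V' : Type*} [AddCommGroup V'] [Module K' V']
    [Module.Finite K' V'] {ρ' : Representation K' G V'} (hρ' : D.IsAttachedAlong f' ρ')
    (hff' : RingHom.ker f ≤ RingHom.ker f') (x : A[G]) :
    Module.finrank K' (act f' ρ' x).range ≤ Module.finrank K (act f ρ x).range := by
  classical
  set r := Module.finrank K (act f ρ x).range
  obtain ⟨y, hy⟩ := hρ'.isSemisimple.exists_mul_mul_eq (MonoidAlgebra.mapRingHom G f' x)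
  obtain ⟨m, g, c, rfl⟩ := exists_sum_single y
  -- `Q = D(1 + X x Y)`, where `Y` is a combination of the `g i` with indeterminate coefficients. At
  -- the first point its degree in `X` is at most the rank `r` of `x`. At the second point put `Y =
  -- y`: since `x y x = x`, the product `x y` is an idempotent with the same range as `x`, and `Q`
  -- becomes a power of `1 + X` whose exponent is the rank of `x`.
  let Y : (MvPolynomial (Fin m) A)[X][G] :=
    ∑ i, MonoidAlgebra.single (g i) (Polynomial.C (MvPolynomial.X i))
  let z : (MvPolynomial (Fin m) A)[X][G] :=
    1 + (Polynomial.X : (MvPolynomial (Fin m) A)[X]) •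
      (MonoidAlgebra.mapRingHom G (Polynomial.C.comp MvPolynomial.C) x * Y)
  let Q := D.eval _ z
  -- the degree of `Q` at the first representation
  have hQ : ∀ k, r < k → MvPolynomial.map f (Q.coeff k) = 0 := by
    intro k hk
    let b := Module.finBasis K V
    have h := hρ.det_actionOn (S := (MvPolynomial (Fin m) K)[X])
      (Polynomial.mapRingHom (MvPolynomial.map f))
      (by ext a; simp [Polynomial.algebraMap_apply, MvPolynomial.algebraMap_eq]) z
    obtain ⟨B, C, hBC, -⟩ := LinearMap.exists_toMatrix_eq_mul b (act f ρ x)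
    let Y' : Matrix _ _ (MvPolynomial (Fin m) K) := matrixOn b ρ (MvPolynomial (Fin m) K)
      (∑ i, MonoidAlgebra.single (g i) (MvPolynomial.X i))
    let B' : Matrix _ _ (MvPolynomial (Fin m) K) := B.map MvPolynomial.C
    let C' : Matrix _ _ (MvPolynomial (Fin m) K) := C.map MvPolynomial.C
    have e : matrixOn b ρ (MvPolynomial (Fin m) K)[X] (MonoidAlgebra.mapRingHom G
        (Polynomial.mapRingHom (MvPolynomial.map f)) z) =
        1 + (Polynomial.X : (MvPolynomial (Fin m) K)[X]) •
          (B' * (C' * Y')).map Polynomial.C := by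
      have e1 : MonoidAlgebra.mapRingHom G (Polynomial.mapRingHom (MvPolynomial.map f)) z =
          1 + (Polynomial.X : (MvPolynomial (Fin m) K)[X]) •
            (MonoidAlgebra.mapRingHom G ((algebraMap K (MvPolynomial (Fin m) K)[X]).comp f) x *
              MonoidAlgebra.mapRingHom G Polynomial.C
                (∑ i, MonoidAlgebra.single (g i) (MvPolynomial.X i))) := by
        have e2 : ∀ w : (MvPolynomial (Fin m) A)[X][G],
            MonoidAlgebra.mapRingHom G (Polynomial.mapRingHom (MvPolynomial.map f))
              ((Polynomial.X : (MvPolynomial (Fin m) A)[X]) • w) =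
            (Polynomial.X : (MvPolynomial (Fin m) K)[X]) •
              MonoidAlgebra.mapRingHom G (Polynomial.mapRingHom (MvPolynomial.map f)) w := by
          intro w
          ext; simp
        simp only [z, map_add, map_one, e2, map_mul]
        have e3 : (Polynomial.mapRingHom (MvPolynomial.map f)).comp
            (Polynomial.C.comp (MvPolynomial.C (σ := Fin m))) =
            (algebraMap K (MvPolynomial (Fin m) K)[X]).comp f := by
          ext; simp [Polynomial.algebraMap_apply, MvPolynomial.algebraMap_eq]
        rw [← RingHom.comp_apply, ← MonoidAlgebra.mapRingHom_comp, e3]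
        simp [Y]
      rw [e1, map_add, map_one, map_smul, map_mul, matrixOn_act, hBC,
        matrixOn_map b ρ Polynomial.C (by ext; simp [Polynomial.algebraMap_apply])]
      congr 2
      rw [← Matrix.mul_assoc, Matrix.map_mul (f := Polynomial.C)]
      congr 1
      rw [← Matrix.map_mul, Matrix.map_map]
      rfl
    rw [← det_matrixOn b, e] at h
    have := Matrix.natDegree_det_one_add_X_smul_mul_le B' (C' * Y')
    rw [h] at this
    have := Polynomial.coeff_eq_zero_of_natDegree_lt (lt_of_le_of_lt this hk)
    simpa using this
  -- the value of `Q` at the second representation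
  let h' : (MvPolynomial (Fin m) A)[X] →+* K'[X] :=
    Polynomial.mapRingHom (MvPolynomial.eval₂Hom f' c)
  have hdeg : (h' Q).natDegree ≤ r := by
    rw [Polynomial.natDegree_le_iff_coeff_eq_zero]
    intro k hk
    -- The coefficients of the polynomial `Q.coeff k` belong to `ker f`, hence to `ker f'`.
    have h1 : MvPolynomial.map f' (Q.coeff k) = 0 := by
      ext d
      have := congrArg (MvPolynomial.coeff d) (hQ k hk)
      rw [MvPolynomial.coeff_map, MvPolynomial.coeff_zero] at this ⊢
      exact hff' this
    simp only [h', Polynomial.coe_mapRingHom, Polynomial.coeff_map, MvPolynomial.coe_eval₂Hom]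
    rw [← MvPolynomial.eval_map, h1, map_zero]
  let b := Module.finBasis K' V'
  have h := hρ'.det_actionOn (S := K'[X]) h'
    (by ext a; simp [h', Polynomial.algebraMap_eq, Polynomial.algebraMap_apply,
      MvPolynomial.algebraMap_eq]) z
  set y := ∑ i, MonoidAlgebra.single (g i) (c i)
  set e : Module.End K' V' := ρ'.asAlgebraHom (MonoidAlgebra.mapRingHom G f' x * y) with he
  have hid : IsIdempotentElem e := by
    rw [IsIdempotentElem, he, ← map_mul, ← mul_assoc, map_mul, hy, ← map_mul]
  have hrange : e.range = (act f' ρ' x).range := by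
    apply le_antisymm
    · rw [he, map_mul]
      exact LinearMap.range_comp_le_range _ _
    · have : act f' ρ' x = e * act f' ρ' x := by
        rw [he, show act f' ρ' x = ρ'.asAlgebraHom (MonoidAlgebra.mapRingHom G f' x) from rfl,
          ← map_mul, hy]
      rw [this]
      exact LinearMap.range_comp_le_range _ _
  obtain ⟨B, C, hBC, hCB⟩ := LinearMap.exists_toMatrix_eq_mul b e
  have e1 : MonoidAlgebra.mapRingHom G h' z =
      1 + (Polynomial.X : K'[X]) • MonoidAlgebra.mapRingHom G ((algebraMap K' K'[X]).comp
        (RingHom.id K')) (MonoidAlgebra.mapRingHom G f' x * y) := by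
    have e2 : ∀ w : (MvPolynomial (Fin m) A)[X][G],
        MonoidAlgebra.mapRingHom G h' ((Polynomial.X : (MvPolynomial (Fin m) A)[X]) • w) =
        (Polynomial.X : K'[X]) • MonoidAlgebra.mapRingHom G h' w := by
      intro w
      ext; simp [h']
    simp only [z, map_add, map_one, e2, map_mul]
    have e3 : h'.comp (Polynomial.C.comp MvPolynomial.C) =
        ((algebraMap K' K'[X]).comp (RingHom.id K')).comp f' := by
      ext; simp [h']
    rw [← RingHom.comp_apply, ← MonoidAlgebra.mapRingHom_comp, ← RingHom.comp_apply,
      ← MonoidAlgebra.mapRingHom_comp, e3]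
    simp [Y, y, h']
  have e3 : act (RingHom.id K') ρ' (MonoidAlgebra.mapRingHom G f' x * y) = e := by
    rw [he, act, MonoidAlgebra.mapRingHom_id]; rfl
  rw [← det_matrixOn b, e1, map_add, map_one, map_smul, matrixOn_act, e3, hBC] at h
  have h2 := Matrix.det_one_add_X_smul_mul_of_mul_eq_one B C (hCB hid)
  rw [← Polynomial.algebraMap_eq] at h2
  rw [h] at h2
  rw [h2, add_comm, ← Polynomial.C_1, Polynomial.natDegree_pow, Polynomial.natDegree_X_add_C, mul_one] at hdeg
  rwa [hrange] at hdeg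

end Specialization

end Determinant

/-! ### Norms, roots of unity and open subgroups over `ℚ_ℓ` -/

section LocalFields

variable {ℓ : ℕ} [Fact ℓ.Prime]

namespace PadicAlgCl

theorem norm_sub_le_max (x y : PadicAlgCl ℓ) : ‖x - y‖ ≤ max ‖x‖ ‖y‖ := by
  simpa [sub_eq_add_neg] using isNonarchimedean ℓ x (-y)

theorem norm_natCast_of_coprime {n : ℕ} (hn : ℓ.Coprime n) : ‖(n : PadicAlgCl ℓ)‖ = 1 := by
  rw [← map_natCast (algebraMap ℚ_[ℓ] (PadicAlgCl ℓ)), norm_extends]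
  exact Padic.norm_natCast_eq_one_iff.2 hn

theorem norm_prime : ‖(ℓ : PadicAlgCl ℓ)‖ = (ℓ : ℝ)⁻¹ := by
  rw [← map_natCast (algebraMap ℚ_[ℓ] (PadicAlgCl ℓ)), norm_extends]
  exact Padic.norm_p

theorem norm_eq_one_of_pow_eq_one {z : PadicAlgCl ℓ} {n : ℕ} (hn : n ≠ 0) (hz : z ^ n = 1) :
    ‖z‖ = 1 := by
  rw [← pow_eq_one_iff_of_nonneg (norm_nonneg z) hn, ← norm_pow, hz, norm_one]

/-- Distinct roots of unity of order prime to `ℓ` are not congruent. -/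
theorem norm_sub_one_eq_one {z : PadicAlgCl ℓ} {n : ℕ} (hn : ℓ.Coprime n) (hn0 : n ≠ 0)
    (hz : z ^ n = 1) (hz1 : z ≠ 1) : ‖z - 1‖ = 1 := by
  obtain ⟨m, hm, hmp⟩ : ∃ m, m ∣ n ∧ IsPrimitiveRoot z m :=
    ⟨orderOf z, orderOf_dvd_of_pow_eq_one hz, IsPrimitiveRoot.orderOf z⟩
  have hm0 : m ≠ 0 := ne_zero_of_dvd_ne_zero hn0 hm
  have hm1 : m ≠ 1 := by
    rintro rfl
    exact hz1 (by simpa using hmp.pow_eq_one)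
  obtain ⟨k, rfl⟩ : ∃ k, m = k + 1 + 1 := ⟨m - 2, by lia⟩
  -- The product of the `1 - z ^ i`, for `0 < i < m`, is `m`, of norm one. All the factors have norm
  -- at most one, so they all have norm one.
  have hprod := congrArg norm hmp.prod_one_sub_pow_eq_order
  rw [norm_prod, show (((k + 1 : ℕ) : PadicAlgCl ℓ) + 1) = ((k + 1 + 1 : ℕ) : PadicAlgCl ℓ) by
    push_cast; ring, norm_natCast_of_coprime (hn.coprime_dvd_right hm)] at hprod
  have hle (i : ℕ) : ‖1 - z ^ (i + 1)‖ ≤ 1 := by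
    refine (PadicAlgCl.norm_sub_le_max _ _).trans ?_
    rw [norm_one, norm_pow, norm_eq_one_of_pow_eq_one hn0 hz, one_pow, max_self]
  rw [Finset.prod_range_succ'] at hprod
  rw [zero_add, pow_one] at hprod
  rw [norm_sub_rev]
  refine le_antisymm (by simpa using hle 0) ?_
  calc (1 : ℝ) = _ := hprod.symm
    _ ≤ 1 * ‖1 - z‖ := by
      gcongr
      exact Finset.prod_le_one (fun _ _ => norm_nonneg _) fun i _ => hle _
    _ = _ := one_mul _

/-- The norm is the spectral value of the minimal polynomial. It is attained by some term, which is
a root of the norm of an element of `ℚ_ℓ`. -/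
theorem exists_norm_pow_eq_zpow {x : PadicAlgCl ℓ} (hx : x ≠ 0) :
    ∃ (d : ℕ) (k : ℤ), d ≠ 0 ∧ ‖x‖ ^ d = (ℓ : ℝ) ^ k := by
  have h : ‖x‖ = spectralValue (minpoly ℚ_[ℓ] x) := rfl
  obtain ⟨i, hi⟩ : ∃ i, spectralValueTerms (minpoly ℚ_[ℓ] x) i = ‖x‖ := by
    rw [h, spectralValue]
    have hf := spectralValueTerms_finite_range (minpoly ℚ_[ℓ] x)
    exact (Set.range_nonempty _).csSup_mem hf
  rw [spectralValueTerms] at hi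
  split_ifs at hi with hlt
  · obtain ⟨d, hd⟩ : ∃ d, (minpoly ℚ_[ℓ] x).natDegree = i + d := ⟨_, (Nat.add_sub_of_le hlt.le).symm⟩
    have hd0 : d ≠ 0 := by lia
    have hd' : (1 / (((minpoly ℚ_[ℓ] x).natDegree : ℝ) - i)) = ((d : ℝ))⁻¹ := by
      rw [hd]; push_cast; simp
    have hpow : ‖x‖ ^ d = ‖(minpoly ℚ_[ℓ] x).coeff i‖ := by
      rw [← hi, hd', Real.rpow_inv_natCast_pow (norm_nonneg _) hd0]
    have hc : (minpoly ℚ_[ℓ] x).coeff i ≠ 0 := by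
      intro hc
      rw [hc, norm_zero, pow_eq_zero_iff hd0, norm_eq_zero] at hpow
      exact hx hpow
    exact ⟨d, _, hd0, hpow.trans (Padic.norm_eq_zpow_neg_valuation hc)⟩
  · exact absurd (norm_eq_zero.1 hi.symm) hx

end PadicAlgCl

namespace LocalGaloisGroup

/-- `γ x` depends only on the coset of `γ` modulo the stabilizer of `x`, which is open. -/
theorem isOpen_setOf_apply (P : PadicAlgCl ℓ → Prop) (x : PadicAlgCl ℓ) :
    IsOpen {γ : LocalGaloisGroup ℓ | P (γ x)} := by
  rw [isOpen_iff_mem_nhds]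
  intro γ hγ
  have h1 := stabilizer_isOpen_of_isIntegral (K := ℚ_[ℓ]) x
  have h2 := h1.leftCoset γ
  refine Filter.mem_of_superset (h2.mem_nhds ⟨1, by simp, by simp⟩) ?_
  rintro _ ⟨δ, hδ, rfl⟩
  have : δ x = x := hδ
  simpa [this] using hγ

theorem isClosed_setOf_apply (P : PadicAlgCl ℓ → Prop) (x : PadicAlgCl ℓ) :
    IsClosed {γ : LocalGaloisGroup ℓ | P (γ x)} :=
  ⟨isOpen_setOf_apply (fun y => ¬ P y) x⟩

theorem isClosed_inertiaGroup : IsClosed (inertiaGroup ℓ : Set (LocalGaloisGroup ℓ)) := by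
  have : (inertiaGroup ℓ : Set (LocalGaloisGroup ℓ)) =
      ⋂ x : {x : PadicAlgCl ℓ // ‖x‖ ≤ 1}, {γ | ‖γ x.1 - x.1‖ < 1} := by
    ext γ
    simp only [Set.mem_iInter, Subtype.forall]
    rfl
  rw [this]
  exact isClosed_iInter fun x => isClosed_setOf_apply (fun y => ‖y - x.1‖ < 1) x.1

theorem exists_pow_mem (U : Subgroup (LocalGaloisGroup ℓ))
    (hU : IsOpen (U : Set (LocalGaloisGroup ℓ)))
    (γ : LocalGaloisGroup ℓ) : ∃ r, 0 < r ∧ γ ^ r ∈ U := by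
  have := Subgroup.quotient_finite_of_isOpen U hU
  obtain ⟨r, h, -, h'⟩ := Subgroup.exists_pow_mem_of_index_ne_zero (H := U)
    (Subgroup.index_ne_zero_of_finite) γ
  exact ⟨r, h, h'⟩

end LocalGaloisGroup

section RootsOfUnity

variable {n : ℕ} {z : PadicAlgCl ℓ}

/-- `τ z / z` is a root of unity of order prime to `ℓ` and is congruent to `1`, hence is `1`. The
same argument, with `z ^ ℓ`, applies to Frobenius below. -/
theorem apply_rootOfUnity_of_mem_inertia (hn : ℓ.Coprime n) (hn0 : n ≠ 0) (hz : z ^ n = 1)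
    {τ : LocalGaloisGroup ℓ} (hτ : τ ∈ inertiaGroup ℓ) : τ z = z := by
  have hz1 := PadicAlgCl.norm_eq_one_of_pow_eq_one hn0 hz
  have hz0 : z ≠ 0 := by rintro rfl; simp at hz1
  by_contra h
  have h1 := PadicAlgCl.norm_sub_one_eq_one (z := τ z / z) hn hn0
    (by rw [div_pow, ← map_pow, hz, map_one, div_one]) (by rwa [ne_eq, div_eq_one_iff_eq hz0])
  have h2 := hτ z hz1.le
  rw [div_sub_one hz0, norm_div, hz1, div_one] at h1
  exact h2.ne h1

theorem IsGeometricFrobenius.inv_apply_rootOfUnity {σ : LocalGaloisGroup ℓ}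
    (hσ : IsGeometricFrobenius σ) (hn : ℓ.Coprime n) (hn0 : n ≠ 0) (hz : z ^ n = 1) :
    σ⁻¹ z = z ^ ℓ := by
  have hz1 := PadicAlgCl.norm_eq_one_of_pow_eq_one hn0 hz
  have hz0 : z ≠ 0 := by rintro rfl; simp at hz1
  have hz0' : z ^ ℓ ≠ 0 := pow_ne_zero _ hz0
  by_contra h
  have h1 := PadicAlgCl.norm_sub_one_eq_one (z := σ⁻¹ z / z ^ ℓ) hn hn0
    (by rw [div_pow, ← map_pow, hz, map_one, ← pow_mul, mul_comm, pow_mul, hz]; simp)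
    (by rwa [ne_eq, div_eq_one_iff_eq hz0'])
  have h2 := hσ z hz1.le
  rw [div_sub_one hz0', norm_div, norm_pow, hz1, one_pow, div_one] at h1
  exact h2.ne h1

/-- A geometric Frobenius commutes with the Galois group modulo inertia. -/
theorem IsGeometricFrobenius.commutator_mem {σ : LocalGaloisGroup ℓ}
    (hσ : IsGeometricFrobenius σ) (γ : LocalGaloisGroup ℓ) :
    (σ⁻¹ * γ)⁻¹ * (γ * σ⁻¹) ∈ inertiaGroup ℓ := by
  intro x hx
  rw [← PadicAlgCl.norm_galois ℓ (σ⁻¹ * γ), map_sub, ← AlgEquiv.mul_apply, mul_inv_cancel_left,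
    AlgEquiv.mul_apply, AlgEquiv.mul_apply]
  have h1 := hσ x hx
  rw [← PadicAlgCl.norm_galois ℓ γ, map_sub, map_pow] at h1
  have h2 := hσ (γ x) (by rwa [PadicAlgCl.norm_galois])
  -- Both terms are congruent to `γ x ^ ℓ`.
  rw [show γ (σ⁻¹ x) - σ⁻¹ (γ x) = (γ (σ⁻¹ x) - γ x ^ ℓ) - (σ⁻¹ (γ x) - γ x ^ ℓ) by ring]
  exact (PadicAlgCl.norm_sub_le_max _ _).trans_lt (max_lt h1 h2)

end RootsOfUnity

end LocalFields

/-! ### The tame character: additivity, conjugation, kernel and nontriviality -/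

section TameCharacter

variable {ℓ p : ℕ} [Fact ℓ.Prime] [Fact p.Prime] {t : inertiaGroup ℓ → ℤ_[p]}

theorem coprime_prime_pow (hℓp : ℓ ≠ p) (k : ℕ) : ℓ.Coprime (p ^ k) :=
  ((Nat.coprime_primes Fact.out Fact.out).2 hℓp).pow_right k

/-- The roots of `ℓ` and of unity that define a tame character, with the characterization of its
values. -/
structure TameSystem (t : inertiaGroup ℓ → ℤ_[p]) where
  /-- roots of unity -/
  ζ : ℕ → PadicAlgCl ℓ
  /-- roots of `ℓ` -/
  ϖ : ℕ → PadicAlgCl ℓ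
  primitive : ∀ k, IsPrimitiveRoot (ζ k) (p ^ k)
  ϖ_pow : ∀ k, ϖ k ^ p ^ k = ℓ
  ϖ_succ : ∀ k, ϖ (k + 1) ^ p = ϖ k
  apply_eq_iff : ∀ (τ : inertiaGroup ℓ) (k a : ℕ),
    (τ : LocalGaloisGroup ℓ) (ϖ k) = ζ k ^ a * ϖ k ↔ PadicInt.toZModPow k (t τ) = a

theorem IsTameCharacter.nonempty_tameSystem (ht : IsTameCharacter t) :
    Nonempty (TameSystem t) := by
  obtain ⟨ζ, ϖ, h1, h2, h3, h4, h5⟩ := ht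
  have hϖ (k : ℕ) : ϖ k ^ p ^ k = ℓ := by
    induction k with
    | zero => simp [h3]
    | succ k ih => rw [pow_succ' p, pow_mul, h4, ih]
  refine ⟨⟨ζ, ϖ, h1, hϖ, h4, fun τ k a => ?_⟩⟩
  have h0 : ϖ k ≠ 0 := by
    intro h
    have := hϖ k
    rw [h, zero_pow (pow_ne_zero _ (Fact.out : p.Prime).ne_zero)] at this
    exact (Fact.out : ℓ.Prime).ne_zero (by exact_mod_cast this.symm)
  rw [h5, mul_left_inj' h0]
  have hζ : IsUnit (ζ k) := (h1 k).isUnit (pow_ne_zero _ (Fact.out : p.Prime).ne_zero)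
  have : NeZero (p ^ k) := ⟨pow_ne_zero _ (Fact.out : p.Prime).ne_zero⟩
  obtain ⟨u, hu⟩ := hζ
  have hu1 : IsPrimitiveRoot u (p ^ k) := by
    rw [← IsPrimitiveRoot.coe_units_iff, hu]; exact h1 k
  rw [← hu, ← Units.val_pow_eq_pow_val, ← Units.val_pow_eq_pow_val, Units.val_inj,
    pow_eq_pow_iff_modEq, ← hu1.eq_orderOf, ← ZMod.natCast_eq_natCast_iff, ZMod.natCast_zmod_val]

namespace TameSystem

variable (s : TameSystem t)

include s in
theorem norm_ϖ_pow (k : ℕ) : ‖s.ϖ k‖ ^ p ^ k = (ℓ : ℝ)⁻¹ := by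
  rw [← norm_pow, s.ϖ_pow, PadicAlgCl.norm_prime]

theorem ϖ_ne_zero (k : ℕ) : s.ϖ k ≠ 0 := by
  intro h
  have := s.ϖ_pow k
  rw [h, zero_pow (pow_ne_zero _ (Fact.out : p.Prime).ne_zero)] at this
  exact (Fact.out : ℓ.Prime).ne_zero (by exact_mod_cast this.symm)

theorem apply_ϖ (τ : inertiaGroup ℓ) (k : ℕ) :
    (τ : LocalGaloisGroup ℓ) (s.ϖ k) =
      s.ζ k ^ (PadicInt.toZModPow k (t τ)).val * s.ϖ k := by
  have : NeZero (p ^ k) := ⟨pow_ne_zero _ (Fact.out : p.Prime).ne_zero⟩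
  rw [s.apply_eq_iff, ZMod.natCast_zmod_val]

theorem apply_ϖ_eq_self_iff (τ : inertiaGroup ℓ) (k : ℕ) :
    (τ : LocalGaloisGroup ℓ) (s.ϖ k) = s.ϖ k ↔ (p : ℤ_[p]) ^ k ∣ t τ := by
  have := s.apply_eq_iff τ k 0
  rw [pow_zero, one_mul, Nat.cast_zero] at this
  rw [this, ← RingHom.mem_ker, PadicInt.ker_toZModPow, Ideal.mem_span_singleton]

theorem eq_zero_iff (τ : inertiaGroup ℓ) :
    t τ = 0 ↔ ∀ k, (τ : LocalGaloisGroup ℓ) (s.ϖ k) = s.ϖ k := by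
  rw [← PadicInt.ext_of_toZModPow]
  refine forall_congr' fun k => ?_
  rw [s.apply_ϖ_eq_self_iff, ← Ideal.mem_span_singleton, ← PadicInt.ker_toZModPow,
    RingHom.mem_ker, map_zero]

/-- An element of the Galois group multiplies `ϖ k` by a root of unity. -/
theorem exists_apply_ϖ (γ : LocalGaloisGroup ℓ) (k : ℕ) :
    ∃ w, w ^ p ^ k = 1 ∧ γ (s.ϖ k) = w * s.ϖ k := by
  refine ⟨γ (s.ϖ k) / s.ϖ k, ?_, (div_mul_cancel₀ _ (s.ϖ_ne_zero k)).symm⟩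
  rw [div_pow, ← map_pow, s.ϖ_pow, map_natCast, div_self]
  exact_mod_cast (Fact.out : ℓ.Prime).ne_zero

variable (hℓp : ℓ ≠ p)

include s hℓp

theorem apply_ζ (τ : inertiaGroup ℓ) (k : ℕ) : (τ : LocalGaloisGroup ℓ) (s.ζ k) = s.ζ k :=
  apply_rootOfUnity_of_mem_inertia (coprime_prime_pow hℓp k)
    (pow_ne_zero _ (Fact.out : p.Prime).ne_zero) (s.primitive k).pow_eq_one τ.2

/-- The Kummer cocycle is additive on inertia because inertia fixes the `ζ k`. -/
theorem map_mul (τ τ' : inertiaGroup ℓ) : t (τ * τ') = t τ + t τ' := by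
  rw [← PadicInt.ext_of_toZModPow]
  intro k
  have : NeZero (p ^ k) := ⟨pow_ne_zero _ (Fact.out : p.Prime).ne_zero⟩
  have h : ((τ * τ' : inertiaGroup ℓ) : LocalGaloisGroup ℓ) (s.ϖ k) =
      s.ζ k ^ ((PadicInt.toZModPow k (t τ)).val + (PadicInt.toZModPow k (t τ')).val) * s.ϖ k := by
    rw [Subgroup.coe_mul, AlgEquiv.mul_apply, s.apply_ϖ, _root_.map_mul, map_pow, s.apply_ζ hℓp,
      s.apply_ϖ]
    ring
  rw [s.apply_eq_iff] at h
  rw [h, map_add]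
  push_cast
  rw [ZMod.natCast_zmod_val, ZMod.natCast_zmod_val]

theorem map_one : t 1 = 0 := by
  have := s.map_mul hℓp 1 1
  rw [one_mul] at this
  exact left_eq_add.1 this

theorem map_inv (τ : inertiaGroup ℓ) : t τ⁻¹ = - t τ := by
  have := s.map_mul hℓp τ⁻¹ τ
  rw [inv_mul_cancel, s.map_one hℓp] at this
  exact eq_neg_of_add_eq_zero_left this.symm

theorem map_pow (τ : inertiaGroup ℓ) (m : ℕ) : t (τ ^ m) = m * t τ := by
  induction m with
  | zero => simp [s.map_one hℓp]
  | succ m ih => rw [pow_succ, s.map_mul hℓp, ih]; push_cast; ring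

/-- `σ⁻¹` raises the roots of unity of order `p ^ k` to the power `ℓ`. The root of unity `w` by
which `σ` multiplies `ϖ k` is fixed by `τ`, so it does not contribute. -/
theorem map_conj_frobenius {σ : LocalGaloisGroup ℓ} (hσ : IsGeometricFrobenius σ)
    (τ τ' : inertiaGroup ℓ) (h : (τ' : LocalGaloisGroup ℓ) = σ⁻¹ * τ * σ) : t τ' = ℓ * t τ := by
  rw [← PadicInt.ext_of_toZModPow]
  intro k
  have hp0 : p ^ k ≠ 0 := pow_ne_zero _ (Fact.out : p.Prime).ne_zero
  have : NeZero (p ^ k) := ⟨hp0⟩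
  obtain ⟨w, hw, hσw⟩ := s.exists_apply_ϖ σ k
  have hF : σ⁻¹ (w * s.ϖ k) = s.ϖ k := by
    rw [← hσw, ← AlgEquiv.mul_apply, inv_mul_cancel, AlgEquiv.one_apply]
  have e : (τ' : LocalGaloisGroup ℓ) (s.ϖ k) =
      s.ζ k ^ (ℓ * (PadicInt.toZModPow k (t τ)).val) * s.ϖ k := by
    rw [h, AlgEquiv.mul_apply, AlgEquiv.mul_apply, hσw, _root_.map_mul,
      apply_rootOfUnity_of_mem_inertia (coprime_prime_pow hℓp k) hp0 hw τ.2, s.apply_ϖ,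
      mul_left_comm, _root_.map_mul, _root_.map_pow,
      hσ.inv_apply_rootOfUnity (coprime_prime_pow hℓp k) hp0 (s.primitive k).pow_eq_one, hF,
      ← pow_mul]
  rw [s.apply_eq_iff] at e
  rw [e, _root_.map_mul, map_natCast]
  push_cast
  rw [ZMod.natCast_zmod_val]

theorem map_conj_eq_zero (γ : LocalGaloisGroup ℓ) (τ τ' : inertiaGroup ℓ)
    (h : (τ' : LocalGaloisGroup ℓ) = γ * τ * γ⁻¹) (hτ : t τ = 0) : t τ' = 0 := by
  rw [s.eq_zero_iff] at hτ ⊢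
  intro k
  obtain ⟨w, hw, hγ⟩ := s.exists_apply_ϖ γ⁻¹ k
  rw [h, AlgEquiv.mul_apply, AlgEquiv.mul_apply, hγ, _root_.map_mul,
    apply_rootOfUnity_of_mem_inertia (coprime_prime_pow hℓp k)
      (pow_ne_zero _ (Fact.out : p.Prime).ne_zero) hw τ.2, hτ k, ← hγ, ← AlgEquiv.mul_apply,
    mul_inv_cancel, AlgEquiv.one_apply]

/-- The kernel of a tame character has no eigenvector with eigenvalue a nontrivial `p`-th root of
unity. -/
theorem eq_one_of_apply_eq_mul {τ : inertiaGroup ℓ} (hτ : t τ = 0) {z w : PadicAlgCl ℓ}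
    (hz : z ≠ 0) (hw : w ^ p = 1) (h : (τ : LocalGaloisGroup ℓ) z = w * z) : w = 1 := by
  by_contra hw1
  have hp : p.Prime := Fact.out
  have hℓ : ℓ.Prime := Fact.out
  have hℓ0 : (ℓ : ℝ) ≠ 0 := by exact_mod_cast hℓ.ne_zero
  obtain ⟨d, k, hd, hk⟩ := PadicAlgCl.exists_norm_pow_eq_zpow hz
  obtain ⟨a, b, hb, rfl⟩ := Nat.exists_eq_pow_mul_and_not_dvd hd p hp.ne_one
  -- Here `‖z‖ ^ (p ^ a * b) = ℓ ^ k` with `b` prime to `p`, while `‖ϖ a‖ ^ p ^ a = ℓ⁻¹`; so `u` has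
  -- norm one. As `τ` fixes `ϖ a`, it multiplies `u` by `w ^ b`, which is not `1`, hence not
  -- congruent to `1`. This contradicts that `τ` is in inertia.
  set u := z ^ b * s.ϖ a ^ k with hu
  have hu1 : ‖u‖ = 1 := by
    rw [← pow_eq_one_iff_of_nonneg (norm_nonneg u) (pow_ne_zero a hp.ne_zero), hu, norm_mul,
      norm_pow, norm_zpow, mul_pow, ← pow_mul, mul_comm b, hk, ← zpow_natCast, ← zpow_mul,
      mul_comm k, zpow_mul, zpow_natCast, s.norm_ϖ_pow, inv_zpow, mul_inv_cancel₀]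
    exact zpow_ne_zero _ hℓ0
  have hτu : (τ : LocalGaloisGroup ℓ) u = w ^ b * u := by
    rw [hu, _root_.map_mul, _root_.map_pow, h, map_zpow₀, (s.eq_zero_iff τ).1 hτ a]
    ring
  have hwb : w ^ b ≠ 1 := by
    intro hwb
    have hc : p.Coprime b := (hp.coprime_iff_not_dvd).2 hb
    exact hw1 (by simpa [hc.gcd_eq_one] using pow_gcd_eq_one.2 ⟨hw, hwb⟩)
  have h1 := PadicAlgCl.norm_sub_one_eq_one (z := w ^ b) (n := p ^ 1) (coprime_prime_pow hℓp 1)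
    (by simpa using hp.ne_zero) (by rw [pow_one, ← pow_mul, mul_comm, pow_mul, hw, one_pow]) hwb
  have h2 := τ.2 u hu1.le
  rw [hτu, ← sub_one_mul, norm_mul, h1, hu1, one_mul] at h2
  exact lt_irrefl _ h2

/-- The kernel of a tame character `t : I_ℓ → ℤ_p` has order prime to `p`. -/
theorem exists_coprime_pow_mem (τ : inertiaGroup ℓ) (hτ : t τ = 0)
    (U : Subgroup (LocalGaloisGroup ℓ)) (hU : IsOpen (U : Set (LocalGaloisGroup ℓ))) :
    ∃ m, p.Coprime m ∧ (τ : LocalGaloisGroup ℓ) ^ m ∈ U := by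
  have hp : p.Prime := Fact.out
  obtain ⟨E, hE, hEU⟩ := (krullTopology_mem_nhds_one_iff ℚ_[ℓ] (PadicAlgCl ℓ) U).1
    (hU.mem_nhds U.one_mem)
  suffices h : ∃ m, p.Coprime m ∧ (τ : LocalGaloisGroup ℓ) ^ m ∈ E.fixingSubgroup by
    obtain ⟨m, h1, h2⟩ := h
    exact ⟨m, h1, hEU h2⟩
  obtain ⟨r, hr, hrE⟩ := LocalGaloisGroup.exists_pow_mem E.fixingSubgroup E.fixingSubgroup_isOpen τ
  obtain ⟨a, m, hm, rfl⟩ := Nat.exists_eq_pow_mul_and_not_dvd hr.ne' p hp.ne_one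
  refine ⟨m, (hp.coprime_iff_not_dvd).2 hm, ?_⟩
  clear hr
  induction a with
  | zero => simpa using hrE
  | succ a ih =>
    apply ih
    by_contra hg
    set g : inertiaGroup ℓ := τ ^ (p ^ a * m) with hgdef
    have hgt : t g = 0 := by rw [hgdef, s.map_pow hℓp, hτ, mul_zero]
    have hg' : (g : LocalGaloisGroup ℓ) ∉ E.fixingSubgroup := by simpa [hgdef] using hg
    have hgp : (g : LocalGaloisGroup ℓ) ^ p ∈ E.fixingSubgroup := by
      rw [hgdef, Subgroup.coe_pow, ← pow_mul]
      rwa [show p ^ a * m * p = p ^ (a + 1) * m by ring]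
    apply hg'
    rw [IntermediateField.mem_fixingSubgroup_iff] at hgp ⊢
    intro x hx
    have hgx : ((g : LocalGaloisGroup ℓ) ^ p) x = x := hgp x hx
    have hζ : IsPrimitiveRoot (s.ζ 1) p := by simpa using s.primitive 1
    -- Lagrange resolvents of `x` for `g`, which acts on `x` with order dividing `p`. For `c ≠ 0` a
    -- nonzero resolvent would be an eigenvector for a nontrivial `p`-th root of unity. So only `y
    -- 0` survives: it equals `p x` and it is fixed by `g`.
    let y (c : ℕ) : PadicAlgCl ℓ :=
      ∑ i ∈ Finset.range p, s.ζ 1 ^ (c * i) * ((g : LocalGaloisGroup ℓ) ^ i) x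
    have hgy (c : ℕ) : s.ζ 1 ^ c * (g : LocalGaloisGroup ℓ) (y c) = y c := by
      have h1 : s.ζ 1 ^ c * (g : LocalGaloisGroup ℓ) (y c) =
          ∑ i ∈ Finset.range p, s.ζ 1 ^ (c * (i + 1)) * ((g : LocalGaloisGroup ℓ) ^ (i + 1)) x := by
        rw [map_sum, Finset.mul_sum]
        refine Finset.sum_congr rfl fun i _ => ?_
        rw [_root_.map_mul, _root_.map_pow, s.apply_ζ hℓp, pow_succ' (g : LocalGaloisGroup ℓ),
          AlgEquiv.mul_apply]
        ring
      rw [h1]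
      have h2 := Finset.sum_range_succ'
        (fun i => s.ζ 1 ^ (c * i) * ((g : LocalGaloisGroup ℓ) ^ i) x) p
      have h3 := Finset.sum_range_succ
        (fun i => s.ζ 1 ^ (c * i) * ((g : LocalGaloisGroup ℓ) ^ i) x) p
      have h4 : s.ζ 1 ^ (c * p) = 1 := by rw [mul_comm, pow_mul, hζ.pow_eq_one, one_pow]
      rw [h2, hgx, h4] at h3
      simpa [y] using h3
    have hy (c : ℕ) (hc0 : c ≠ 0) (hc : c < p) : y c = 0 := by
      by_contra hyc
      have hζ0 : s.ζ 1 ^ c ≠ 0 := pow_ne_zero _ (hζ.ne_zero hp.ne_zero)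
      have h1 : (g : LocalGaloisGroup ℓ) (y c) = (s.ζ 1 ^ c)⁻¹ * y c := by
        rw [eq_inv_mul_iff_mul_eq₀ hζ0, hgy]
      have h2 := s.eq_one_of_apply_eq_mul hℓp hgt hyc
        (by rw [inv_pow, ← pow_mul, mul_comm, pow_mul, hζ.pow_eq_one, one_pow, inv_one]) h1
      exact hζ.pow_ne_one_of_pos_of_lt hc0 hc (inv_eq_one.1 h2)
    have hsum : ∑ c ∈ Finset.range p, y c = p * x := by
      simp only [y]
      rw [Finset.sum_comm, Finset.sum_eq_single 0]
      · simp
      · intro i hi hi0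
        rw [← Finset.sum_mul]
        have : ∑ c ∈ Finset.range p, s.ζ 1 ^ (c * i) = 0 := by
          have hprim : IsPrimitiveRoot (s.ζ 1 ^ i) p := hζ.pow_of_coprime i
            ((hp.coprime_iff_not_dvd.2 fun hd => absurd (Nat.le_of_dvd (Nat.pos_of_ne_zero hi0) hd)
              (not_le.2 (Finset.mem_range.1 hi))).symm)
          simpa only [← pow_mul, mul_comm i] using hprim.geom_sum_eq_zero hp.one_lt
        rw [this, zero_mul]
      · intro h; exact absurd (Finset.mem_range.2 hp.pos) h
    rw [Finset.sum_eq_single 0 (fun c hc hc0 => hy c hc0 (Finset.mem_range.1 hc))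
      (fun h => absurd (Finset.mem_range.2 hp.pos) h)] at hsum
    have h0 := hgy 0
    rw [pow_zero, one_mul, hsum, _root_.map_mul, map_natCast] at h0
    exact mul_left_cancel₀ (by exact_mod_cast hp.ne_zero) h0

/-- A tame character is not trivial. -/
theorem exists_ne_zero {σ : LocalGaloisGroup ℓ} (hσ : IsGeometricFrobenius σ) :
    ∃ τ, t τ ≠ 0 := by
  by_contra! h0
  have hp : p.Prime := Fact.out
  have hℓ : ℓ.Prime := Fact.out
  have hI (τ : LocalGaloisGroup ℓ) (hτ : τ ∈ inertiaGroup ℓ) (k : ℕ) : τ (s.ϖ k) = s.ϖ k :=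
    (s.eq_zero_iff ⟨τ, hτ⟩).1 (h0 _) k
  have hcomm (γ : LocalGaloisGroup ℓ) (k : ℕ) : γ (σ⁻¹ (s.ϖ k)) = σ⁻¹ (γ (s.ϖ k)) := by
    have := congrArg (σ⁻¹ * γ) (hI _ (hσ.commutator_mem γ) k)
    rwa [← AlgEquiv.mul_apply, mul_inv_cancel_left, AlgEquiv.mul_apply, AlgEquiv.mul_apply] at this
  -- If `t` vanished, inertia would fix `ϖ ℓ`, and this quotient would be fixed by the whole Galois
  -- group: an element `γ` multiplies numerator and denominator by the same `w ^ ℓ`. But its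
  -- valuation would be `(ℓ - 1) / p ^ ℓ`, which is not an integer. The level `ℓ` is chosen only to
  -- have `ℓ < p ^ ℓ`.
  set y := s.ϖ ℓ ^ ℓ / σ⁻¹ (s.ϖ ℓ) with hy
  have hp0 : p ^ ℓ ≠ 0 := pow_ne_zero _ hp.ne_zero
  have hfix (γ : LocalGaloisGroup ℓ) : γ y = y := by
    obtain ⟨w, hw, hγ⟩ := s.exists_apply_ϖ γ ℓ
    have hw0 : w ≠ 0 := by rintro rfl; rw [zero_pow hp0] at hw; exact zero_ne_one hw
    rw [hy, map_div₀, _root_.map_pow, hcomm, hγ, _root_.map_mul,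
      hσ.inv_apply_rootOfUnity (coprime_prime_pow hℓp ℓ) hp0 hw, mul_pow, mul_div_mul_left]
    exact pow_ne_zero _ hw0
  obtain ⟨q, hq⟩ := (InfiniteGalois.mem_range_algebraMap_iff_fixed y).2 hfix
  have hϖ0 : ‖s.ϖ ℓ‖ ≠ 0 := norm_ne_zero_iff.2 (s.ϖ_ne_zero ℓ)
  have hy0 : y ≠ 0 := div_ne_zero (pow_ne_zero _ (s.ϖ_ne_zero ℓ))
    ((map_ne_zero σ⁻¹).2 (s.ϖ_ne_zero ℓ))
  have hq0 : q ≠ 0 := by rintro rfl; exact hy0 (by rw [← hq, map_zero])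
  have hnorm : ‖y‖ * ‖s.ϖ ℓ‖ = ‖s.ϖ ℓ‖ ^ ℓ := by
    rw [hy, norm_div, norm_pow, PadicAlgCl.norm_galois, div_mul_cancel₀ _ hϖ0]
  rw [← hq, PadicAlgCl.norm_extends, Padic.norm_eq_zpow_neg_valuation hq0] at hnorm
  have hnorm2 := congrArg (· ^ p ^ ℓ) hnorm
  simp only [mul_pow] at hnorm2
  rw [← pow_mul _ ℓ, mul_comm ℓ, pow_mul _ _ ℓ, s.norm_ϖ_pow, ← zpow_natCast, ← zpow_mul,
    ← zpow_neg_one, ← zpow_add₀ (by exact_mod_cast hℓ.ne_zero), ← zpow_natCast, ← zpow_mul] at hnorm2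
  have hinj := zpow_right_injective₀ (a := (ℓ : ℝ)) (by exact_mod_cast hℓ.pos)
    (by exact_mod_cast hℓ.ne_one) hnorm2
  push_cast at hinj
  have hdvd : (p ^ ℓ : ℕ) ∣ ℓ - 1 := by
    have : ((p ^ ℓ : ℕ) : ℤ) ∣ ((ℓ - 1 : ℕ) : ℤ) := by
      refine ⟨q.valuation, ?_⟩
      rw [Nat.cast_sub hℓ.one_le]
      push_cast
      linarith
    exact_mod_cast this
  have h1 : p ^ ℓ ≤ ℓ - 1 := Nat.le_of_dvd (Nat.sub_pos_of_lt hℓ.one_lt) hdvd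
  have h2 : ℓ < p ^ ℓ := Nat.lt_pow_self hp.one_lt
  lia

omit hℓp in
/-- Inertia elements whose tame character is small are close to the kernel of the tame character. -/
theorem exists_mul_mem (U : Subgroup (LocalGaloisGroup ℓ))
    (hU : IsOpen (U : Set (LocalGaloisGroup ℓ))) :
    ∃ c : ℕ, ∀ h : inertiaGroup ℓ, (p : ℤ_[p]) ^ c ∣ t h →
      ∃ j : inertiaGroup ℓ, t j = 0 ∧ (j : LocalGaloisGroup ℓ)⁻¹ * h ∈ U := by
  -- The compact sets `Z c` decrease to the kernel of `t`, so one of them is contained in the open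
  -- neighbourhood of this kernel made of its left translates of `U`.
  let Z (c : ℕ) : Set (LocalGaloisGroup ℓ) :=
    (inertiaGroup ℓ : Set (LocalGaloisGroup ℓ)) ∩ {γ | γ (s.ϖ c) = s.ϖ c}
  have hZc (c : ℕ) : IsClosed (Z c) := LocalGaloisGroup.isClosed_inertiaGroup.inter
    (LocalGaloisGroup.isClosed_setOf_apply (fun y => y = s.ϖ c) _)
  have hanti : Antitone Z := by
    refine antitone_nat_of_succ_le fun c γ hγ => ⟨hγ.1, ?_⟩
    have : γ (s.ϖ (c + 1)) = s.ϖ (c + 1) := hγ.2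
    change γ (s.ϖ c) = s.ϖ c
    rw [← s.ϖ_succ, _root_.map_pow, this]
  obtain ⟨c, hc⟩ := exists_subset_nhds_of_isCompact' (V := Z)
    (U := ⋃ j : {j : inertiaGroup ℓ // t j = 0}, {γ | ((j : inertiaGroup ℓ) : LocalGaloisGroup ℓ)⁻¹ * γ ∈ U})
    (directed_of_isDirected_le fun _ _ h => hanti h) (fun c => (hZc c).isCompact) hZc (by
      intro γ hγ
      rw [Set.mem_iInter] at hγ
      refine IsOpen.mem_nhds (isOpen_iUnion fun j => ?_) ?_
      · exact hU.preimage (continuous_const_mul (j.1 : LocalGaloisGroup ℓ)⁻¹)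
      · rw [Set.mem_iUnion]
        exact ⟨⟨⟨γ, (hγ 0).1⟩, (s.eq_zero_iff _).2 fun k => (hγ k).2⟩, by simp⟩)
  refine ⟨c, fun h hh => ?_⟩
  obtain ⟨j, hj⟩ := Set.mem_iUnion.1 (hc (show (h : LocalGaloisGroup ℓ) ∈ Z c from
    ⟨h.2, (s.apply_ϖ_eq_self_iff h c).2 hh⟩))
  exact ⟨j.1, j.2, hj⟩

end TameSystem

end TameCharacter

/-! ### Continuity of the map from the local to the global Galois group -/

section LocalToGlobal

theorem continuous_localToGlobal {ℓ : ℕ} [Fact ℓ.Prime] (S : Finset ℕ)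
    (ι : AlgebraicClosure ℚ →ₐ[ℚ] PadicAlgCl ℓ) : Continuous (localToGlobal S ι) := by
  refine continuous_of_continuousAt_one _ ?_
  rw [ContinuousAt, map_one]
  intro s hs
  obtain ⟨E, hE, hEs⟩ := (krullTopology_mem_nhds_one_iff _ _ s).1 hs
  rw [Filter.mem_map]
  let b := Module.finBasis ℚ E
  have hop : IsOpen (⋂ i, {γ : LocalGaloisGroup ℓ | γ (ι (b i : maxUnramifiedOutside S)) =
      ι (b i : maxUnramifiedOutside S)}) :=
    isOpen_iInter_of_finite fun i =>
      LocalGaloisGroup.isOpen_setOf_apply (fun y => y = ι (b i : maxUnramifiedOutside S)) _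
  refine Filter.mem_of_superset (hop.mem_nhds (by simp)) fun γ hγ => hEs ?_
  rw [Set.mem_iInter] at hγ
  rw [SetLike.mem_coe, IntermediateField.mem_fixingSubgroup_iff]
  intro x hx
  have hb (i) : localToGlobal S ι γ (b i : maxUnramifiedOutside S) = b i := by
    apply Subtype.val_injective
    apply ι.toRingHom.injective
    exact (localToGlobal_commutes S ι γ _).trans (hγ i)
  have h := congrArg (fun y : E => (y : maxUnramifiedOutside S)) (b.sum_repr ⟨x, hx⟩)
  simp only [AddSubmonoidClass.coe_finsetSum, IntermediateField.coe_smul] at h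
  rw [← h, map_sum]
  refine Finset.sum_congr rfl fun i _ => ?_
  rw [Algebra.smul_def, map_mul, AlgEquiv.commutes, hb]

end LocalToGlobal

/-! ### Adic topology on a finite algebra and congruence subgroups -/

section Adic

open IsLocalRing

variable {R : Type*} [CommRing R] {E : Type*} [Ring E] [Algebra R E]

theorem mul_mem_ideal_smul_top {I J : Ideal R} {x y : E} (hx : x ∈ (I • ⊤ : Submodule R E))
    (hy : y ∈ (J • ⊤ : Submodule R E)) : x * y ∈ ((I * J) • ⊤ : Submodule R E) := by
  refine Submodule.smul_induction_on hx (fun r hr e _ => ?_) (fun a b ha hb => ?_)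
  · refine Submodule.smul_induction_on hy (fun r' hr' e' _ => ?_) (fun a b ha hb => ?_)
    · rw [smul_mul_smul_comm]
      exact Submodule.smul_mem_smul (Ideal.mul_mem_mul hr hr') trivial
    · rw [mul_add]; exact add_mem ha hb
  · rw [add_mul]; exact add_mem ha hb

theorem mul_left_mem_ideal_smul_top {I : Ideal R} {x : E} (y : E)
    (hx : x ∈ (I • ⊤ : Submodule R E)) : y * x ∈ (I • ⊤ : Submodule R E) := by
  have := mul_mem_ideal_smul_top (I := ⊤) (x := y) (by simp) hx
  rwa [Ideal.top_mul] at this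

theorem mul_right_mem_ideal_smul_top {I : Ideal R} {x : E} (y : E)
    (hx : x ∈ (I • ⊤ : Submodule R E)) : x * y ∈ (I • ⊤ : Submodule R E) := by
  have := mul_mem_ideal_smul_top (J := ⊤) (y := y) hx (by simp)
  rwa [Ideal.mul_top] at this

theorem ideal_smul_top_mono {I J : Ideal R} (h : I ≤ J) :
    (I • ⊤ : Submodule R E) ≤ J • ⊤ := Submodule.smul_mono_left h

/-- Submodules of finite modules over a noetherian local ring are closed. -/
theorem mem_of_forall_mem_sup_pow_smul [IsLocalRing R] [IsNoetherianRing R] {M : Type*}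
    [AddCommGroup M] [Module R M] [Module.Finite R M] (Q : Submodule R M) {x : M}
    (hx : ∀ k, x ∈ Q ⊔ (maximalIdeal R ^ k • ⊤ : Submodule R M)) : x ∈ Q := by
  have h := Ideal.iInf_pow_smul_eq_bot_of_isLocalRing (M := M ⧸ Q) (maximalIdeal R)
    (maximalIdeal.isMaximal R).ne_top
  rw [← Submodule.Quotient.mk_eq_zero, ← Submodule.mem_bot R, ← h, Submodule.mem_iInf]
  intro k
  obtain ⟨q, hq, y, hy, rfl⟩ := Submodule.mem_sup.1 (hx k)
  rw [Submodule.Quotient.mk_add, (Submodule.Quotient.mk_eq_zero Q).2 hq, zero_add]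
  have := Submodule.mem_map_of_mem (f := Q.mkQ) hy
  rw [Submodule.map_smul''] at this
  exact Submodule.smul_mono le_rfl le_top this

theorem eq_zero_of_forall_mem_pow_smul [IsLocalRing R] [IsNoetherianRing R] {M : Type*}
    [AddCommGroup M] [Module R M] [Module.Finite R M] {x : M}
    (hx : ∀ k, x ∈ (maximalIdeal R ^ k • ⊤ : Submodule R M)) : x = 0 :=
  (Submodule.mem_bot R).1 (mem_of_forall_mem_sup_pow_smul ⊥ fun k => by
    rw [bot_sup_eq]; exact hx k)

theorem exists_one_add_pow_eq (z : E) (m : ℕ) :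
    ∃ w : E, (1 + z) ^ m = 1 + m * z + z * z * w := by
  induction m with
  | zero => exact ⟨0, by simp⟩
  | succ m ih =>
    obtain ⟨w, hw⟩ := ih
    refine ⟨m + w * (1 + z), ?_⟩
    rw [pow_succ, hw]
    push_cast
    have h : (m : E) * z = z * m := (Nat.cast_commute m z).eq
    have h2 : (m : E) * (z * z) = z * z * m := (Nat.cast_commute m (z * z)).eq
    simp only [mul_add, add_mul, mul_one, one_mul, mul_assoc] at *
    rw [h2]
    abel

variable [IsLocalRing R] {Γ : Type*} [Group Γ] (M : Γ →* E)

variable (R) in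
/-- The elements of `Γ` that act trivially modulo the `k`-th power of the maximal ideal. -/
def congruenceSubgroup (k : ℕ) : Subgroup Γ where
  carrier := {g | M g - 1 ∈ (maximalIdeal R ^ k • ⊤ : Submodule R E)}
  one_mem' := by simp
  mul_mem' := by
    intro g h hg hh
    have : M (g * h) - 1 = (M g - 1) * M h + (M h - 1) := by rw [map_mul, sub_mul, one_mul]; abel
    change M (g * h) - 1 ∈ (maximalIdeal R ^ k • ⊤ : Submodule R E)
    rw [this]
    exact add_mem (mul_right_mem_ideal_smul_top _ hg) hh
  inv_mem' := by
    intro g hg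
    have : M g⁻¹ - 1 = -((M g - 1) * M g⁻¹) := by
      rw [sub_mul, ← map_mul, mul_inv_cancel, map_one, one_mul, neg_sub]
    change M g⁻¹ - 1 ∈ (maximalIdeal R ^ k • ⊤ : Submodule R E)
    rw [this]
    exact neg_mem (mul_right_mem_ideal_smul_top _ hg)

theorem mem_congruenceSubgroup {k : ℕ} {g : Γ} :
    g ∈ congruenceSubgroup R M k ↔ M g - 1 ∈ (maximalIdeal R ^ k • ⊤ : Submodule R E) := Iff.rfl

variable (R) in
/-- The representation `M` is continuous for the adic topology. -/
def IsAdicContinuous [TopologicalSpace Γ] : Prop :=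
  ∀ k : ℕ, IsOpen (congruenceSubgroup R M k : Set Γ)

/-- `(1 + z) ^ p = 1 + p z + z ^ 2 w`. One more factor of the maximal ideal comes from `p` in the
second term, and from `2 k ≥ k + 1` in the third. -/
theorem congruenceSubgroup_pow_prime {p : ℕ} (hp : (p : R) ∈ maximalIdeal R) {k : ℕ} (hk : k ≠ 0)
    {g : Γ} (hg : g ∈ congruenceSubgroup R M k) : g ^ p ∈ congruenceSubgroup R M (k + 1) := by
  rw [mem_congruenceSubgroup] at hg ⊢
  obtain ⟨w, hw⟩ := exists_one_add_pow_eq (M g - 1) p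
  rw [add_sub_cancel] at hw
  rw [map_pow, hw, add_assoc, add_sub_cancel_left]
  refine add_mem ?_ (mul_right_mem_ideal_smul_top _ ?_)
  · rw [← nsmul_eq_mul, ← Nat.cast_smul_eq_nsmul R, pow_succ', mul_smul]
    exact Submodule.smul_mem_smul hp hg
  · have := mul_mem_ideal_smul_top hg hg
    rw [← pow_add] at this
    exact ideal_smul_top_mono (Ideal.pow_le_pow_right (by lia)) this

theorem congruenceSubgroup_pow_prime_pow {p : ℕ} (hp : (p : R) ∈ maximalIdeal R) (k : ℕ)
    {g : Γ} (hg : g ∈ congruenceSubgroup R M 1) :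
    g ^ p ^ k ∈ congruenceSubgroup R M (k + 1) := by
  induction k with
  | zero => simpa using hg
  | succ k ih =>
    rw [pow_succ, pow_mul]
    exact congruenceSubgroup_pow_prime M hp (by lia) ih

theorem Subgroup.mem_of_pow_mem_of_coprime {G : Type*} [Group G] (H : Subgroup G) {g : G}
    {a b : ℕ} (hab : a.Coprime b) (ha : g ^ a ∈ H) (hb : g ^ b ∈ H) : g ∈ H := by
  have h := Nat.gcd_eq_gcd_ab a b
  rw [hab.gcd_eq_one] at h
  have : g = (g ^ a) ^ a.gcdA b * (g ^ b) ^ a.gcdB b := by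
    rw [← zpow_natCast, ← zpow_natCast, ← zpow_mul, ← zpow_mul, ← zpow_add, ← h]
    simp
  rw [this]
  exact H.mul_mem (H.zpow_mem ha _) (H.zpow_mem hb _)

end Adic

/-! ### Inertia modulo the kernel of the tame character -/

section Projector

open IsLocalRing

variable {R : Type*} [CommRing R] [IsLocalRing R] [IsNoetherianRing R] {E : Type*} [Ring E]
  [Algebra R E] [Module.Finite R E] {ℓ p : ℕ} [Fact ℓ.Prime] [Fact p.Prime]
  {t : inertiaGroup ℓ → ℤ_[p]} (s : TameSystem t) (hℓp : ℓ ≠ p)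
  (hp : (p : R) ∈ maximalIdeal R) {M : LocalGaloisGroup ℓ →* E} (hM : IsAdicContinuous R M)

include s hℓp hp hM

/-- The kernel of the tame character acts through a finite group. -/
theorem map_eq_one_of_tame_eq_zero (j : inertiaGroup ℓ) (hj : t j = 0)
    (hj1 : (j : LocalGaloisGroup ℓ) ∈ congruenceSubgroup R M 1) : M j = 1 := by
  rw [← sub_eq_zero]
  refine eq_zero_of_forall_mem_pow_smul (R := R) fun k => ?_
  -- Modulo the `k`-th power of the maximal ideal, `j` has order dividing both a power of `p`, being
  -- congruent to `1`, and an integer prime to `p`.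
  obtain ⟨m, hm, hjm⟩ := s.exists_coprime_pow_mem hℓp j hj _ (hM k)
  have h1 := congruenceSubgroup_pow_prime_pow M hp k hj1
  have h2 : (j : LocalGaloisGroup ℓ) ^ p ^ k ∈ congruenceSubgroup R M k :=
    ideal_smul_top_mono (Ideal.pow_le_pow_right (Nat.le_succ k)) h1
  exact Subgroup.mem_of_pow_mem_of_coprime (congruenceSubgroup R M k) (hm.pow_left k) h2 hjm

variable (M) in
/-- The inertia elements, with augmentation. -/
abbrev augmentedInertia (M : LocalGaloisGroup ℓ →* E) : Subalgebra ℤ (E × ℤ) :=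
  Algebra.adjoin ℤ (Set.range fun h : inertiaGroup ℓ => (M h, (1 : ℤ)))

/-- By the preceding lemma, an element of the kernel of `t` acts in a way determined by its class
modulo the first congruence subgroup, which has finite index. -/
theorem finite_image_tameKernel :
    (M '' {γ | ∃ j : inertiaGroup ℓ, t j = 0 ∧ (j : LocalGaloisGroup ℓ) = γ}).Finite := by
  have := Subgroup.quotient_finite_of_isOpen _ (hM 1)
  let f : (M '' {γ | ∃ j : inertiaGroup ℓ, t j = 0 ∧ (j : LocalGaloisGroup ℓ) = γ}) →
      LocalGaloisGroup ℓ ⧸ congruenceSubgroup R M 1 := fun x => (x.2.choose : LocalGaloisGroup ℓ)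
  have hf : Function.Injective f := by
    rintro x y hxy
    obtain ⟨⟨j, hj, hjx⟩, hMx⟩ := x.2.choose_spec
    obtain ⟨⟨j', hj', hjy⟩, hMy⟩ := y.2.choose_spec
    have h := QuotientGroup.eq.1 hxy
    rw [← hjx, ← hjy] at h
    have h1 := map_eq_one_of_tame_eq_zero s hℓp hp hM (j⁻¹ * j')
      (by rw [s.map_mul hℓp, s.map_inv hℓp, hj, hj', neg_zero, add_zero]) h
    apply Subtype.ext
    rw [← hMx, ← hMy, ← hjx, ← hjy]
    have h2 : M j' = M j * M ((j⁻¹ * j' : inertiaGroup ℓ) : LocalGaloisGroup ℓ) := by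
      rw [← map_mul]; simp
    rw [h2, h1, mul_one]
  have := Finite.of_injective f hf
  exact Set.toFinite _

/-- The multiple of the projector onto the invariants of the kernel of the tame character. -/
theorem exists_tameKernel_projector :
    ∃ (e : E) (m : ℕ), m ≠ 0 ∧ (e, (m : ℤ)) ∈ augmentedInertia M ∧ e * e = m * e ∧
      (∀ γ, Commute e (M γ)) ∧ ∀ j : inertiaGroup ℓ, t j = 0 → M j * e = e := by
  classical
  let J : Set (LocalGaloisGroup ℓ) :=
    {γ | ∃ j : inertiaGroup ℓ, t j = 0 ∧ (j : LocalGaloisGroup ℓ) = γ}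
  have hfin : (M '' J).Finite := finite_image_tameKernel s hℓp hp hM
  let Q := hfin.toFinset
  have hQ (x : E) : x ∈ Q ↔ ∃ j : inertiaGroup ℓ, t j = 0 ∧ M j = x := by
    simp only [Q, Set.Finite.mem_toFinset, J]
    constructor
    · rintro ⟨_, ⟨j, hj, rfl⟩, rfl⟩; exact ⟨j, hj, rfl⟩
    · rintro ⟨j, hj, rfl⟩; exact ⟨j, ⟨j, hj, rfl⟩, rfl⟩
  have hj (j : inertiaGroup ℓ) (hj : t j = 0) : M j * ∑ x ∈ Q, x = ∑ x ∈ Q, x := by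
    rw [Finset.mul_sum]
    refine Finset.sum_bij (fun x _ => M j * x) ?_ ?_ (fun y hy => ?_) (fun _ _ => rfl)
    · intro x hx
      obtain ⟨j', hj', rfl⟩ := (hQ x).1 hx
      exact (hQ _).2 ⟨j * j', by rw [s.map_mul hℓp, hj, hj', add_zero], by simp⟩
    · intro x _ y _ hxy
      have := congrArg (M (j⁻¹ : inertiaGroup ℓ) * ·) hxy
      simpa [← mul_assoc, ← map_mul] using this
    · obtain ⟨j', hj', rfl⟩ := (hQ y).1 hy
      exact ⟨M ((j⁻¹ * j' : inertiaGroup ℓ) : LocalGaloisGroup ℓ), (hQ _).2 ⟨j⁻¹ * j',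
        by rw [s.map_mul hℓp, s.map_inv hℓp, hj, hj', neg_zero, add_zero], rfl⟩,
        by rw [← map_mul]; simp⟩
  -- The sum over a finite group, without division by its order, which need not be invertible in
  -- `E`.
  refine ⟨∑ x ∈ Q, x, Q.card, ?_, ?_, ?_, ?_, hj⟩
  · rw [Finset.card_ne_zero]
    exact ⟨1, (hQ 1).2 ⟨1, s.map_one hℓp, by simp⟩⟩
  · have : ((∑ x ∈ Q, x, (Q.card : ℤ)) : E × ℤ) = ∑ x ∈ Q, (x, (1 : ℤ)) := by
      ext <;> simp [Prod.fst_sum, Prod.snd_sum]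
    rw [this]
    refine sum_mem fun x hx => ?_
    obtain ⟨j, -, rfl⟩ := (hQ x).1 hx
    exact Algebra.subset_adjoin ⟨j, rfl⟩
  · rw [Finset.sum_mul, Finset.sum_congr rfl (g := fun _ => ∑ x ∈ Q, x)]
    · rw [Finset.sum_const, nsmul_eq_mul]
    · intro x hx
      obtain ⟨j, hj0, rfl⟩ := (hQ x).1 hx
      exact hj j hj0
  · intro γ
    rw [Commute, SemiconjBy, Finset.mul_sum, Finset.sum_mul]
    have hconj (γ : LocalGaloisGroup ℓ) (x : E) (hx : x ∈ Q) : M γ * x * M γ⁻¹ ∈ Q := by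
      obtain ⟨j, hj0, rfl⟩ := (hQ x).1 hx
      refine (hQ _).2 ⟨⟨γ * j * γ⁻¹, (inferInstance : (inertiaGroup ℓ).Normal).conj_mem _ j.2 γ⟩,
        s.map_conj_eq_zero hℓp γ j _ rfl hj0, by simp⟩
    refine Finset.sum_bij (fun x _ => M γ⁻¹ * x * M γ) (fun x hx => ?_) ?_ (fun y hy => ?_)
      (fun x hx => ?_)
    · simpa using hconj γ⁻¹ x hx
    · intro x _ y _ hxy
      have := congrArg (fun z => M γ * z * M γ⁻¹) hxy
      simpa [mul_assoc, ← map_mul, reduceCtorEq, ← mul_assoc (M γ) (M γ⁻¹)] using this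
    · refine ⟨M γ * y * M γ⁻¹, hconj γ y hy, ?_⟩
      simp [mul_assoc, ← map_mul, ← mul_assoc (M γ⁻¹) (M γ)]
    · simp [← mul_assoc, ← map_mul]

omit hp in
/-- On the invariants of the kernel of the tame character, inertia is generated by one element. -/
theorem exists_inertia_generator {σ : LocalGaloisGroup ℓ} (hσ : IsGeometricFrobenius σ) {e : E}
    (he : ∀ γ, Commute e (M γ)) (hje : ∀ j : inertiaGroup ℓ, t j = 0 → M j * e = e) :
    ∃ τ : inertiaGroup ℓ, t τ ≠ 0 ∧
      ∀ h : inertiaGroup ℓ, ∃ x : E, (M h - 1) * e = x * (M τ - 1) * e := by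
  -- A nonzero value of `t` of minimal valuation divides all the others.
  obtain ⟨τ, hτ0, hτ⟩ : ∃ τ, t τ ≠ 0 ∧ ∀ h, t τ ∣ t h := by
    obtain ⟨τ₁, hτ₁⟩ := s.exists_ne_zero hℓp hσ
    obtain ⟨_, ⟨τ, hτ0, rfl⟩, hmin⟩ := wellFounded_dvdNotUnit.has_min
      {a | ∃ τ, t τ ≠ 0 ∧ t τ = a} ⟨_, τ₁, hτ₁, rfl⟩
    refine ⟨τ, hτ0, fun h => ?_⟩
    rcases ValuationRing.dvd_total (t τ) (t h) with h1 | ⟨u, hu⟩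
    · exact h1
    · have hh0 : t h ≠ 0 := by
        intro h0
        rw [h0, zero_mul] at hu
        exact hτ0 hu
      by_cases hunit : IsUnit u
      · obtain ⟨v, rfl⟩ := hunit
        exact ⟨(v⁻¹ : ℤ_[p]ˣ), by rw [hu, mul_assoc, Units.mul_inv, mul_one]⟩
      · exact absurd ⟨hh0, u, hunit, hu⟩ (hmin (t h) ⟨h, hh0, rfl⟩)
  refine ⟨τ, hτ0, fun h => ?_⟩
  -- The left ideal `E (M τ - 1) e` is an `R`-submodule, hence closed for the adic topology, so
  -- approximations suffice. If `m` is an integer close to `t h / t τ`, then `h = j u τ ^ m` with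
  -- `j` in the kernel of `t`, hence trivial on `e`, and `u` close to the identity; and `M τ ^ m -
  -- 1` is a multiple of `M τ - 1`.
  let Q : Submodule R E := LinearMap.range (LinearMap.mulRight R ((M τ - 1) * e))
  suffices hQ : (M h - 1) * e ∈ Q by
    obtain ⟨x, hx⟩ := hQ
    exact ⟨x, by rw [mul_assoc]; exact hx.symm⟩
  refine mem_of_forall_mem_sup_pow_smul Q fun k => ?_
  obtain ⟨c, hc⟩ := s.exists_mul_mem _ (hM k)
  obtain ⟨z, hz⟩ := hτ h
  set m := z.appr c
  obtain ⟨j, hj, hju⟩ := hc (h * (τ ^ m)⁻¹) (by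
    rw [s.map_mul hℓp, s.map_inv hℓp, s.map_pow hℓp, hz, mul_comm, ← sub_eq_add_neg, ← sub_mul]
    exact (Ideal.mem_span_singleton.1 (PadicInt.appr_spec c z)).mul_right _)
  set u : LocalGaloisGroup ℓ := (j : LocalGaloisGroup ℓ)⁻¹ * (h * (τ ^ m)⁻¹ : inertiaGroup ℓ)
  have hMh : M h = M j * M u * M τ ^ m := by
    rw [← map_pow, ← map_mul, ← map_mul]; simp [u]
  have h1 : M j * M τ ^ m * e = M τ ^ m * e := by
    have hc := ((he τ).pow_right m).eq
    rw [mul_assoc, ← hc, ← mul_assoc, hje j hj]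
  have h2 : (M h - 1) * e = (M τ ^ m - 1) * e + M j * ((M u - 1) * (M τ ^ m * e)) := by
    rw [hMh]
    have : M j * ((M u - 1) * (M τ ^ m * e)) = M j * M u * M τ ^ m * e - M τ ^ m * e := by
      rw [sub_mul, mul_sub, one_mul, ← mul_assoc (M j) (M τ ^ m), h1]
      simp only [mul_assoc]
    rw [this, sub_mul, sub_mul]
    abel
  rw [h2]
  refine Submodule.add_mem_sup ⟨∑ i ∈ Finset.range m, M τ ^ i, ?_⟩
    (mul_left_mem_ideal_smul_top _ (mul_right_mem_ideal_smul_top _ hju))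
  rw [LinearMap.mulRight_apply, ← mul_assoc, geom_sum_mul]

-- `σ⁻¹ τ σ` and `τ ^ ℓ` have the same image under `t`, so they differ by an element that acts
-- trivially on `e`.
omit [IsLocalRing R] [IsNoetherianRing R] [Algebra R E] [Module.Finite R E] hp hM in
theorem frobenius_conj_mul {σ : LocalGaloisGroup ℓ} (hσ : IsGeometricFrobenius σ) {e : E}
    (he : ∀ γ, Commute e (M γ)) (hje : ∀ j : inertiaGroup ℓ, t j = 0 → M j * e = e)
    (τ : inertiaGroup ℓ) : M (σ⁻¹ * τ * σ) * e = M τ ^ ℓ * e := by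
  have hmem : σ⁻¹ * τ * σ ∈ inertiaGroup ℓ := by
    simpa using (inferInstance : (inertiaGroup ℓ).Normal).conj_mem _ τ.2 σ⁻¹
  set τ' : inertiaGroup ℓ := ⟨_, hmem⟩
  have h1 := hje (τ' * (τ ^ ℓ)⁻¹) (by
    rw [s.map_mul hℓp, s.map_inv hℓp, s.map_pow hℓp, s.map_conj_frobenius hℓp hσ τ τ' rfl]; simp)
  have h2 : M (σ⁻¹ * τ * σ) = M (τ' * (τ ^ ℓ)⁻¹ : inertiaGroup ℓ) * M τ ^ ℓ := by
    rw [← map_pow, ← map_mul]; simp [τ']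
  rw [h2, mul_assoc, ← ((he τ).pow_right ℓ).eq, ← mul_assoc, h1]

end Projector

/-! ### Quasi-unipotence of the generator of inertia -/

section RootsOfUnity

/-- Two of the powers `a ^ ℓ ^ i` coincide by finiteness; the exponents of the various `a` are then
multiplied together. -/
theorem exists_pow_eq_one_of_finite {K : Type*} [Field K] {Λ : Set K} (hΛ : Λ.Finite)
    (h0 : ∀ a ∈ Λ, a ≠ 0) {ℓ : ℕ} (hℓ : 1 < ℓ) (h : ∀ a ∈ Λ, a ^ ℓ ∈ Λ) :
    ∃ m : ℕ, m ≠ 0 ∧ ∀ a ∈ Λ, a ^ m = 1 := by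
  have key (a : K) (ha : a ∈ Λ) : ∃ m : ℕ, m ≠ 0 ∧ a ^ m = 1 := by
    have hmem (i : ℕ) : a ^ ℓ ^ i ∈ Λ := by
      induction i with
      | zero => simpa using ha
      | succ i ih => rw [pow_succ, pow_mul]; exact h _ ih
    obtain ⟨i, j, hij, heq⟩ := hΛ.exists_lt_map_eq_of_forall_mem hmem
    have hlt : ℓ ^ i < ℓ ^ j := Nat.pow_lt_pow_right hℓ hij
    refine ⟨ℓ ^ j - ℓ ^ i, by lia, ?_⟩
    have h1 : a ^ ℓ ^ i * a ^ (ℓ ^ j - ℓ ^ i) = a ^ ℓ ^ i * 1 := by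
      rw [← pow_add, Nat.add_sub_cancel' hlt.le, mul_one]; exact heq.symm
    exact mul_left_cancel₀ (pow_ne_zero _ (h0 a ha)) h1
  choose! m hm0 hm using key
  refine ⟨∏ a ∈ hΛ.toFinset, m a, Finset.prod_ne_zero_iff.2 fun a ha => hm0 a (by simpa using ha),
    fun a ha => ?_⟩
  obtain ⟨d, hd⟩ := Finset.dvd_prod_of_mem m (hΛ.mem_toFinset.2 ha)
  rw [hd, pow_mul, hm a ha, one_pow]

theorem Module.End.isNilpotent_of_forall_eigenvalue {K V : Type*} [Field K] [IsAlgClosed K]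
    [AddCommGroup V] [Module K V] [Module.Finite K V] (f : Module.End K V)
    (h : ∀ (μ : K) (v : V), f v = μ • v → v ≠ 0 → μ = 0) : IsNilpotent f := by
  have h1 (μ : K) (hμ : μ ≠ 0) : f.maxGenEigenspace μ = ⊥ := by
    by_contra hne
    obtain ⟨v, hv, hv0⟩ := Submodule.exists_mem_ne_zero_of_ne_bot
      (p := f.eigenspace μ) (fun hbot => hne (by
        rw [eq_bot_iff]
        intro v hv
        obtain ⟨k, hk⟩ := (Module.End.mem_maxGenEigenspace f μ v).1 hv
        have hinj : Function.Injective (f - μ • (1 : Module.End K V)) := by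
          rw [← LinearMap.ker_eq_bot, ← Algebra.algebraMap_eq_smul_one, ← hbot,
            Module.End.eigenspace_def]
          rfl
        rw [Module.End.coe_pow] at hk
        exact (hinj.iterate k) (by rw [hk, ← Module.End.coe_pow, map_zero])))
    exact hμ (h μ v (Module.End.mem_eigenspace_iff.1 hv) hv0)
  have h2 : f.maxGenEigenspace 0 = ⊤ := by
    rw [eq_top_iff, ← Module.End.iSup_maxGenEigenspace_eq_top f]
    refine iSup_le fun μ => ?_
    rcases eq_or_ne μ 0 with rfl | hμ
    · exact le_rfl
    · rw [h1 μ hμ]; exact bot_le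
  refine ⟨Module.finrank K V, LinearMap.ext fun v => ?_⟩
  have hv : v ∈ f.maxGenEigenspace 0 := h2 ▸ trivial
  rw [Module.End.maxGenEigenspace_eq_genEigenspace_finrank] at hv
  simpa [Module.End.mem_genEigenspace_nat] using hv

theorem Module.End.exists_eigenvector_mem {K V : Type*} [Field K] [IsAlgClosed K]
    [AddCommGroup V] [Module K V] [Module.Finite K V] (f : Module.End K V) {W : Submodule K V}
    (hW : W ≠ ⊥) (hf : ∀ v ∈ W, f v ∈ W) : ∃ v ∈ W, v ≠ 0 ∧ ∃ μ : K, f v = μ • v := by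
  have : Nontrivial W := Submodule.nontrivial_iff_ne_bot.2 hW
  obtain ⟨μ, hμ⟩ := Module.End.exists_eigenvalue (f.restrict hf)
  obtain ⟨v, hv⟩ := hμ.exists_hasEigenvector
  refine ⟨v, v.2, fun h => hv.2 (Subtype.ext h), μ, ?_⟩
  exact congrArg Subtype.val hv.apply_eq_smul

/-- A monodromy theorem: `T` is quasi-unipotent on the image of `e`. -/
theorem Module.End.exists_pow_sub_one_nilpotent {K V : Type*} [Field K] [IsAlgClosed K] [CharZero K]
    [AddCommGroup V] [Module K V] [Module.Finite K V] {T s s' T' e : Module.End K V} {ℓ m : ℕ}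
    (hℓ : 1 < ℓ) (hm : m ≠ 0) (he : e * e = m * e) (heT : Commute e T) (hes : Commute e s)
    (hs : s' * s = 1) (hT : T' * T = 1) (hsT : T * s * e = s * T ^ ℓ * e) :
    ∃ M₀ N : ℕ, M₀ ≠ 0 ∧ ((T ^ M₀ - 1) * e) ^ (N + 1) = 0 := by
  have hmK : (m : K) ≠ 0 := Nat.cast_ne_zero.2 hm
  have hre (v : V) (hv : v ∈ LinearMap.range e) : e v = (m : K) • v := by
    obtain ⟨w, rfl⟩ := hv
    rw [← Module.End.mul_apply, he, Module.End.mul_apply, Module.End.natCast_apply,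
      Nat.cast_smul_eq_nsmul]
  -- The eigenvalues of `T` on the image of `e`. If `T v = a v`, then `T (s v) = s (T ^ ℓ v) = a ^ ℓ
  -- s v`, so they are stable under `ℓ`-th powers and are therefore roots of unity.
  let Λ : Set K := {a | ∃ v ∈ LinearMap.range e, v ≠ 0 ∧ T v = a • v}
  have hΛfin : Λ.Finite := by
    refine (Module.End.finite_hasEigenvalue T).subset ?_
    rintro a ⟨v, -, hv0, hv⟩
    exact Module.End.hasEigenvalue_of_hasEigenvector
      (Module.End.hasEigenvector_iff.2 ⟨Module.End.mem_eigenspace_iff.2 hv, hv0⟩)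
  have hpow (a : K) (v : V) (hv : T v = a • v) (k : ℕ) : (T ^ k) v = a ^ k • v := by
    induction k with
    | zero => simp
    | succ k ih => rw [pow_succ, Module.End.mul_apply, hv, map_smul, ih, smul_smul, pow_succ']
  obtain ⟨M₀, hM₀, hM⟩ := exists_pow_eq_one_of_finite hΛfin (ℓ := ℓ) (by
      rintro _ ⟨v, -, hv0, hv⟩ rfl
      have := congrArg T' hv
      rw [← Module.End.mul_apply, hT, zero_smul, map_zero] at this
      exact hv0 this) hℓ (by
      rintro a ⟨v, ⟨w, rfl⟩, hv0, hv⟩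
      refine ⟨s (e w), ⟨s w, ?_⟩, fun h => hv0 ?_, ?_⟩
      · rw [← Module.End.mul_apply, hes.eq, Module.End.mul_apply]
      · have := congrArg s' h
        rwa [← Module.End.mul_apply, hs, map_zero] at this
      · have := congrArg (· w) hsT
        simp only [Module.End.mul_apply] at this
        rw [this, hpow a _ hv, map_smul])
  obtain ⟨N, hN⟩ := Module.End.isNilpotent_of_forall_eigenvalue ((T ^ M₀ - 1) * e) (by
    intro μ v hv hv0
    by_contra hμ
    have hcomm : Commute ((T ^ M₀ - 1) * e) T :=
      (((Commute.refl T).pow_left M₀).sub_left (Commute.one_left T)).mul_left heT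
    obtain ⟨v, hv, hv0, a, ha⟩ := Module.End.exists_eigenvector_mem T
      (W := Module.End.eigenspace ((T ^ M₀ - 1) * e) μ)
      (fun h => hv0 ((Submodule.mem_bot K).1 (h ▸ Module.End.mem_eigenspace_iff.2 hv)))
      (fun w hw => by
        rw [Module.End.mem_eigenspace_iff] at hw ⊢
        rw [← Module.End.mul_apply, hcomm.eq, Module.End.mul_apply, hw, map_smul])
    rw [Module.End.mem_eigenspace_iff] at hv
    have hvr : v ∈ LinearMap.range e := by
      refine ⟨μ⁻¹ • (T ^ M₀ - 1) v, ?_⟩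
      have hc : Commute (T ^ M₀ - 1) e := (heT.symm.pow_left M₀).sub_left (Commute.one_left e)
      rw [map_smul, ← Module.End.mul_apply, ← hc.eq, hv, smul_smul, inv_mul_cancel₀ hμ, one_smul]
    have h1 := hM a ⟨v, hvr, hv0, ha⟩
    rw [Module.End.mul_apply, hre v hvr, map_smul, LinearMap.sub_apply, hpow a v ha, h1, one_smul,
      Module.End.one_apply, sub_self, smul_zero] at hv
    exact hv0 ((smul_eq_zero.1 hv.symm).resolve_left hμ))
  exact ⟨M₀, N, hM₀, by rw [pow_succ, hN, zero_mul]⟩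

open Polynomial in
-- Write `g` for the geometric sum: it is congruent to `M₀` modulo `X - 1`. Expand the power `2 N +
-- 2` of `M₀ = g - (X - 1) q`: each term contains the power `N + 1` of `g` or of `X - 1`. Over `ℤ`,
-- a power of `M₀` takes the place of `1`.
theorem Polynomial.exists_bezout_geom_sum (M₀ N : ℕ) :
    ∃ u v : ℤ[X], u * (X - 1) ^ (N + 1) + v * (∑ i ∈ Finset.range M₀, X ^ i) ^ (N + 1) =
      C ((M₀ : ℤ) ^ (2 * N + 2)) := by
  set g : ℤ[X] := ∑ i ∈ Finset.range M₀, X ^ i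
  obtain ⟨q, hq⟩ : (X - 1 : ℤ[X]) ∣ g - C (M₀ : ℤ) := by
    have := X_sub_C_dvd_sub_C_eval (a := (1 : ℤ)) (p := g)
    simpa [g, eval_finsetSum] using this
  have h1 : (C (M₀ : ℤ) : ℤ[X]) = -((X - 1) * q) + g := by rw [← hq]; ring
  have := Ideal.add_pow_mem_of_pow_mem_of_le
    (Ideal.span {((X : ℤ[X]) - 1) ^ (N + 1), g ^ (N + 1)}) (a := -((X - 1) * q)) (b := g)
    (m := N + 1) (n := N + 1) (k := 2 * N + 2)
    (by
      rw [neg_pow, mul_pow]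
      exact Ideal.mul_mem_left _ _ (Ideal.mul_mem_right _ _ (Ideal.subset_span (by simp))))
    (Ideal.subset_span (by simp)) (by lia)
  rw [← h1, Ideal.mem_span_pair] at this
  obtain ⟨u, v, h⟩ := this
  exact ⟨u, v, by rw [h, C_pow]⟩

end RootsOfUnity

/-! ### The projector onto the unipotent part of inertia -/

section UnipotentProjector

variable {E : Type*} [Ring E] {ℓ : ℕ} [Fact ℓ.Prime]

/-- `ε` is a multiple of a projector, in the image of the group ring of inertia, onto the part where
inertia acts through the unipotent element `τ`. -/
structure IsUnipotentProjector (M : LocalGaloisGroup ℓ →* E) (σ : LocalGaloisGroup ℓ)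
    (τ : inertiaGroup ℓ) (ε : E) (m : ℕ) : Prop where
  ne_zero : m ≠ 0
  mem : (ε, (m : ℤ)) ∈ augmentedInertia M
  mul_self : ε * ε = m * ε
  commute_frobenius : Commute ε (M σ)
  commute : Commute ε (M τ)
  exists_pow : ∃ N : ℕ, (M τ - 1) ^ N * ε = 0
  inertia : ∀ h : inertiaGroup ℓ, ∃ x : E, (M h - 1) * ε = x * (M τ - 1) * ε
  conj : M (σ⁻¹ * τ * σ) * ε = M τ ^ ℓ * ε

open Polynomial in
theorem aeval_mul_mul_eq {T s e : E} {ℓ : ℕ} (heT : Commute e T)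
    (hsT : T * s * e = s * T ^ ℓ * e) (f : ℤ[X]) :
    aeval T f * s * e = s * aeval (T ^ ℓ) f * e := by
  have hpow (k : ℕ) : T ^ k * s * e = s * (T ^ ℓ) ^ k * e := by
    induction k with
    | zero => simp
    | succ k ih =>
      have hc := ((heT.pow_right ℓ).eq)
      calc T ^ (k + 1) * s * e = T ^ k * (T * s * e) := by rw [pow_succ]; simp only [mul_assoc]
        _ = T ^ k * s * e * T ^ ℓ := by rw [hsT]; simp only [mul_assoc]; rw [hc]
        _ = s * (T ^ ℓ) ^ (k + 1) * e := by
          rw [ih, pow_succ]; simp only [mul_assoc]; rw [hc]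
  induction f using Polynomial.induction_on' with
  | add f g hf hg => simp only [map_add, add_mul, mul_add, hf, hg]
  | monomial k a =>
    rw [aeval_monomial, aeval_monomial, mul_assoc, mul_assoc, ← mul_assoc _ s, hpow]
    simp only [algebraMap_int_eq, eq_intCast, ← mul_assoc]
    rw [(Int.cast_commute a s).eq]

-- On the image of `e`, some power `T ^ M₀` of `T = M τ` is unipotent. The Bezout relation gives a
-- polynomial `f`, divisible by a power of the geometric sum and congruent to a nonzero integer `c`
-- modulo `(X - 1) ^ (N + 1)`. So `f(T)` kills the part of the image of `e` where `T` is not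
-- unipotent and is `c` on the unipotent part; one takes `ε = f(T) e` and the integer `c m`. The
-- faithful action `Θ` in characteristic zero provides eigenvalues, traces and cancellation of
-- integers.
open Polynomial in
theorem exists_isUnipotentProjector {R : Type*} [CommRing R] [IsLocalRing R] [IsNoetherianRing R]
    [Algebra R E] [Module.Finite R E] {p : ℕ} [Fact p.Prime]
    {t : inertiaGroup ℓ → ℤ_[p]} (s : TameSystem t) (hℓp : ℓ ≠ p)
    (hp : (p : R) ∈ IsLocalRing.maximalIdeal R) {M : LocalGaloisGroup ℓ →* E}
    (hM : IsAdicContinuous R M) {σ : LocalGaloisGroup ℓ} (hσ : IsGeometricFrobenius σ)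
    {K V : Type*} [Field K] [IsAlgClosed K] [CharZero K] [AddCommGroup V] [Module K V]
    [Module.Finite K V] (Θ : E →+* Module.End K V) (hΘ : Function.Injective Θ) :
    ∃ (τ : inertiaGroup ℓ) (ε : E) (m : ℕ), t τ ≠ 0 ∧ IsUnipotentProjector M σ τ ε m := by
  obtain ⟨e, m, hm, hmem, hee, he, hje⟩ := exists_tameKernel_projector s hℓp hp hM
  obtain ⟨τ, hτ0, hτ⟩ := exists_inertia_generator s hℓp hM hσ he hje
  have hconj := frobenius_conj_mul s hℓp hσ he hje τ
  have hss : M σ⁻¹ * M σ = 1 := by rw [← map_mul, inv_mul_cancel, map_one]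
  have hss' : M σ * M σ⁻¹ = 1 := by rw [← map_mul, mul_inv_cancel, map_one]
  set T := M τ
  have hsT : T * M σ * e = M σ * T ^ ℓ * e := by
    rw [mul_assoc (M σ) _ e, ← hconj, map_mul, map_mul, ← mul_assoc, ← mul_assoc, ← mul_assoc, hss',
      one_mul]
  have heT : Commute e T := he τ
  obtain ⟨M₀, N, hM₀, hN⟩ := Module.End.exists_pow_sub_one_nilpotent (T := Θ T) (s := Θ (M σ))
    (s' := Θ (M σ⁻¹)) (T' := Θ (M τ⁻¹)) (e := Θ e) (Fact.out : ℓ.Prime).one_lt hm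
    (by rw [← map_mul, hee, map_mul, map_natCast]) (heT.map Θ) ((he σ).map Θ)
    (by rw [← map_mul, hss, map_one])
    (by rw [← map_mul, ← map_mul, inv_mul_cancel, map_one, map_one])
    (by rw [← map_mul, ← map_mul, hsT]; simp)
  have hcancel (k : ℕ) (hk : k ≠ 0) (x : E) (hx : (k : E) * x = 0) : x = 0 := by
    apply hΘ
    have := congrArg Θ hx
    rw [map_mul, map_natCast, map_zero, ← nsmul_eq_mul, ← Nat.cast_smul_eq_nsmul K] at this
    rw [map_zero]
    exact (smul_eq_zero.1 this).resolve_left (Nat.cast_ne_zero.2 hk)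
  have hepow (k : ℕ) : e ^ (k + 1) = (m : E) ^ k * e := by
    induction k with
    | zero => simp
    | succ k ih => rw [pow_succ, ih, mul_assoc, hee, ← mul_assoc, pow_succ]
  have hN' : (T ^ M₀ - 1) ^ (N + 1) * e = 0 := by
    have h1 : ((T ^ M₀ - 1) * e) ^ (N + 1) = 0 := by
      apply hΘ; rw [map_zero, ← hN]; simp
    have hc : Commute (T ^ M₀ - 1) e := (heT.symm.pow_left M₀).sub_left (Commute.one_left e)
    rw [hc.mul_pow, hepow, ← mul_assoc, ← Nat.cast_pow, ← (Nat.cast_commute _ _).eq,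
      mul_assoc] at h1
    exact hcancel _ (pow_ne_zero _ hm) _ h1
  obtain ⟨u, v, huv⟩ := Polynomial.exists_bezout_geom_sum M₀ N
  set c : ℕ := M₀ ^ (2 * N + 2)
  have hc0 : c ≠ 0 := pow_ne_zero _ hM₀
  set f : ℤ[X] := v * (∑ i ∈ Finset.range M₀, X ^ i) ^ (N + 1) with hf
  have hf' : f = C (c : ℤ) - u * (X - 1) ^ (N + 1) := by rw [eq_sub_iff_add_eq', huv]; simp [c]
  have hf1 : (X - 1) ^ (N + 1) * f = v * (X ^ M₀ - 1) ^ (N + 1) := by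
    rw [hf, mul_left_comm, ← mul_pow, mul_comm (X - 1), geom_sum_mul]
  have hfe (g : ℤ[X]) : Commute e (aeval T g) := by
    induction g using Polynomial.induction_on' with
    | add f g hf hg => rw [map_add]; exact hf.add_right hg
    | monomial k a =>
      rw [aeval_monomial]
      exact (Int.cast_commute a e).symm.mul_right (heT.pow_right k)
  have hff (g h : ℤ[X]) : Commute (aeval T g) (aeval T h) := by
    rw [Commute, SemiconjBy, ← map_mul, mul_comm, map_mul]
  set ε := aeval T f * e
  have hnil (g : ℤ[X]) (hg : (X - 1) ^ (N + 1) ∣ g) : aeval T g * ε = 0 := by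
    obtain ⟨q, rfl⟩ := hg
    have : aeval T ((X - 1) ^ (N + 1) * q) * ε = aeval T (q * v) * ((T ^ M₀ - 1) ^ (N + 1) * e) := by
      have h3 : (T ^ M₀ - 1) ^ (N + 1) = aeval T ((X ^ M₀ - 1 : ℤ[X]) ^ (N + 1)) := by simp
      rw [h3]
      simp only [ε]
      rw [← mul_assoc, ← mul_assoc, ← map_mul, ← map_mul, mul_right_comm, hf1]
      congr 2; ring
    rw [this, hN', mul_zero]
  -- Any polynomial congruent to `c` modulo `(X - 1) ^ (N + 1)` acts as `c` on `ε`, while `e`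
  -- contributes `m`. This is used for `f` and for `f(X ^ ℓ)`.
  have hεpoly (g h : ℤ[X]) (hg : g = C (c : ℤ) - h) (hh : (X - 1) ^ (N + 1) ∣ h) :
      aeval T g * e * ε = (c * m : ℕ) * ε := by
    have : aeval T g * e * ε = (m : E) * (aeval T g * ε) := by
      simp only [ε]
      rw [mul_assoc, ← mul_assoc e, (hfe f).eq, mul_assoc _ e e, hee, ← mul_assoc _ (m : E),
        ← (Nat.cast_commute m (aeval T f)).eq]
      simp only [← mul_assoc]
      rw [(Nat.cast_commute m (aeval T g)).eq]
    rw [this, hg, map_sub, sub_mul, hnil h hh, sub_zero, aeval_C]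
    simp only [algebraMap_int_eq, eq_intCast, Int.cast_natCast]
    rw [← mul_assoc, ← Nat.cast_mul, mul_comm]
  have hεε : ε * ε = (c * m : ℕ) * ε := hεpoly f _ hf' (Dvd.intro_left _ rfl)
  have hεT : Commute ε T := by
    have := hff f X
    rw [aeval_X] at this
    exact this.mul_left heT
  refine ⟨τ, ε, c * m, hτ0, mul_ne_zero hc0 hm, ?_, hεε, ?_, hεT, ⟨N + 1, ?_⟩, fun h => ?_, ?_⟩
  · have h1 : aeval ((T, 1) : E × ℤ) f ∈ augmentedInertia M :=
      Algebra.adjoin_mono (Set.singleton_subset_iff.2 (Set.mem_range_self τ))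
        (aeval_mem_adjoin_singleton ℤ ((T, 1) : E × ℤ))
    have h2 : aeval ((T, 1) : E × ℤ) f = (aeval T f, (c : ℤ)) := by
      -- The augmentation of `f(T)` is `f(1)`, which is `c` because `X - 1` divides `f - c`.
      have h3 : aeval (1 : ℤ) f = c := by rw [hf']; simp
      have h4 := Polynomial.aeval_algHom_apply (AlgHom.fst ℤ E ℤ) (T, 1) f
      have h5 := Polynomial.aeval_algHom_apply (AlgHom.snd ℤ E ℤ) (T, 1) f
      exact Prod.ext h4.symm (h5.symm.trans h3)
    have := mul_mem (h2 ▸ h1) hmem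
    simpa using this
  · set ε' := M σ⁻¹ * ε * M σ with hε'
    have hε'2 : ε' = aeval (T ^ ℓ) f * e := by
      have h1 := aeval_mul_mul_eq heT hsT f
      rw [hε', mul_assoc]
      simp only [ε]
      rw [mul_assoc, (he σ).eq, ← mul_assoc _ (M σ), h1, ← mul_assoc, ← mul_assoc, hss, one_mul]
    have hexp (g : ℤ[X]) : aeval (T ^ ℓ) g = aeval T (expand ℤ ℓ g) := by
      rw [expand_aeval]
    have h1 : ε' * ε = (c * m : ℕ) * ε := by
      rw [hε'2, hexp]
      refine hεpoly _ (expand ℤ ℓ (u * (X - 1) ^ (N + 1))) (by rw [hf']; simp) ?_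
      rw [map_mul, map_pow, map_sub, map_one, expand_X]
      exact Dvd.dvd.mul_left (pow_dvd_pow_of_dvd (by simpa using sub_dvd_pow_sub_pow (X : ℤ[X]) 1 ℓ) _) _
    have h2 : ε * ε' = ε' * ε := by
      have h3 : Commute (aeval T f * e) (aeval T (expand ℤ ℓ f) * e) :=
        ((hff _ _).mul_right (hfe f).symm).mul_left ((hfe _).mul_right (Commute.refl e))
      rw [hε'2, hexp]
      exact h3.eq
    have h3 : ε' * ε' = (c * m : ℕ) * ε' := by
      calc ε' * ε' = M σ⁻¹ * (ε * (M σ * M σ⁻¹) * ε) * M σ := by rw [hε']; simp only [mul_assoc]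
        _ = _ := by
          rw [hss', mul_one, hεε, hε']
          simp only [← mul_assoc]
          rw [(Nat.cast_commute _ (M σ⁻¹)).eq]
    -- `ε'` is the Frobenius conjugate of `ε`, and `ε' ε = ε ε' = c m ε`. So `d` is a multiple of an
    -- idempotent, and its trace is zero since `ε` and `ε'` are conjugate. In characteristic zero
    -- this forces `d = 0`.
    set d := ε' - ε with hd
    have hdd : d * d = (c * m : ℕ) * d := by
      rw [hd, mul_sub, sub_mul, sub_mul, h3, h2, h1, hεε, mul_sub]; abel
    have hmK : ((c * m : ℕ) : K) ≠ 0 := Nat.cast_ne_zero.2 (mul_ne_zero hc0 hm)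
    have hd0 : Θ d = 0 := by
      have hid : IsIdempotentElem (((c * m : ℕ) : K)⁻¹ • Θ d) := by
        rw [IsIdempotentElem, smul_mul_smul_comm, ← map_mul, hdd, map_mul, map_natCast,
          ← nsmul_eq_mul, ← Nat.cast_smul_eq_nsmul K, smul_smul, mul_assoc, inv_mul_cancel₀ hmK,
          mul_one]
      have htr : LinearMap.trace K V (((c * m : ℕ) : K)⁻¹ • Θ d) = 0 := by
        rw [map_smul, hd, map_sub, map_sub, hε', map_mul, LinearMap.trace_mul_comm, ← map_mul,
          ← mul_assoc, hss', one_mul, sub_self, smul_zero]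
      have := LinearMap.IsIdempotentElem.eq_zero_of_trace_eq_zero hid htr
      exact (smul_eq_zero.1 this).resolve_left (inv_ne_zero hmK)
    have hd0' : ε' = ε := by
      rw [← sub_eq_zero]; exact hΘ (by rw [map_zero]; exact hd0)
    rw [Commute, SemiconjBy]
    nth_rewrite 2 [← hd0']
    rw [hε', ← mul_assoc, ← mul_assoc, hss', one_mul]
  · have := hnil _ (dvd_refl ((X - 1) ^ (N + 1)))
    simpa using this
  · obtain ⟨x, hx⟩ := hτ h
    refine ⟨x, ?_⟩
    simp only [ε]
    rw [← (hfe f).eq, ← mul_assoc, hx, mul_assoc]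
  · simp only [ε]
    rw [← (hfe f).eq, ← mul_assoc, hconj, mul_assoc]

end UnipotentProjector

/-! ### The image of the group algebra: specialization, finiteness, continuity -/

namespace Determinant

open IsLocalRing

variable {A : Type u} [CommRing A] {G : Type v} [Group G] {n : ℕ} {D : Determinant A G n}
  {K : Type w} [Field K] {f : A →+* K} {V : Type*} [AddCommGroup V] [Module K V]
  {ρ : Representation K G V}

variable (f ρ) in
/-- The image of the group algebra `A[G]` under a representation over an `A`-field. -/
abbrev ImageAlgebra := A[G] ⧸ RingHom.ker (act f ρ)

variable (f ρ) in
/-- The group elements in the image of the group algebra. -/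
noncomputable def toImageAlgebra : G →* ImageAlgebra f ρ :=
  (Ideal.Quotient.mk (RingHom.ker (act f ρ))).toMonoidHom.comp (MonoidAlgebra.of A G)

theorem toImageAlgebra_apply (g : G) :
    toImageAlgebra f ρ g = Ideal.Quotient.mk _ (MonoidAlgebra.single g 1) := rfl

section

variable {K' : Type*} [Field K'] {f' : A →+* K'} {V' : Type*} [AddCommGroup V'] [Module K' V']
  {ρ' : Representation K' G V'}

/-- The action of the image of the group algebra on another representation. -/
noncomputable def imageAct (h : RingHom.ker (act f ρ) ≤ RingHom.ker (act f' ρ')) :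
    ImageAlgebra f ρ →+* Module.End K' V' :=
  Ideal.Quotient.lift _ (act f' ρ') h

theorem imageAct_mk (h : RingHom.ker (act f ρ) ≤ RingHom.ker (act f' ρ')) (x : A[G]) :
    imageAct h (Ideal.Quotient.mk _ x) = act f' ρ' x := rfl

theorem imageAct_toImageAlgebra (h : RingHom.ker (act f ρ) ≤ RingHom.ker (act f' ρ')) (g : G) :
    imageAct h (toImageAlgebra f ρ g) = ρ' g := by
  rw [toImageAlgebra_apply, imageAct_mk, act_single, map_one, one_smul]

theorem imageAct_injective : Function.Injective (imageAct (le_refl (RingHom.ker (act f ρ)))) := by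
  rw [injective_iff_map_eq_zero]
  intro x hx
  obtain ⟨x, rfl⟩ := Ideal.Quotient.mk_surjective x
  exact Ideal.Quotient.eq_zero_iff_mem.2 hx

theorem _root_.MonoidAlgebra.smul_eq_single_one_mul (a : A) (x : A[G]) :
    a • x = MonoidAlgebra.single 1 a * x := by
  rw [Algebra.smul_def]
  rfl

theorem imageAct_smul (h : RingHom.ker (act f ρ) ≤ RingHom.ker (act f' ρ')) (a : A)
    (x : ImageAlgebra f ρ) : imageAct h (a • x) = f' a • imageAct h x := by
  obtain ⟨x, rfl⟩ := Ideal.Quotient.mk_surjective x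
  have e : a • (Ideal.Quotient.mk (RingHom.ker (act f ρ)) x) =
      Ideal.Quotient.mk _ (MonoidAlgebra.single 1 a * x) := by
    rw [← MonoidAlgebra.smul_eq_single_one_mul]
    rfl
  rw [e, imageAct_mk, map_mul, act_single, map_one, smul_one_mul, imageAct_mk]

/-- An element of rank zero keeps rank zero under specialization. This makes the image algebra at
one point act at all its specializations. -/
theorem ker_act_le [Module.Finite K V] [Module.Finite K' V'] (hρ : D.IsAttachedAlong f ρ)
    (hρ' : D.IsAttachedAlong f' ρ') (hff' : RingHom.ker f ≤ RingHom.ker f') :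
    RingHom.ker (act f ρ) ≤ RingHom.ker (act f' ρ') := by
  intro x hx
  have := finrank_range_act_le hρ hρ' hff' x
  rw [(RingHom.mem_ker).1 hx, LinearMap.range_zero, finrank_bot, Nat.le_zero,
    Submodule.finrank_eq_zero, LinearMap.range_eq_bot] at this
  exact this

end

section Finite

variable [Module.Finite K V] [CharZero K]

omit [CharZero K] in
theorem IsAttachedAlong.charpoly_map (hρ : D.IsAttachedAlong f ρ) (g : G) :
    f ((D.charpoly g).coeff 1) = -LinearMap.trace K V (ρ g) := by
  classical
  let b := Module.finBasis K V
  have h := hρ.det_actionOn (S := K[X]) (Polynomial.mapRingHom f)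
    (by ext; simp [Polynomial.algebraMap_eq]) (1 - MonoidAlgebra.single g Polynomial.X)
  rw [← det_matrixOn b, map_sub, map_sub, map_one, map_one, MonoidAlgebra.mapRingHom_single,
    matrixOn_single, Polynomial.coe_mapRingHom, Polynomial.map_X] at h
  have h2 := Matrix.coeff_charpolyRev_eq_neg_trace (LinearMap.toMatrix b b (ρ g))
  rw [Matrix.charpolyRev, ← Polynomial.algebraMap_eq, h, Polynomial.coeff_map] at h2
  rw [charpoly, h2, LinearMap.trace_eq_matrix_trace K b]

omit [CharZero K] in
theorem IsAttachedAlong.exists_trace_act (hρ : D.IsAttachedAlong f ρ) (x : A[G]) :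
    ∃ a : A, f a = LinearMap.trace K V (act f ρ x) := by
  induction x using MonoidAlgebra.induction_linear with
  | zero => exact ⟨0, by simp⟩
  | add x y hx hy =>
    obtain ⟨a, ha⟩ := hx
    obtain ⟨b, hb⟩ := hy
    exact ⟨a + b, by rw [map_add, map_add, map_add, ha, hb]⟩
  | single g s =>
    exact ⟨-(s * (D.charpoly g).coeff 1), by
      rw [act_single, map_smul, map_neg, map_mul, hρ.charpoly_map]; simp⟩

/-- By regularity `x = x y x` for some `y`, so `x y` is idempotent. Its trace is a combination of
the traces of the `x g`, hence zero, and `x y = 0` in characteristic zero. -/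
theorem IsAttachedAlong.eq_zero_of_trace (hρ : D.IsAttachedAlong f ρ) {x : A[G]}
    (hx : ∀ g, LinearMap.trace K V (act f ρ x * ρ g) = 0) : act f ρ x = 0 := by
  obtain ⟨y, hy⟩ := hρ.isSemisimple.exists_mul_mul_eq (MonoidAlgebra.mapRingHom G f x)
  rw [map_mul, map_mul] at hy
  change act f ρ x * ρ.asAlgebraHom y * act f ρ x = act f ρ x at hy
  have htr (z : K[G]) : LinearMap.trace K V (act f ρ x * ρ.asAlgebraHom z) = 0 := by
    induction z using MonoidAlgebra.induction_linear with
    | zero => simp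
    | add z w hz hw => rw [map_add, mul_add, map_add, hz, hw, add_zero]
    | single g s =>
      rw [Representation.asAlgebraHom_single, mul_smul_comm, map_smul, hx, smul_zero]
  have hid : IsIdempotentElem (act f ρ x * ρ.asAlgebraHom y) := by
    rw [IsIdempotentElem, ← mul_assoc, hy]
  rw [← hy, LinearMap.IsIdempotentElem.eq_zero_of_trace_eq_zero hid (htr y), zero_mul]

/-- The image of the group algebra embeds in a finite free module, through traces. -/
theorem IsAttachedAlong.exists_trace_embedding (hρ : D.IsAttachedAlong f ρ)
    (hf : Function.Injective f) :
    ∃ (m : ℕ) (s : Fin m → G) (T : ImageAlgebra f ρ →ₗ[A] (Fin m → A)), Function.Injective T ∧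
      ∀ g i, T (toImageAlgebra f ρ g) i = -(D.charpoly (g * s i)).coeff 1 := by
  let Θ := imageAct (le_refl (RingHom.ker (act f ρ)))
  -- Finitely many group elements, whose images span the same space as all of `ρ(G)`, suffice to
  -- test the vanishing of traces.
  obtain ⟨s, hs, hspan, -⟩ := Submodule.exists_fun_fin_finrank_span_eq K (Set.range ρ)
  choose s' hs' using hs
  have hex (x : ImageAlgebra f ρ) (g : G) :
      ∃ a : A, f a = LinearMap.trace K V (Θ x * ρ g) := by
    obtain ⟨x, rfl⟩ := Ideal.Quotient.mk_surjective x
    obtain ⟨a, ha⟩ := hρ.exists_trace_act (x * MonoidAlgebra.single g 1)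
    exact ⟨a, by rw [ha, map_mul, act_single, map_one, one_smul]; rfl⟩
  choose T hT using hex
  refine ⟨_, s', { toFun := fun x i => T x (s' i), map_add' := ?_, map_smul' := ?_ }, ?_, ?_⟩
  · intro x y
    funext i
    apply hf
    rw [Pi.add_apply, map_add, hT, hT, hT, map_add, add_mul, map_add]
  · intro a x
    funext i
    apply hf
    rw [RingHom.id_apply, Pi.smul_apply, smul_eq_mul, map_mul, hT, hT, imageAct_smul,
      smul_mul_assoc, map_smul, smul_eq_mul]
  · rw [injective_iff_map_eq_zero]
    intro x hx
    apply imageAct_injective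
    obtain ⟨x, rfl⟩ := Ideal.Quotient.mk_surjective x
    rw [map_zero]
    refine hρ.eq_zero_of_trace fun g => ?_
    have hmem : ρ g ∈ Submodule.span K (Set.range s) := by
      rw [hspan]; exact Submodule.subset_span ⟨g, rfl⟩
    refine Submodule.span_induction (p := fun z _ => LinearMap.trace K V (act f ρ x * z) = 0)
      ?_ (by simp) (fun z w _ _ hz hw => by rw [mul_add, map_add, hz, hw, add_zero])
      (fun c z _ hz => by rw [mul_smul_comm, map_smul, hz, smul_zero]) hmem
    rintro _ ⟨i, rfl⟩
    have h1 : T (Ideal.Quotient.mk _ x) (s' i) = 0 := congrFun hx i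
    rw [← hs' i]
    refine (hT (Ideal.Quotient.mk _ x) (s' i)).symm.trans ?_
    rw [h1, map_zero]
  · intro g i
    apply hf
    change f (T _ _) = _
    rw [hT, map_neg, hρ.charpoly_map, neg_neg, imageAct_toImageAlgebra, map_mul ρ]

theorem IsAttachedAlong.finite_imageAlgebra [IsNoetherianRing A] (hρ : D.IsAttachedAlong f ρ)
    (hf : Function.Injective f) : Module.Finite A (ImageAlgebra f ρ) := by
  obtain ⟨m, s, T, hT, -⟩ := hρ.exists_trace_embedding hf
  exact Module.Finite.of_injective T hT

/-- The representation of the group in the image of the group algebra is continuous. -/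
theorem IsAttachedAlong.isAdicContinuous [IsNoetherianRing A] [IsLocalRing A] [TopologicalSpace G]
    [IsTopologicalGroup G] (hD : D.IsContinuous) (hρ : D.IsAttachedAlong f ρ)
    (hf : Function.Injective f) : IsAdicContinuous A (toImageAlgebra f ρ) := by
  intro k
  obtain ⟨m, s, T, hT, hTs⟩ := hρ.exists_trace_embedding hf
  -- Artin–Rees: the filtration induced on `E` by the trace embedding is the adic one, up to the
  -- shift `k₀`. So it suffices that finitely many traces be close to their values at the identity.
  obtain ⟨k₀, hk₀⟩ := Ideal.exists_pow_inf_eq_pow_smul (maximalIdeal A) (LinearMap.range T)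
  have key (x : ImageAlgebra f ρ)
      (hx : ∀ i, T x i ∈ maximalIdeal A ^ (k + k₀)) : x ∈ (maximalIdeal A ^ k • ⊤ : Submodule A _) := by
    have h1 : T x ∈ (maximalIdeal A ^ (k + k₀) • ⊤ : Submodule A (Fin m → A)) ⊓ LinearMap.range T := by
      refine ⟨?_, ⟨x, rfl⟩⟩
      rw [pi_eq_sum_univ (T x)]
      exact sum_mem fun i _ => Submodule.smul_mem_smul (hx i) trivial
    rw [hk₀ _ (by lia), Nat.add_sub_cancel] at h1
    have h2 : T x ∈ (maximalIdeal A ^ k • ⊤ : Submodule A _).map T := by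
      rw [Submodule.map_smul'', Submodule.map_top]
      exact Submodule.smul_mono le_rfl inf_le_right h1
    obtain ⟨y, hy, hyx⟩ := h2
    exact hT hyx ▸ hy
  refine Subgroup.isOpen_of_mem_nhds _ (g := 1) ?_
  let := (maximalIdeal A).adicTopology
  have hcont (i : Fin m) : ∀ᶠ g in nhds (1 : G),
      (D.charpoly (g * s i)).coeff 1 - (D.charpoly (s i)).coeff 1 ∈ maximalIdeal A ^ (k + k₀) := by
    have h1 : Filter.Tendsto (fun g => (D.charpoly (g * s i)).coeff 1) (nhds 1)
        (nhds ((D.charpoly (s i)).coeff 1)) := by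
      have := ((hD 1).comp (continuous_mul_const (s i))).tendsto 1
      simpa [Function.comp_def] using this
    have h2 := h1 (((maximalIdeal A).hasBasis_nhds_adic _).mem_of_mem (i := k + k₀) trivial)
    filter_upwards [h2] with g hg
    obtain ⟨y, hy, hyg⟩ := hg
    change _ = (D.charpoly (g * s i)).coeff 1 at hyg
    rw [← hyg]
    simpa using hy
  filter_upwards [Filter.eventually_all.2 hcont] with g hg
  refine key _ fun i => ?_
  have h1 := hTs 1 i
  rw [map_one, one_mul] at h1
  rw [map_sub, Pi.sub_apply, hTs, h1, ← neg_mem_iff]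
  convert hg i using 1
  ring

end Finite

end Determinant

theorem IsAdicContinuous.comp {R : Type*} [CommRing R] [IsLocalRing R] {E : Type*} [Ring E]
    [Algebra R E] {Γ Γ' : Type*} [Group Γ] [TopologicalSpace Γ] [Group Γ'] [TopologicalSpace Γ']
    {M : Γ →* E} (hM : IsAdicContinuous R M) {φ : Γ' →* Γ} (hφ : Continuous φ) :
    IsAdicContinuous R (M.comp φ) :=
  fun k => (hM k).preimage hφ

theorem IsLocalRing.natCast_mem_maximalIdeal (R : Type*) [CommRing R] [IsLocalRing R] (p : ℕ)
    [CharP (IsLocalRing.ResidueField R) p] : (p : R) ∈ IsLocalRing.maximalIdeal R := by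
  rw [← IsLocalRing.residue_eq_zero_iff, map_natCast, CharP.cast_eq_zero]

/-! ### Characteristic polynomials in exact sequences and their roots -/

namespace LinearMap

section Charpoly

variable {F : Type*} [Field F] [Infinite F] {A B : Type*} [AddCommGroup A] [Module F A]
  [Module.Finite F A] [AddCommGroup B] [Module F B] [Module.Finite F B]

open Polynomial in
theorem charpoly_eq_of_forall_det (a : Module.End F A) (P : F[X])
    (h : ∀ t : F, (algebraMap F (Module.End F A) t - a).det = P.eval t) : a.charpoly = P := by
  refine Polynomial.funext fun t => ?_
  rw [LinearMap.eval_charpoly, h]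

/-- The characteristic polynomial is multiplicative in exact sequences. -/
theorem charpoly_eq_mul_of_surjective (f : A →ₗ[F] B) (hf : Function.Surjective f)
    (a : Module.End F A) (b : Module.End F B) (h : ∀ x, f (a x) = b (f x))
    (hker : ∀ x ∈ LinearMap.ker f, a x ∈ LinearMap.ker f) :
    a.charpoly = (a.restrict hker).charpoly * b.charpoly := by
  refine charpoly_eq_of_forall_det _ _ fun t => ?_
  rw [Polynomial.eval_mul, LinearMap.eval_charpoly, LinearMap.eval_charpoly]
  have he : LinearMap.ker f ≤ (LinearMap.ker f).comap (algebraMap F (Module.End F A) t - a) := by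
    intro x hx
    have h1 := hker x hx
    rw [LinearMap.mem_ker] at hx h1
    simp [Module.algebraMap_end_apply, hx, h1]
  rw [LinearMap.det_eq_det_mul_det (LinearMap.ker f) _ he]
  have e1 : (algebraMap F (Module.End F A) t - a).restrict he =
      algebraMap F (Module.End F (LinearMap.ker f)) t - a.restrict hker := by
    ext x; simp [Module.algebraMap_end_apply]
  have e2 : (LinearMap.ker f).mapQ (LinearMap.ker f) (algebraMap F (Module.End F A) t - a) he =
      (f.quotKerEquivOfSurjective hf).symm.toLinearMap ∘ₗ
        (algebraMap F (Module.End F B) t - b) ∘ₗ (f.quotKerEquivOfSurjective hf).toLinearMap := by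
    apply LinearMap.ext
    intro x
    obtain ⟨x, rfl⟩ := Submodule.Quotient.mk_surjective _ x
    apply (f.quotKerEquivOfSurjective hf).injective
    simp [Module.algebraMap_end_apply, h]
  rw [e1, e2, ← LinearMap.det_conj (algebraMap F (Module.End F B) t - b)
    (f.quotKerEquivOfSurjective hf).symm]
  rfl

variable [IsAlgClosed F]

omit [Infinite F] in
theorem charpoly_eq_prod_roots (a : Module.End F A) :
    a.charpoly = (a.charpoly.roots.map fun β => Polynomial.X - Polynomial.C β).prod :=
  ((IsAlgClosed.splits a.charpoly).eq_prod_roots_of_monic a.charpoly_monic)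

omit [Infinite F] in
theorem card_roots_charpoly (a : Module.End F A) :
    Multiset.card a.charpoly.roots = Module.finrank F A := by
  rw [← (IsAlgClosed.splits a.charpoly).natDegree_eq_card_roots, a.charpoly_natDegree]

theorem roots_charpoly_smul (a : Module.End F A) {c : F} (hc : c ≠ 0) :
    (c • a).charpoly.roots = a.charpoly.roots.map (c * ·) := by
  have : (c • a).charpoly =
      ((a.charpoly.roots.map (c * ·)).map fun β => Polynomial.X - Polynomial.C β).prod := by
    refine charpoly_eq_of_forall_det _ _ fun t => ?_
    have h1 : algebraMap F (Module.End F A) t - c • a =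
        c • (algebraMap F (Module.End F A) (t / c) - a) := by
      rw [smul_sub, Algebra.algebraMap_eq_smul_one, Algebra.algebraMap_eq_smul_one, smul_smul,
        mul_div_cancel₀ _ hc]
    rw [h1, LinearMap.det_smul, ← LinearMap.eval_charpoly]
    conv_lhs => rw [charpoly_eq_prod_roots a]
    rw [Polynomial.eval_multiset_prod, Polynomial.eval_multiset_prod, ← card_roots_charpoly a,
      ← Multiset.prod_replicate]
    rw [← Multiset.map_const' a.charpoly.roots c, Multiset.map_map, Multiset.map_map,
      Multiset.map_map, ← Multiset.prod_map_mul]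
    refine congrArg _ (Multiset.map_congr rfl fun β _ => ?_)
    simp only [Function.comp_apply, Polynomial.eval_sub, Polynomial.eval_X, Polynomial.eval_C]
    field_simp
  rw [this, Polynomial.roots_multiset_prod_X_sub_C]

end Charpoly

end LinearMap

/-! ### Spectral subspaces -/

namespace Module.End

section Spectral

variable {F : Type*} [Field F] {W : Type*} [AddCommGroup W] [Module F W]

/-- The sum of the generalized eigenspaces for the eigenvalues in `S`. -/
def spectralSubspace (s : Module.End F W) (S : Set F) : Submodule F W :=
  ⨆ β ∈ S, s.maxGenEigenspace β

theorem map_spectralSubspace_le {s f : Module.End F W} {S S' : Set F} (c : F → F)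
    (hS : ∀ β ∈ S, c β ∈ S')
    (hf : ∀ β, ∀ x ∈ s.maxGenEigenspace β, f x ∈ s.maxGenEigenspace (c β)) :
    (spectralSubspace s S).map f ≤ spectralSubspace s S' := by
  simp only [spectralSubspace, Submodule.map_iSup]
  refine iSup₂_le fun β hβ => ?_
  refine le_trans ?_ (le_iSup₂_of_le (c β) (hS β hβ) le_rfl)
  rintro _ ⟨x, hx, rfl⟩
  exact hf β x hx

theorem apply_mem_spectralSubspace {s f : Module.End F W} (hf : Commute s f) {S : Set F} {x : W}
    (hx : x ∈ spectralSubspace s S) : f x ∈ spectralSubspace s S :=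
  map_spectralSubspace_le id (fun _ => id)
    (fun β _ hx => mapsTo_maxGenEigenspace_of_comm hf β hx) ⟨x, hx, rfl⟩

theorem maxGenEigenspace_scaling {s N : Module.End F W} {c : F} (hc : c ≠ 0)
    (h : N * s = c • (s * N)) (β : F) {x : W} (hx : x ∈ s.maxGenEigenspace β) :
    N x ∈ s.maxGenEigenspace (c⁻¹ * β) := by
  rw [mem_maxGenEigenspace] at hx ⊢
  obtain ⟨k, hk⟩ := hx
  refine ⟨k, ?_⟩
  have h1 : N * (s - β • 1) = c • ((s - (c⁻¹ * β) • 1) * N) := by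
    rw [mul_sub, h, sub_mul, smul_sub, smul_mul_assoc, smul_smul, mul_inv_cancel_left₀ hc,
      mul_smul_comm, mul_one, one_mul]
  have h2 (k : ℕ) : N * (s - β • 1) ^ k = c ^ k • ((s - (c⁻¹ * β) • 1) ^ k * N) := by
    induction k with
    | zero => simp
    | succ k ih =>
      rw [pow_succ, ← mul_assoc, ih, smul_mul_assoc, mul_assoc, h1, mul_smul_comm, smul_smul,
        pow_succ, pow_succ, mul_assoc]
  have h3 := congrArg (fun f : Module.End F W => f x) (h2 k)
  simp only [LinearMap.smul_apply, mul_apply, hk, map_zero] at h3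
  exact (smul_eq_zero.1 h3.symm).resolve_left (pow_ne_zero _ hc)

theorem isCompl_spectralSubspace [IsAlgClosed F] [Module.Finite F W] (s : Module.End F W)
    (S : Set F) : IsCompl (spectralSubspace s S) (spectralSubspace s Sᶜ) := by
  constructor
  · exact iSupIndep.disjoint_biSup_biSup (independent_maxGenEigenspace s) disjoint_compl_right
  · rw [codisjoint_iff, eq_top_iff, ← iSup_maxGenEigenspace_eq_top s]
    refine iSup_le fun β => ?_
    by_cases hβ : β ∈ S
    · exact le_sup_of_le_left (le_iSup₂_of_le β hβ le_rfl)
    · exact le_sup_of_le_right (le_iSup₂_of_le (f := fun β (_ : β ∈ Sᶜ) => s.maxGenEigenspace β)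
        β hβ le_rfl)

/-- A stable subspace whose eigenvalues belong to `S` is contained in the spectral subspace. -/
theorem le_spectralSubspace [IsAlgClosed F] [Module.Finite F W] {s : Module.End F W}
    {S : Set F} {Q : Submodule F W} (hQ : ∀ x ∈ Q, s x ∈ Q)
    (h : ∀ x ∈ Q, ∀ β, x ≠ 0 → s x = β • x → β ∈ S) : Q ≤ spectralSubspace s S := by
  rw [Submodule.eq_iSup_inf_genEigenspace ⊤ hQ (iSup_maxGenEigenspace_eq_top s)]
  refine iSup_le fun β => ?_
  by_cases hβ : β ∈ S
  · exact inf_le_right.trans (le_iSup₂_of_le (f := fun β (_ : β ∈ S) => s.maxGenEigenspace β)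
      β hβ le_rfl)
  · refine le_of_eq_of_le ((Submodule.eq_bot_iff _).2 ?_) bot_le
    rintro x ⟨hxQ, hx⟩
    obtain ⟨k, hk⟩ := (mem_maxGenEigenspace s β x).1 hx
    by_contra hx0
    have hex : ∃ k, ((s - β • (1 : Module.End F W)) ^ k) x = 0 := ⟨k, hk⟩
    classical
    obtain ⟨m, hm⟩ : ∃ m, Nat.find hex = m + 1 := Nat.exists_eq_succ_of_ne_zero (by
      intro h0
      have := Nat.find_spec hex
      rw [h0] at this
      exact hx0 (by simpa using this))
    have h1 := Nat.find_spec hex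
    rw [hm, pow_succ', mul_apply, LinearMap.sub_apply, sub_eq_zero] at h1
    refine hβ (h (((s - β • (1 : Module.End F W)) ^ m) x) ?_ β (Nat.find_min hex (m := m) (by lia))
      (by simpa using h1))
    have hstab (k : ℕ) : ((s - β • (1 : Module.End F W)) ^ k) x ∈ Q := by
      induction k with
      | zero => simpa using hxQ
      | succ k ih =>
        rw [pow_succ', mul_apply]
        exact sub_mem (hQ _ ih) (Q.smul_mem _ ih)
    exact hstab m

theorem eigenvalue_mem_of_mem_spectralSubspace [IsAlgClosed F] [Module.Finite F W]
    {s : Module.End F W} {S : Set F} {x : W} (hx : x ∈ spectralSubspace s S) (hx0 : x ≠ 0) {β : F}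
    (h : s x = β • x) : β ∈ S := by
  by_contra hβ
  refine hx0 ((isCompl_spectralSubspace s S).disjoint.le_bot ⟨hx, ?_⟩)
  exact Submodule.mem_iSup_of_mem β (Submodule.mem_iSup_of_mem hβ
    (eigenspace_le_maxGenEigenspace (mem_eigenspace_iff.2 h)))

theorem apply_self_mem_spectralSubspace (s : Module.End F W) (S : Set F) :
    ∀ x ∈ spectralSubspace s S, s x ∈ spectralSubspace s S :=
  fun _ hx => apply_mem_spectralSubspace (Commute.refl s) hx

open Classical in
/-- The eigenvalues on a spectral subspace. -/
theorem roots_charpoly_restrict_spectralSubspace [IsAlgClosed F] [Module.Finite F W]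
    (s : Module.End F W) (S : Set F) :
    (s.restrict (apply_self_mem_spectralSubspace s S)).charpoly.roots =
      s.charpoly.roots.filter (· ∈ S) := by
  have hcompl := isCompl_spectralSubspace s S
  have hroot (S : Set F) (β : F)
      (hβ : β ∈ (s.restrict (apply_self_mem_spectralSubspace s S)).charpoly.roots) : β ∈ S := by
    rw [Polynomial.mem_roots (LinearMap.charpoly_monic _).ne_zero,
      ← hasEigenvalue_iff_isRoot_charpoly] at hβ
    obtain ⟨v, hv⟩ := hβ.exists_hasEigenvector
    exact eigenvalue_mem_of_mem_spectralSubspace v.2 (fun h => hv.2 (Subtype.ext h))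
      (congrArg Subtype.val hv.apply_eq_smul)
  have h1 := LinearMap.charpoly_prodMap (s.restrict (apply_self_mem_spectralSubspace s S))
    (s.restrict (apply_self_mem_spectralSubspace s Sᶜ))
  have h2 := LinearEquiv.charpoly_conj (Submodule.prodEquivOfIsCompl _ _ hcompl)
    (LinearMap.prodMap (s.restrict (apply_self_mem_spectralSubspace s S))
      (s.restrict (apply_self_mem_spectralSubspace s Sᶜ)))
  have h3 : (Submodule.prodEquivOfIsCompl _ _ hcompl).conj
    (LinearMap.prodMap (s.restrict (apply_self_mem_spectralSubspace s S))
      (s.restrict (apply_self_mem_spectralSubspace s Sᶜ))) = s := by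
    apply LinearMap.ext
    intro x
    obtain ⟨⟨a, b⟩, rfl⟩ := (Submodule.prodEquivOfIsCompl _ _ hcompl).surjective x
    rw [LinearEquiv.conj_apply_apply, LinearEquiv.symm_apply_apply]
    simp
  rw [h3, h1] at h2
  rw [h2, Polynomial.roots_mul (mul_ne_zero (LinearMap.charpoly_monic _).ne_zero
    (LinearMap.charpoly_monic _).ne_zero), Multiset.filter_add,
    Multiset.filter_eq_self.2 (hroot S), Multiset.filter_eq_nil.2 (hroot Sᶜ), add_zero]

open Classical in
theorem finrank_spectralSubspace [IsAlgClosed F] [Module.Finite F W] (s : Module.End F W)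
    (S : Set F) : Module.finrank F (spectralSubspace s S) =
      Multiset.card (s.charpoly.roots.filter (· ∈ S)) := by
  rw [← roots_charpoly_restrict_spectralSubspace, LinearMap.card_roots_charpoly]

end Spectral

end Module.End

/-! ### The kernel of an operator that rescales eigenvalues, and logarithms -/

namespace Module.End

section Kernel

variable {F : Type*} [Field F] [IsAlgClosed F] {W : Type*} [AddCommGroup W] [Module F W]
  [Module.Finite F W]

/-- The restriction of `N` to spectral subspaces of `s`, when `N s = c s N`. -/
noncomputable def spectralMap {s N : Module.End F W} {c : F} (hc : c ≠ 0)
    (h : N * s = c • (s * N)) (S : Set F) :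
    spectralSubspace s S →ₗ[F] spectralSubspace s {β | c * β ∈ S} :=
  N.restrict fun x hx => map_spectralSubspace_le (c⁻¹ * ·)
    (fun β hβ => by simpa [mul_inv_cancel_left₀ hc] using hβ)
    (fun β _ hx => maxGenEigenspace_scaling hc h β hx) ⟨x, hx, rfl⟩

open Classical in
/-- If the kernel of `N` is as small as the eigenvalues of `s` allow, then they determine the
eigenvalues of `s` on this kernel. -/
theorem roots_charpoly_ker_add {s N : Module.End F W} {c : F} (hc : c ≠ 0)
    (h : N * s = c • (s * N)) (S : Set F) {Q : Submodule F W} (hQ : Q = LinearMap.ker N)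
    (hsQ : ∀ x ∈ Q, s x ∈ Q)
    (hdim : Module.finrank F Q + Multiset.card (s.charpoly.roots.filter (c * · ∈ S)) ≤
      Multiset.card (s.charpoly.roots.filter (· ∈ S))) :
    (s.restrict hsQ).charpoly.roots + (s.charpoly.roots.filter (c * · ∈ S)).map (c * ·) =
      s.charpoly.roots.filter (· ∈ S) := by
  subst hQ
  let f := spectralMap hc h S
  have hf (x : spectralSubspace s S) : (f x : W) = N x := rfl
  have hdS := finrank_spectralSubspace s S
  have hdS' := finrank_spectralSubspace s {β | c * β ∈ S}
  simp only [Set.mem_ofPred_eq] at hdS'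
  rw [← hdS, ← hdS'] at hdim
  have hrn := LinearMap.finrank_range_add_finrank_ker f
  let g : LinearMap.ker f →ₗ[F] LinearMap.ker N :=
    { toFun := fun x => ⟨x.1.1, by
        have := x.2
        rw [LinearMap.mem_ker] at this ⊢
        rw [← hf, this, Submodule.coe_zero]⟩
      map_add' := fun _ _ => rfl
      map_smul' := fun _ _ => rfl }
  have hg : Function.Injective g := by
    intro x y hxy
    have h1 : ((g x : LinearMap.ker N) : W) = g y := by rw [hxy]
    exact Subtype.ext (Subtype.ext h1)
  -- Rank-nullity gives `dim W_S ≤ dim W_S' + dim ker N`, and `hdim` is the opposite inequality. So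
  -- all the intermediate inequalities are equalities: `f` is surjective and its kernel is the whole
  -- of `ker N`.
  have hgle := LinearMap.finrank_le_finrank_of_injective hg
  have hrle := Submodule.finrank_le (LinearMap.range f)
  have hfsurj : Function.Surjective f := by
    rw [← LinearMap.range_eq_top]
    exact Submodule.eq_top_of_finrank_eq (by lia)
  have hgeq : Module.finrank F (LinearMap.ker f) = Module.finrank F (LinearMap.ker N) := by lia
  have hgsurj : Function.Surjective g :=
    (LinearMap.injective_iff_surjective_of_finrank_eq_finrank hgeq).1 hg
  let e := LinearEquiv.ofBijective g ⟨hg, hgsurj⟩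
  set a := s.restrict (apply_self_mem_spectralSubspace s S)
  set b := s.restrict (apply_self_mem_spectralSubspace s {β | c * β ∈ S})
  have hcomm (x : spectralSubspace s S) : f (a x) = (c • b) (f x) := by
    apply Subtype.ext
    have := congrArg (fun f : Module.End F W => f x) h
    exact this
  have hker : ∀ x ∈ LinearMap.ker f, a x ∈ LinearMap.ker f := by
    intro x hx
    rw [LinearMap.mem_ker] at hx ⊢
    rw [hcomm, hx, map_zero]
  -- In the exact sequence `0 → ker N → W_S → W_S' → 0`, the action of `s` on `W_S` induces `c s` on
  -- the quotient `W_S'`.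
  have h1 := LinearMap.charpoly_eq_mul_of_surjective f hfsurj a (c • b) hcomm hker
  have h2 : e.conj (a.restrict hker) = s.restrict hsQ := by
    apply LinearMap.ext
    intro x
    obtain ⟨x, rfl⟩ := e.surjective x
    rw [LinearEquiv.conj_apply_apply, LinearEquiv.symm_apply_apply]
    rfl
  have h3 := congrArg Polynomial.roots h1
  rw [Polynomial.roots_mul (mul_ne_zero (LinearMap.charpoly_monic _).ne_zero
    (LinearMap.charpoly_monic _).ne_zero), LinearMap.roots_charpoly_smul b hc,
    roots_charpoly_restrict_spectralSubspace, roots_charpoly_restrict_spectralSubspace,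
    ← LinearEquiv.charpoly_conj e, h2] at h3
  exact h3.symm

-- Rank-nullity for `N : W_S → W_S'`, which is surjective by `hsurj` and has kernel the whole of
-- `ker N` by `hker`.
open Classical in
theorem finrank_ker_add_of_surjective {s N : Module.End F W} {c : F} (hc : c ≠ 0)
    (h : N * s = c • (s * N)) (S : Set F) (hker : LinearMap.ker N ≤ spectralSubspace s S)
    (hsurj : spectralSubspace s {β | c * β ∈ S} ≤ (spectralSubspace s S).map N) :
    Module.finrank F (LinearMap.ker N) + Multiset.card (s.charpoly.roots.filter (c * · ∈ S)) =
      Multiset.card (s.charpoly.roots.filter (· ∈ S)) := by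
  let f := spectralMap hc h S
  have hdS := finrank_spectralSubspace s S
  have hdS' := finrank_spectralSubspace s {β | c * β ∈ S}
  simp only [Set.mem_ofPred_eq] at hdS'
  rw [← hdS, ← hdS', ← LinearMap.finrank_range_add_finrank_ker f]
  have h1 : LinearMap.range f = ⊤ := by
    rw [LinearMap.range_eq_top]
    intro y
    obtain ⟨x, hx, hxy⟩ := hsurj y.2
    exact ⟨⟨x, hx⟩, Subtype.ext hxy⟩
  have h2 : LinearMap.ker f = (LinearMap.ker N).comap (spectralSubspace s S).subtype := by
    ext x
    exact ⟨fun hx => congrArg Subtype.val hx, fun hx => Subtype.ext hx⟩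
  rw [h1, finrank_top, h2, add_comm, (Submodule.comapSubtypeEquivOfLe hker).finrank_eq]

end Kernel

section Logarithm

variable {F : Type*} [Field F] [CharZero F]

/-- A polynomial in `k` that vanishes at all natural numbers is zero in characteristic zero; linear
forms reduce vector coefficients to scalar ones. -/
theorem _root_.eq_zero_of_forall_sum_pow_smul {X : Type*} [AddCommGroup X] [Module F X] {n : ℕ}
    {c : ℕ → X} (h : ∀ k : ℕ, ∑ i ∈ Finset.range n, (k : F) ^ i • c i = 0) {i : ℕ} (hi : i < n) :
    c i = 0 := by
  rw [← Module.forall_dual_apply_eq_zero_iff F]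
  intro φ
  let q : F[X] := ∑ i ∈ Finset.range n, Polynomial.C (φ (c i)) * Polynomial.X ^ i
  have hq : q = 0 := by
    refine Polynomial.eq_zero_of_infinite_isRoot q (Set.infinite_of_injective_forall_mem
      (f := fun k : ℕ => (k : F)) Nat.cast_injective fun k => ?_)
    have := congrArg φ (h k)
    rw [map_zero, map_sum] at this
    change Polynomial.eval (k : F) q = 0
    rw [Polynomial.eval_finsetSum]
    rw [← this]
    refine Finset.sum_congr rfl fun i _ => ?_
    rw [Polynomial.eval_C_mul, Polynomial.eval_pow, Polynomial.eval_X, map_smul, smul_eq_mul,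
      mul_comm]
  have := congrArg (Polynomial.coeff · i) hq
  simpa [q, Polynomial.finsetSum_coeff, Polynomial.coeff_C_mul, Polynomial.coeff_X_pow, hi]
    using this

variable {V : Type*} [AddCommGroup V] [Module F V]

/-- `N` is the logarithm of `T`: the powers `T ^ k` are polynomials in `k` with linear
coefficient `N`. -/
def IsLogarithm (T N : Module.End F V) : Prop :=
  ∃ (a : ℕ → Module.End F V) (n₀ : ℕ), a 1 = N ∧
    ∀ n ≥ n₀, ∀ k : ℕ, T ^ k = ∑ i ∈ Finset.range n, (k : F) ^ i • a i

/-- Both sides of `hab` are polynomial in `k`. Comparing the linear coefficients gives the result,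
the substitution of `c k` for `k` producing the factor `c`. -/
theorem IsLogarithm.intertwine {V' : Type*} [AddCommGroup V'] [Module F V']
    {T N : Module.End F V} {T' N' : Module.End F V'} (h : IsLogarithm T N)
    (h' : IsLogarithm T' N') {a b : V →ₗ[F] V'} {c : ℕ}
    (hab : ∀ k, (T' ^ k) ∘ₗ a = b ∘ₗ (T ^ (c * k))) : N' ∘ₗ a = (c : F) • (b ∘ₗ N) := by
  obtain ⟨x, n, rfl, hx⟩ := h
  obtain ⟨y, m, rfl, hy⟩ := h'
  have key := eq_zero_of_forall_sum_pow_smul (F := F) (n := n + m + 2)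
    (c := fun i => y i ∘ₗ a - (c : F) ^ i • (b ∘ₗ x i)) (fun k => by
      have h1 := hab k
      rw [hy (n + m + 2) (by lia), hx (n + m + 2) (by lia)] at h1
      simp only [smul_sub, Finset.sum_sub_distrib]
      rw [sub_eq_zero]
      apply LinearMap.ext
      intro v
      have h2 := congrArg (fun f : V →ₗ[F] V' => f v) h1
      simp only [LinearMap.comp_apply, LinearMap.sum_apply, LinearMap.smul_apply, map_sum,
        map_smul] at h2 ⊢
      rw [h2]
      refine Finset.sum_congr rfl fun i _ => ?_
      rw [smul_smul, ← mul_pow, Nat.cast_mul, mul_comm]) (i := 1) (by lia)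
  simpa [sub_eq_zero] using key

/-- Unipotent endomorphisms have logarithms. -/
theorem exists_isLogarithm {T : Module.End F V} (hT : IsNilpotent (T - 1)) :
    ∃ N y : Module.End F V, IsLogarithm T N ∧ IsUnit y ∧ N = y * (T - 1) := by
  obtain ⟨m, hm⟩ := hT
  set u := T - 1
  -- The binomial coefficient `k.choose i` as a polynomial in `k`: `T ^ k` is the sum of the `q i
  -- (k) • u ^ i`, with `u` nilpotent.
  let q (i : ℕ) : F[X] := Polynomial.C ((i.factorial : F)⁻¹) * descPochhammer F i
  have hq (i k : ℕ) : (q i).eval (k : F) = k.choose i := by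
    have : (i.factorial : F) ≠ 0 := Nat.cast_ne_zero.2 i.factorial_ne_zero
    rw [Polynomial.eval_mul, Polynomial.eval_C, descPochhammer_eval_eq_descFactorial,
      Nat.descFactorial_eq_factorial_mul_choose, Nat.cast_mul, inv_mul_cancel_left₀ this]
  have hqdeg (i : ℕ) : (q i).natDegree ≤ i :=
    (Polynomial.natDegree_C_mul_le _ _).trans (descPochhammer_natDegree F i).le
  have hu0 (i : ℕ) (hi : m ≤ i) : u ^ i = 0 := pow_eq_zero_of_le hi hm
  have hTk (k : ℕ) : T ^ k = ∑ i ∈ Finset.range (m + 2), (k.choose i : F) • u ^ i := by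
    have h1 : T ^ k = ∑ i ∈ Finset.range (k + 1), (k.choose i : F) • u ^ i := by
      rw [show T = u + 1 by simp [u], (Commute.one_right u).add_pow]
      refine Finset.sum_congr rfl fun i _ => ?_
      rw [one_pow, mul_one, ← (Nat.cast_commute _ _).eq, ← nsmul_eq_mul, Nat.cast_smul_eq_nsmul]
    rw [h1]
    rcases le_total (k + 1) (m + 2) with h | h
    · refine Finset.sum_subset (Finset.range_mono h) fun i _ hi => ?_
      rw [Nat.choose_eq_zero_of_lt (by simpa using hi), Nat.cast_zero, zero_smul]
    · refine (Finset.sum_subset (Finset.range_mono h) fun i _ hi => ?_).symm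
      rw [hu0 i (by simp at hi; lia), smul_zero]
  let a (j : ℕ) : Module.End F V := ∑ i ∈ Finset.range (m + 2), (q i).coeff j • u ^ i
  -- `q 0` has no linear term and `q 1 = X`, so the linear coefficient is `u` plus terms in `u ^ 2`,
  -- that is `(1 + u z) u`.
  let z : Module.End F V := ∑ i ∈ Finset.range m, (q (i + 2)).coeff 1 • u ^ i
  have hz : Commute u z := Commute.sum_right _ _ _ fun i _ =>
    ((Commute.refl u).pow_right i).smul_right _
  refine ⟨a 1, 1 + u * z, ⟨a, m + 2, rfl, fun n hn k => ?_⟩, ?_, ?_⟩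
  · rw [hTk]
    simp only [a, Finset.smul_sum]
    rw [Finset.sum_comm]
    refine Finset.sum_congr rfl fun i hi => ?_
    rw [← hq, Polynomial.eval_eq_sum_range' (n := n)
      ((hqdeg i).trans_lt (by simp at hi; lia)), Finset.sum_smul]
    refine Finset.sum_congr rfl fun j _ => ?_
    rw [smul_smul, mul_comm]
  · exact (hz.isNilpotent_mul_right ⟨m, hm⟩).isUnit_one_add
  · have h0 : (q 0).coeff 1 = 0 := by simp [q, Polynomial.coeff_one]
    have h1 : (q 1).coeff 1 = 1 := by simp [q]
    simp only [a]
    rw [Finset.sum_range_succ', Finset.sum_range_succ', zero_add, h0, h1, zero_smul, add_zero,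
      one_smul, pow_one, add_mul, one_mul, hz.eq, mul_assoc, add_comm]
    congr 1
    rw [Finset.sum_mul]
    refine Finset.sum_congr rfl fun i _ => ?_
    rw [smul_mul_assoc, ← pow_two, ← pow_add]

end Logarithm

end Module.End

/-! ### Weights of Weil numbers -/

section Weil

variable {ℓ : ℕ} {K : Type*} [Field K] [Algebra ℚ K] {α : K} {m m' : ℤ}

theorem IsWeilNumber.weight_unique (hℓ : 1 < ℓ) (h : IsWeilNumber ℓ m α)
    (h' : IsWeilNumber ℓ m' α) : m = m' := by
  have hint : IsIntegral ℚ α := h.1.isIntegral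
  obtain ⟨z, hz⟩ := IsAlgClosed.exists_aeval_eq_zero ℂ (minpoly ℚ α) (minpoly.degree_pos hint).ne'
  have hz' : z ∈ (minpoly ℚ α).aroots ℂ := by
    rw [Polynomial.mem_aroots]; exact ⟨minpoly.ne_zero hint, hz⟩
  have h1 := (h.2 z hz').symm.trans (h'.2 z hz')
  have hℓ' : (1 : ℝ) < ℓ := by exact_mod_cast hℓ
  have h2 := congrArg (Real.logb ℓ) h1
  rw [Real.logb_rpow (by linarith) hℓ'.ne', Real.logb_rpow (by linarith) hℓ'.ne'] at h2
  have h3 : (m : ℝ) = m' := by linarith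
  exact_mod_cast h3

theorem IsWeilNumber.smul (h : IsWeilNumber ℓ m α) {q : ℚ} (hq : q ≠ 0) {e : ℤ} (hℓ : 0 < ℓ)
    (hqe : ‖(q : ℂ)‖ = (ℓ : ℝ) ^ ((e : ℝ) / 2)) : IsWeilNumber ℓ (m + e) (q • α) := by
  have hint : IsIntegral ℚ α := h.1.isIntegral
  refine ⟨(hint.smul q).isAlgebraic, fun z hz => ?_⟩
  rw [Polynomial.mem_aroots] at hz
  have hdvd : minpoly ℚ (q • α) ∣ (minpoly ℚ α).comp (Polynomial.C q⁻¹ * Polynomial.X) := by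
    apply minpoly.dvd
    rw [Polynomial.aeval_comp, map_mul, Polynomial.aeval_C, Polynomial.aeval_X, ← Algebra.smul_def,
      smul_smul, inv_mul_cancel₀ hq, one_smul, minpoly.aeval]
  have hz2 : Polynomial.aeval ((q : ℂ)⁻¹ * z) (minpoly ℚ α) = 0 := by
    obtain ⟨P, hP⟩ := hdvd
    have := congrArg (Polynomial.aeval z) hP
    rw [map_mul, hz.2, zero_mul, Polynomial.aeval_comp] at this
    simpa using this
  have h1 := h.2 _ (Polynomial.mem_aroots.2 ⟨minpoly.ne_zero hint, hz2⟩)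
  have hq' : (q : ℂ) ≠ 0 := by exact_mod_cast hq
  have h2 : z = q * ((q : ℂ)⁻¹ * z) := by rw [mul_inv_cancel_left₀ hq']
  rw [h2, norm_mul, h1, hqe, ← Real.rpow_add (by exact_mod_cast hℓ)]
  congr 1
  push_cast
  ring

theorem isWeilNumber_natCast_mul_iff [CharZero K] (hℓ : 0 < ℓ) :
    IsWeilNumber ℓ m ((ℓ : K) * α) ↔ IsWeilNumber ℓ (m - 2) α := by
  have hℓ' : (ℓ : ℚ) ≠ 0 := by exact_mod_cast hℓ.ne'
  have hℓK : (ℓ : K) ≠ 0 := by exact_mod_cast hℓ.ne'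
  constructor
  · intro h
    have := h.smul (q := (ℓ : ℚ)⁻¹) (e := -2) (inv_ne_zero hℓ') hℓ (by
      push_cast
      rw [norm_inv, Complex.norm_natCast, show (-2 : ℝ) / 2 = -1 by norm_num, Real.rpow_neg_one])
    rw [Algebra.smul_def, map_inv₀, map_natCast, inv_mul_cancel_left₀ hℓK] at this
    exact this
  · intro h
    have := h.smul (q := (ℓ : ℚ)) (e := 2) hℓ' hℓ (by
      push_cast
      rw [Complex.norm_natCast, show (2 : ℝ) / 2 = 1 by norm_num, Real.rpow_one])
    rw [Algebra.smul_def, map_natCast, sub_add_cancel] at this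
    exact this

end Weil

/-! ### The monodromy filtration and its weights -/

namespace IsMonodromyFiltration

variable {K : Type*} [Field K] {V : Type*} [AddCommGroup V] [Module K V]
  {N : Module.End K V} {M : ℤ → Submodule K V}

theorem map_pow_le (hM : IsMonodromyFiltration N M) (k : ℕ) (j : ℤ) {x : V} (hx : x ∈ M j) :
    (N ^ k) x ∈ M (j - 2 * k) := by
  induction k with
  | zero => simpa using hx
  | succ k ih =>
    rw [pow_succ', Module.End.mul_apply]
    have := hM.map_le _ ⟨_, ih, rfl⟩
    convert this using 2
    push_cast; ring

theorem exists_mem_notMem {a b : ℤ} (hM : Monotone M) {x : V} (ha : x ∈ M a) (hb : x ∉ M b) :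
    ∃ j, b < j ∧ j ≤ a ∧ x ∈ M j ∧ x ∉ M (j - 1) := by
  by_contra! hcon
  have hba : b ≤ a := by
    by_contra hlt
    exact hb (hM (not_le.1 hlt).le ha)
  have key (d : ℕ) (hd : b ≤ a - d) : x ∈ M (a - d) := by
    induction d with
    | zero => simpa using ha
    | succ d ih =>
      have := hcon (a - d) (by push_cast at hd; lia) (by lia) (ih (by push_cast at hd; lia))
      convert this using 2
      push_cast; ring
  obtain ⟨d, hd⟩ := Int.eq_ofNat_of_zero_le (sub_nonneg.2 hba)
  have := key d (by lia)
  rw [← hd, sub_sub_cancel] at this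
  exact hb this

/-- The monodromy filtration is stable under the operators which commute with `N` up to a scalar. -/
theorem apply_mem (hM : IsMonodromyFiltration N M) {g : Module.End K V} {c : K} (hc : c ≠ 0)
    (h : N * g = c • (g * N)) (j : ℤ) : ∀ x ∈ M j, g x ∈ M j := by
  have hpow (k : ℕ) (x : V) : (N ^ k) (g x) = c ^ k • g ((N ^ k) x) := by
    induction k with
    | zero => simp
    | succ k ih =>
      have h1 := congrArg (fun f : Module.End K V => f ((N ^ k) x)) h
      simp only [Module.End.mul_apply, LinearMap.smul_apply] at h1
      rw [pow_succ', Module.End.mul_apply, ih, map_smul, h1, smul_smul, pow_succ,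
        Module.End.mul_apply]
  obtain ⟨a, ha⟩ := hM.exists_eq_bot
  obtain ⟨b, hb⟩ := hM.exists_eq_top
  have htop (j : ℤ) (hj : b ≤ j) : M j = ⊤ := top_le_iff.1 (hb ▸ hM.monotone hj)
  have hbot (j : ℤ) (hj : j ≤ a) : M j = ⊥ := le_bot_iff.1 (ha ▸ hM.monotone hj)
  -- Induction from the outer steps of the filtration, where it is `⊤` and `⊥`, towards the middle.
  -- An element of `M (k + 1)` is in `M k` when `N ^ (k + 1)` sends it to `M (-k - 2)`, and `M (-k -
  -- 1)` is generated by `N ^ (k + 1)` of `M (k + 1)` and by `M (-k - 2)`.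
  have key (d k : ℕ) (hd : b ≤ k + d ∧ -(k : ℤ) - d - 1 ≤ a) :
      (∀ x ∈ M k, g x ∈ M k) ∧ ∀ x ∈ M (-k - 1), g x ∈ M (-k - 1) := by
    induction d generalizing k with
    | zero =>
      constructor
      · intro x _; rw [htop k (by lia)]; trivial
      · intro x hx
        rw [hbot _ (by lia), Submodule.mem_bot] at hx ⊢
        rw [hx, map_zero]
    | succ d ih =>
      obtain ⟨h1, h2⟩ := ih (k + 1) (by push_cast at hd ⊢; lia)
      constructor
      · intro x hx
        have h3 : (N ^ (k + 1)) (g x) ∈ M (-(k + 1 : ℕ) - 1) := by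
          rw [hpow]
          refine Submodule.smul_mem _ _ (h2 _ ?_)
          have := hM.map_pow_le (k + 1) k hx
          convert this using 2
          push_cast; ring
        have := hM.injective (k + 1) _ (h1 x (hM.monotone (by lia) hx)) h3
        convert this using 2
        push_cast; ring
      · intro x hx
        have hx' : x ∈ M (-(k + 1 : ℕ)) := by convert hx using 2; push_cast; ring
        obtain ⟨_, ⟨y, hy, rfl⟩, z, hz, rfl⟩ := Submodule.mem_sup.1 (hM.surjective (k + 1) hx')
        rw [map_add]
        refine add_mem ?_ (hM.monotone (by lia) (h2 z hz))
        have h3 := hM.map_pow_le (k + 1) _ (h1 y hy)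
        rw [hpow] at h3
        have h4 := (Submodule.smul_mem_iff _ (pow_ne_zero (k + 1) hc)).1 h3
        convert h4 using 2
        push_cast; ring
  rcases le_or_gt 0 j with hj | hj
  · obtain ⟨k, rfl⟩ := Int.eq_ofNat_of_zero_le hj
    exact (key (b.toNat + (-a).toNat) k (by lia)).1
  · obtain ⟨k, hk⟩ := Int.eq_ofNat_of_zero_le (show 0 ≤ -j - 1 by lia)
    obtain rfl : j = -k - 1 := by lia
    exact (key (b.toNat + (-a).toNat) k (by lia)).2

/-- `N ^ k` is injective on the graded part of degree `k > 0`, so an element killed by `N` has no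
component there. -/
theorem ker_le (hM : IsMonodromyFiltration N M) : LinearMap.ker N ≤ M 0 := by
  intro x hx
  obtain ⟨b, hb⟩ := hM.exists_eq_top
  by_contra h0
  obtain ⟨j, hj, -, hxj, hxj'⟩ := exists_mem_notMem hM.monotone (a := b) (hb ▸ trivial) h0
  obtain ⟨k, rfl⟩ := Int.eq_ofNat_of_zero_le hj.le
  refine hxj' (hM.injective k x hxj ?_)
  obtain ⟨i, rfl⟩ : ∃ i, k = i + 1 := Nat.exists_eq_succ_of_ne_zero (by lia)
  rw [pow_succ, Module.End.mul_apply, LinearMap.mem_ker.1 hx, map_zero]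
  exact zero_mem _

/-- `M (-k)` is contained in `N ^ k M k + M (-k - 1)`. For `k ≥ 2` the first term lies in `N M (2 -
k)`, hence in `N M 0`, and the argument continues with the second until the filtration vanishes. -/
theorem le_map (hM : IsMonodromyFiltration N M) : M (-2) ≤ (M 0).map N := by
  obtain ⟨a, ha⟩ := hM.exists_eq_bot
  have key (d k : ℕ) (hk : 2 ≤ k) (hd : -a ≤ k + d) : M (-k) ≤ (M 0).map N := by
    induction d generalizing k with
    | zero =>
      have : M (-k) = ⊥ := le_bot_iff.1 (ha ▸ hM.monotone (by lia))
      rw [this]; exact bot_le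
    | succ d ih =>
      refine (hM.surjective k).trans (sup_le ?_ ?_)
      · rintro _ ⟨x, hx, rfl⟩
        obtain ⟨i, rfl⟩ : ∃ i, k = i + 1 := Nat.exists_eq_succ_of_ne_zero (by lia)
        rw [pow_succ', Module.End.mul_apply]
        exact ⟨_, hM.monotone (by push_cast; lia) (hM.map_pow_le i _ hx), rfl⟩
      · have := ih (k + 1) (by lia) (by push_cast at hd ⊢; lia)
        convert this using 2
        push_cast; ring
  exact key (-a).toNat 2 le_rfl (by lia)

/-- The monodromy filtration of a direct factor. -/
theorem restrict (hM : IsMonodromyFiltration N M) {W : Submodule K V} {π : Module.End K V}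
    (hπW : ∀ x, π x ∈ W) (hπ : ∀ x ∈ W, π x = x) (hN : Commute N π) (hNW : ∀ x ∈ W, N x ∈ W) :
    IsMonodromyFiltration (N.restrict hNW) fun j => (M j).comap W.subtype where
  monotone _ _ h := Submodule.comap_mono (hM.monotone h)
  exists_eq_bot := by
    obtain ⟨a, ha⟩ := hM.exists_eq_bot
    exact ⟨a, by simp [ha]⟩
  exists_eq_top := by
    obtain ⟨b, hb⟩ := hM.exists_eq_top
    exact ⟨b, by simp [hb]⟩
  map_le j := by
    rintro _ ⟨x, hx, rfl⟩
    exact hM.map_le j ⟨x, hx, rfl⟩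
  injective k x hx hNx := by
    refine hM.injective k x hx ?_
    rw [Module.End.pow_restrict k] at hNx
    exact hNx
  surjective k := by
    intro x hx
    obtain ⟨_, ⟨y, hy, rfl⟩, z, hz, hyz⟩ := Submodule.mem_sup.1 (hM.surjective k hx)
    have hst := fun j => hM.apply_mem one_ne_zero (g := π) (by rw [one_smul]; exact hN.eq) j
    refine Submodule.mem_sup.2 ⟨_, ⟨⟨π y, hπW y⟩, hst _ _ hy, rfl⟩, ⟨π z, hπW z⟩, hst _ _ hz, ?_⟩
    apply Subtype.ext
    rw [Submodule.coe_add, Module.End.pow_restrict k]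
    have h1 := congrArg π hyz
    rw [map_add, Submodule.coe_subtype, hπ _ x.2] at h1
    rw [← h1]
    congr 1
    exact congrArg (fun f : Module.End K V => f y) (hN.pow_left k).eq

open Classical in
/-- For a pure action, the kernel of monodromy has the dimension predicted by the weights. -/
theorem finrank_ker_add [IsAlgClosed K] [CharZero K] [Algebra ℚ K] [Module.Finite K V]
    (hM : IsMonodromyFiltration N M) {s : Module.End K V} {ℓ : ℕ} (hℓ : 1 < ℓ)
    (hs : N * s = (ℓ : K) • (s * N)) {w : ℤ}
    (hw : ∀ (j : ℤ) (α : K), (∃ x ∈ M j, x ∉ M (j - 1) ∧ s x - α • x ∈ M (j - 1)) →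
      IsWeilNumber ℓ (w + j) α) :
    Module.finrank K (LinearMap.ker N) + Multiset.card (s.charpoly.roots.filter
      ((ℓ : K) * · ∈ {α | ∃ j ≤ 0, IsWeilNumber ℓ (w + j) α})) =
      Multiset.card (s.charpoly.roots.filter (· ∈ {α | ∃ j ≤ 0, IsWeilNumber ℓ (w + j) α})) := by
  have hℓK : (ℓ : K) ≠ 0 := Nat.cast_ne_zero.2 (by lia)
  -- Purity identifies `M a` with the sum of the generalized eigenspaces of weight at most `w + a`,
  -- because the weight of an eigenvalue is unique.
  have hspec (a : ℤ) : Module.End.spectralSubspace s {α | ∃ j ≤ a, IsWeilNumber ℓ (w + j) α} =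
      M a := by
    apply le_antisymm
    · refine iSup₂_le fun β hβ x hx => ?_
      obtain ⟨j', hj', hβ⟩ := hβ
      obtain ⟨k, hk⟩ := (Module.End.mem_maxGenEigenspace s β x).1 hx
      clear hx
      induction k generalizing x with
      | zero => simp at hk; rw [hk]; exact zero_mem _
      | succ k ih =>
        rw [pow_succ, Module.End.mul_apply] at hk
        have h1 := ih _ hk
        by_contra hxa
        obtain ⟨b, hb⟩ := hM.exists_eq_top
        obtain ⟨j, hj, -, hxj, hxj'⟩ := exists_mem_notMem hM.monotone (a := b) (hb ▸ trivial) hxa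
        have h2 := hw j β ⟨x, hxj, hxj', hM.monotone (by lia) h1⟩
        have := h2.weight_unique hℓ hβ
        lia
    · refine Module.End.le_spectralSubspace (hM.apply_mem hℓK hs a) fun x hx β hx0 hxβ => ?_
      obtain ⟨b, hb⟩ := hM.exists_eq_bot
      obtain ⟨j, -, hj, hxj, hxj'⟩ := exists_mem_notMem hM.monotone (b := b) hx
        (by rw [hb]; exact fun h => hx0 ((Submodule.mem_bot K).1 h))
      exact ⟨j, hj, hw j β ⟨x, hxj, hxj', by rw [hxβ, sub_self]; exact zero_mem _⟩⟩
  -- Multiplication by `ℓ` raises weights by `2`, so `N : W_S → W_S'` is `N : M 0 → M (-2)`.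
  have hS : {β : K | (ℓ : K) * β ∈ {α | ∃ j ≤ 0, IsWeilNumber ℓ (w + j) α}} =
      {α | ∃ j ≤ -2, IsWeilNumber ℓ (w + j) α} := by
    ext β
    constructor
    · rintro ⟨j, hj, h⟩
      rw [isWeilNumber_natCast_mul_iff (by lia)] at h
      exact ⟨j - 2, by lia, by convert h using 1; ring⟩
    · rintro ⟨j, hj, h⟩
      refine ⟨j + 2, by lia, ?_⟩
      rw [isWeilNumber_natCast_mul_iff (by lia)]
      convert h using 1; ring
  refine Module.End.finrank_ker_add_of_surjective hℓK hs _ ?_ ?_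
  · rw [hspec]; exact hM.ker_le
  · rw [hS, hspec, hspec]; exact hM.le_map

end IsMonodromyFiltration

/-! ### The monodromy operator and its commutation relations -/

section Monodromy

variable {ℓ p : ℕ} [Fact ℓ.Prime] [Fact p.Prime]

/-- Compactness makes the index finite. The factorial of the index works for all elements at once,
although `U` need not be normal. -/
theorem exists_pow_mem_of_isOpen (U : Subgroup (inertiaGroup ℓ))
    (hU : IsOpen (U : Set (inertiaGroup ℓ))) : ∃ k : ℕ, k ≠ 0 ∧ ∀ τ, τ ^ k ∈ U := by
  have : CompactSpace (inertiaGroup ℓ) := isCompact_iff_compactSpace.1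
    LocalGaloisGroup.isClosed_inertiaGroup.isCompact
  have := Subgroup.quotient_finite_of_isOpen U hU
  have : U.FiniteIndex := Subgroup.finiteIndex_of_finite_quotient
  refine ⟨U.index.factorial, Nat.factorial_ne_zero _, fun τ => ?_⟩
  obtain ⟨k, hk0, hk, hkU⟩ := U.exists_pow_mem_of_index_ne_zero this.index_ne_zero τ
  obtain ⟨d, hd⟩ := Nat.dvd_factorial hk0 hk
  rw [hd, pow_mul]
  exact U.pow_mem hkU d

variable {K : Type*} [Field K] [CharZero K] [Algebra ℤ_[p] K] {V : Type*} [AddCommGroup V]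
  [Module K V] [Module.Finite K V] {r : Representation K (LocalGaloisGroup ℓ) V}
  {t : inertiaGroup ℓ → ℤ_[p]} {N : Module.End K V}

/-- Since `τ ^ k ∈ U`, the action of `(τ ^ k) ^ j` is the exponential of `j k t(τ) N`, a polynomial
in `j`. -/
theorem IsMonodromyOperator.exists_isLogarithm (s : TameSystem t) (hℓp : ℓ ≠ p)
    (h : IsMonodromyOperator r t N) : ∃ k : ℕ, k ≠ 0 ∧ ∀ τ : inertiaGroup ℓ,
      Module.End.IsLogarithm (r τ ^ k) (((k : K) * algebraMap ℤ_[p] K (t τ)) • N) := by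
  obtain ⟨hN, U, hU, hUr⟩ := h
  obtain ⟨k, hk, hkU⟩ := exists_pow_mem_of_isOpen U hU
  have hN0 (i : ℕ) (hi : Module.finrank K V ≤ i) : N ^ i = 0 := by
    refine pow_eq_zero_of_le hi ?_
    have h1 := LinearMap.aeval_self_charpoly N
    rwa [(LinearMap.isNilpotent_iff_charpoly N).1 hN, map_pow, Polynomial.aeval_X] at h1
  refine ⟨k, hk, fun τ => ⟨fun i => (((k : K) * algebraMap ℤ_[p] K (t τ)) ^ i / (i.factorial : K)) •
    N ^ i, Module.finrank K V, by simp, fun n hn j => ?_⟩⟩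
  have h1 := hUr _ (U.pow_mem (hkU τ) j)
  rw [← pow_mul, Subgroup.coe_pow, map_pow, pow_mul] at h1
  rw [h1, s.map_pow hℓp]
  rw [← Finset.sum_subset (Finset.range_mono hn)]
  · refine Finset.sum_congr rfl fun i _ => ?_
    rw [smul_smul]
    congr 1
    simp only [map_mul, map_natCast, Nat.cast_mul]
    ring
  · intro i _ hi
    change _ • (_ • N ^ i) = 0
    rw [hN0 i (by simpa using hi), smul_zero, smul_zero]

variable (s : TameSystem t) (hℓp : ℓ ≠ p) (hinj : Function.Injective (algebraMap ℤ_[p] K))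

include s hℓp

/-- `r γ` intertwines the powers of `r τ'` and of `r τ`, hence their logarithms; the common factor
`k` is then cancelled. -/
theorem IsMonodromyOperator.conj_smul (h : IsMonodromyOperator r t N) (γ : LocalGaloisGroup ℓ)
    {τ τ' : inertiaGroup ℓ} (hτ : (τ' : LocalGaloisGroup ℓ) = γ⁻¹ * τ * γ) :
    algebraMap ℤ_[p] K (t τ) • (N * r γ) = algebraMap ℤ_[p] K (t τ') • (r γ * N) := by
  obtain ⟨k, hk, hlog⟩ := h.exists_isLogarithm s hℓp
  have h1 := (hlog τ').intertwine (hlog τ) (a := r γ) (b := r γ) (c := 1) (fun j => by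
    rw [one_mul, ← pow_mul, ← pow_mul, ← map_pow, ← map_pow]
    change r _ * r γ = r γ * r _
    rw [← map_mul, ← map_mul]
    congr 1
    have : ((τ' : LocalGaloisGroup ℓ)) ^ (k * j) = γ⁻¹ * (τ : LocalGaloisGroup ℓ) ^ (k * j) * γ := by
      have := conj_pow (i := k * j) (a := γ⁻¹) (b := (τ : LocalGaloisGroup ℓ))
      rw [inv_inv] at this
      rw [hτ, this]
    rw [this]; group)
  rw [Nat.cast_one, one_smul, LinearMap.comp_smul, LinearMap.smul_comp, mul_smul, mul_smul] at h1
  exact smul_right_injective _ (Nat.cast_ne_zero.2 hk : (k : K) ≠ 0) h1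

include hinj

theorem IsMonodromyOperator.mul_frobenius (h : IsMonodromyOperator r t N) {σ : LocalGaloisGroup ℓ}
    (hσ : IsGeometricFrobenius σ) : N * r σ = (ℓ : K) • (r σ * N) := by
  obtain ⟨τ, hτ⟩ := s.exists_ne_zero hℓp hσ
  have hmem : σ⁻¹ * τ * σ ∈ inertiaGroup ℓ := by
    simpa using (inferInstance : (inertiaGroup ℓ).Normal).conj_mem _ τ.2 σ⁻¹
  have h1 := h.conj_smul s hℓp σ (τ := τ) (τ' := ⟨_, hmem⟩) rfl
  rw [s.map_conj_frobenius hℓp hσ τ ⟨_, hmem⟩ rfl, _root_.map_mul, map_natCast, mul_comm,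
    mul_smul] at h1
  exact smul_right_injective _ ((map_ne_zero_iff _ hinj).2 hτ) h1

theorem IsMonodromyOperator.commute_inertia (h : IsMonodromyOperator r t N)
    {σ : LocalGaloisGroup ℓ} (hσ : IsGeometricFrobenius σ) (γ : inertiaGroup ℓ) :
    Commute N (r γ) := by
  obtain ⟨τ, hτ⟩ := s.exists_ne_zero hℓp hσ
  have h1 := h.conj_smul s hℓp γ (τ := τ) (τ' := γ⁻¹ * τ * γ) rfl
  rw [s.map_mul hℓp, s.map_mul hℓp, s.map_inv hℓp, neg_add_cancel_comm] at h1
  exact smul_right_injective _ ((map_ne_zero_iff _ hinj).2 hτ) h1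

end Monodromy

/-! ### Euler factors as products over eigenvalues -/

section EulerFactor

theorem Polynomial.reverse_prod_X_sub_C {K : Type*} [Field K] (s : Multiset K) :
    (s.map fun β => Polynomial.X - Polynomial.C β).prod.reverse =
      (s.map fun β => 1 - Polynomial.C β * Polynomial.X).prod := by
  induction s using Multiset.induction with
  | empty => simpa using Polynomial.reverse_C (1 : K)
  | cons β s ih =>
    rw [Multiset.map_cons, Multiset.prod_cons, Polynomial.reverse_mul_of_domain, ih,
      Multiset.map_cons, Multiset.prod_cons]
    congr 1
    rw [Polynomial.reverse, Polynomial.natDegree_X_sub_C, Polynomial.reflect_sub,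
      Polynomial.reflect_one_X, Polynomial.reflect_C, pow_one]

theorem Determinant.charpoly_ofRepresentation {K : Type u} [Field K] [IsAlgClosed K] {G : Type v}
    [Group G] {V : Type w} [AddCommGroup V] [Module K V] [Module.Finite K V]
    (ρ : Representation K G V) (g : G) : (ofRepresentation ρ).charpoly g =
      ((ρ g).charpoly.roots.map fun β => 1 - Polynomial.C β * Polynomial.X).prod := by
  classical
  let b := Module.finBasis K V
  rw [charpoly, eval_ofRepresentation, ← det_matrixOn b, map_sub, map_one, matrixOn_single,
    ← Polynomial.reverse_prod_X_sub_C, ← LinearMap.charpoly_eq_prod_roots,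
    ← LinearMap.charpoly_toMatrix _ b, Matrix.reverse_charpoly, Matrix.charpolyRev]
  rfl

end EulerFactor

/-! ### Frobenius and inertia on the image of a unipotent projector -/

namespace IsUnipotentProjector

section Map

variable {E E' : Type*} [Ring E] [Ring E'] {ℓ : ℕ} [Fact ℓ.Prime] {M : LocalGaloisGroup ℓ →* E}
  {M' : LocalGaloisGroup ℓ →* E'} {σ : LocalGaloisGroup ℓ} {τ : inertiaGroup ℓ} {ε : E} {m : ℕ}

theorem map (h : IsUnipotentProjector M σ τ ε m) (Θ : E →+* E') (hM : ∀ γ, Θ (M γ) = M' γ) :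
    IsUnipotentProjector M' σ τ (Θ ε) m where
  ne_zero := h.ne_zero
  mem := by
    have h1 := Subalgebra.mem_map (f := (Θ.toIntAlgHom.prodMap (AlgHom.id ℤ ℤ))).2
      ⟨_, h.mem, rfl⟩
    rw [AlgHom.map_adjoin, ← Set.range_comp] at h1
    have h2 : (Θ.toIntAlgHom.prodMap (AlgHom.id ℤ ℤ)) ∘ (fun h : inertiaGroup ℓ => (M h, (1 : ℤ))) =
        fun h : inertiaGroup ℓ => (M' h, (1 : ℤ)) := by
      funext γ
      exact Prod.ext (hM γ) rfl
    rw [h2] at h1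
    exact h1
  mul_self := by rw [← map_mul, h.mul_self, map_mul, map_natCast]
  commute_frobenius := by rw [← hM]; exact h.commute_frobenius.map Θ
  commute := by rw [← hM]; exact h.commute.map Θ
  exists_pow := by
    obtain ⟨N, hN⟩ := h.exists_pow
    exact ⟨N, by rw [← hM, ← map_one Θ, ← map_sub, ← map_pow, ← map_mul, hN, map_zero]⟩
  inertia γ := by
    obtain ⟨x, hx⟩ := h.inertia γ
    exact ⟨Θ x, by
      rw [← hM, ← hM, ← map_one Θ, ← map_sub, ← map_sub, ← map_mul, hx, map_mul, map_mul]⟩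
  conj := by rw [← hM, ← hM, ← map_mul, h.conj, map_mul, map_pow]

end Map

variable {F : Type u} [Field F] {V : Type w} [AddCommGroup V] [Module F V]
  {ℓ : ℕ} [Fact ℓ.Prime] {r : Representation F (LocalGaloisGroup ℓ) V} {σ : LocalGaloisGroup ℓ}
  {τ : inertiaGroup ℓ} {ε : Module.End F V} {m : ℕ} (h : IsUnipotentProjector r σ τ ε m)

include h

theorem apply_of_mem_range {x : V} (hx : x ∈ LinearMap.range ε) : ε x = (m : F) • x := by
  obtain ⟨y, rfl⟩ := hx
  rw [← Module.End.mul_apply, h.mul_self, Module.End.mul_apply, Module.End.natCast_apply,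
    Nat.cast_smul_eq_nsmul]

omit h in
theorem _root_.LinearMap.apply_mem_range_of_commute {ε g : Module.End F V} (hg : Commute ε g) :
    ∀ x ∈ LinearMap.range ε, g x ∈ LinearMap.range ε := by
  rintro _ ⟨y, rfl⟩
  exact ⟨g y, congrArg (fun f : Module.End F V => f y) hg.eq⟩

/-- The action of Frobenius on the image of the projector. -/
noncomputable def frob : Module.End F (LinearMap.range ε) :=
  (r σ).restrict (LinearMap.apply_mem_range_of_commute h.commute_frobenius)

/-- The action of the generator of inertia on the image of the projector. -/
noncomputable def unip : Module.End F (LinearMap.range ε) :=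
  (r τ).restrict (LinearMap.apply_mem_range_of_commute h.commute)

theorem coe_frob (x : LinearMap.range ε) : (h.frob x : V) = r σ x := rfl

theorem coe_unip (x : LinearMap.range ε) : (h.unip x : V) = r τ x := rfl

theorem coe_unip_pow (k : ℕ) (x : LinearMap.range ε) : ((h.unip ^ k) x : V) = (r τ ^ k) x := by
  rw [unip, Module.End.pow_restrict k]; rfl

theorem unip_mul_frob : h.unip * h.frob = h.frob * h.unip ^ ℓ := by
  apply LinearMap.ext
  rintro ⟨_, y, rfl⟩
  apply Subtype.ext
  rw [Module.End.mul_apply, Module.End.mul_apply, coe_unip, coe_frob, coe_frob, coe_unip_pow]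
  have h1 := congrArg (fun f : Module.End F V => r σ (f y)) h.conj
  simp only [Module.End.mul_apply] at h1
  have h2 : r σ * r (σ⁻¹ * τ * σ) = r τ * r σ := by
    rw [← map_mul, ← map_mul]
    congr 1
    group
  rw [← h1]
  exact (congrArg (fun f : Module.End F V => f (ε y)) h2).symm

theorem frob_mem_ker :
    ∀ x ∈ LinearMap.ker (h.unip - 1), h.frob x ∈ LinearMap.ker (h.unip - 1) := by
  intro x hx
  rw [LinearMap.mem_ker, LinearMap.sub_apply, sub_eq_zero, Module.End.one_apply] at hx ⊢
  rw [← Module.End.mul_apply, h.unip_mul_frob, Module.End.mul_apply]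
  congr 1
  have hk (k : ℕ) : (h.unip ^ k) x = x := by
    induction k with
    | zero => simp
    | succ k ih => rw [pow_succ, Module.End.mul_apply, hx, ih]
  exact hk ℓ

theorem isNilpotent : IsNilpotent (h.unip - 1) := by
  obtain ⟨N, hN⟩ := h.exists_pow
  refine ⟨N, ?_⟩
  apply LinearMap.ext
  rintro ⟨_, y, rfl⟩
  apply Subtype.ext
  have h1 : ∀ k, ∀ x : LinearMap.range ε, (((h.unip - 1 : Module.End F (LinearMap.range ε)) ^ k) x : V) =
      ((r τ - 1 : Module.End F V) ^ k) x := by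
    intro k
    induction k with
    | zero => simp
    | succ k ih =>
      intro x
      rw [pow_succ, Module.End.mul_apply, ih, pow_succ, Module.End.mul_apply]
      rfl
  rw [h1]
  exact congrArg (fun f : Module.End F V => f y) hN

/-- An element of `ℤ[I_ℓ]` acts on a vector fixed by inertia through its augmentation, so `ε` acts
on it as `m`, and the vector is in the range of `ε`. Conversely, on this range each `r γ - 1`
factors through `r τ - 1`. -/
theorem mem_invariants_iff [CharZero F] (x : V) :
    x ∈ Representation.invariants (r.comp (inertiaGroup ℓ).subtype) ↔
      ∃ y : LinearMap.range ε, y ∈ LinearMap.ker (h.unip - 1) ∧ (y : V) = x := by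
  have hm : (m : F) ≠ 0 := Nat.cast_ne_zero.2 h.ne_zero
  constructor
  · intro hx
    have hx' (γ : inertiaGroup ℓ) : r γ x = x := hx γ
    have h1 : ∀ a ∈ augmentedInertia (E := Module.End F V) r, a.1 x = (a.2 : F) • x := by
      intro a ha
      induction ha using Algebra.adjoin_induction with
      | mem a ha =>
        obtain ⟨γ, rfl⟩ := ha
        simpa using hx' γ
      | algebraMap n => simp [Int.cast_smul_eq_zsmul]
      | add a b _ _ ha hb => simp [ha, hb, add_smul]
      | mul a b _ _ ha hb => simp [ha, hb, smul_smul, mul_comm]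
    have h2 := h1 _ h.mem
    simp only [Int.cast_natCast] at h2
    refine ⟨⟨x, (m : F)⁻¹ • x, ?_⟩, ?_, rfl⟩
    · rw [map_smul, h2, smul_smul, inv_mul_cancel₀ hm, one_smul]
    · rw [LinearMap.mem_ker, LinearMap.sub_apply, sub_eq_zero]
      exact Subtype.ext (hx' τ)
  · rintro ⟨⟨_, y, rfl⟩, hy, rfl⟩ γ
    rw [LinearMap.mem_ker, LinearMap.sub_apply, sub_eq_zero] at hy
    have hy' : (r τ) (ε y) = ε y := congrArg Subtype.val hy
    obtain ⟨x, hx⟩ := h.inertia γ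
    have h1 := congrArg (fun f : Module.End F V => f y) hx
    simp only [Module.End.mul_apply, LinearMap.sub_apply, Module.End.one_apply, hy', sub_self,
      map_zero] at h1
    exact sub_eq_zero.1 h1

section

variable [IsAlgClosed F] [CharZero F] [Module.Finite F V]

theorem charpoly_inertiaDeterminant :
    (inertiaDeterminant r).charpoly (σ : LocalGaloisGroup ℓ ⧸ inertiaGroup ℓ) =
      ((h.frob.restrict h.frob_mem_ker).charpoly.roots.map
        fun β => 1 - Polynomial.C β * Polynomial.X).prod := by
  let g : LinearMap.ker (h.unip - 1) →ₗ[F]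
      Representation.invariants (r.comp (inertiaGroup ℓ).subtype) :=
    { toFun := fun x => ⟨x.1.1, (h.mem_invariants_iff _).2 ⟨x.1, x.2, rfl⟩⟩
      map_add' := fun _ _ => rfl
      map_smul' := fun _ _ => rfl }
  let e : LinearMap.ker (h.unip - 1) ≃ₗ[F]
      Representation.invariants (r.comp (inertiaGroup ℓ).subtype) :=
    LinearEquiv.ofBijective g
      ⟨fun x y hxy => by
        have h1 : ((g x : Representation.invariants (r.comp (inertiaGroup ℓ).subtype)) : V) =
          g y := by rw [hxy]
        exact Subtype.ext (Subtype.ext h1), fun x => by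
        obtain ⟨y, hy, hyx⟩ := (h.mem_invariants_iff _).1 x.2
        exact ⟨⟨y, hy⟩, Subtype.ext hyx⟩⟩
  have h1 : e.conj (h.frob.restrict h.frob_mem_ker) =
      (r.quotientToInvariants (inertiaGroup ℓ)) (σ : LocalGaloisGroup ℓ ⧸ inertiaGroup ℓ) := by
    apply LinearMap.ext
    intro x
    obtain ⟨x, rfl⟩ := e.surjective x
    rw [LinearEquiv.conj_apply_apply, LinearEquiv.symm_apply_apply]
    rfl
  rw [inertiaDeterminant, Determinant.charpoly_ofRepresentation, ← h1, LinearEquiv.charpoly_conj]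

/-- `r σ * ε` kills `ker ε` and induces `m` times Frobenius on the quotient, identified with the
range of `ε`. -/
theorem charpoly_frob_mul : (r σ * ε).charpoly =
    Polynomial.X ^ (Module.finrank F (LinearMap.ker ε)) *
      (h.frob.charpoly.roots.map fun β => Polynomial.X - Polynomial.C ((m : F) * β)).prod := by
  have hm : (m : F) ≠ 0 := Nat.cast_ne_zero.2 h.ne_zero
  have hz : ∀ x ∈ LinearMap.ker ε.rangeRestrict, (r σ * ε) x = 0 := by
    intro x hx
    have : ε x = 0 := congrArg Subtype.val hx
    rw [Module.End.mul_apply, this, map_zero]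
  have hker : ∀ x ∈ LinearMap.ker ε.rangeRestrict, (r σ * ε) x ∈ LinearMap.ker ε.rangeRestrict := by
    intro x hx
    rw [hz x hx]; exact zero_mem _
  rw [LinearMap.charpoly_eq_mul_of_surjective ε.rangeRestrict (LinearMap.surjective_rangeRestrict _)
    (r σ * ε) ((m : F) • h.frob) (fun x => ?_) hker]
  · congr 1
    · have h0 : (r σ * ε).restrict hker = 0 := by
        apply LinearMap.ext
        intro x
        exact Subtype.ext (hz x x.2)
      rw [h0, LinearMap.charpoly_zero, LinearMap.ker_rangeRestrict]
    · rw [LinearMap.charpoly_eq_prod_roots, LinearMap.roots_charpoly_smul _ hm, Multiset.map_map]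
      rfl
  · apply Subtype.ext
    have h1 := congrArg (fun f : Module.End F V => f (ε x)) h.commute_frobenius.eq
    simp only [Module.End.mul_apply] at h1
    have h2 := h.apply_of_mem_range (x := ε x) ⟨x, rfl⟩
    change ε (r σ (ε x)) = (m : F) • (r σ (ε x))
    rw [h1, h2, map_smul]

-- This expresses the dimension of the invariants through ranks of elements of the group algebra,
-- which are controlled under specialization.
omit [IsAlgClosed F] [CharZero F] in
theorem finrank_range_add_finrank_ker :
    Module.finrank F (LinearMap.range ((r τ - 1) * ε)) +
      Module.finrank F (LinearMap.ker (h.unip - 1)) = Module.finrank F (LinearMap.range ε) := by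
  have h0 := LinearMap.finrank_range_add_finrank_ker (h.unip - 1)
  have h1 : LinearMap.range ((r τ - 1) * ε) =
      (LinearMap.range (h.unip - 1)).map (LinearMap.range ε).subtype := by
    ext x
    constructor
    · rintro ⟨y, rfl⟩
      exact ⟨(h.unip - 1 : Module.End F (LinearMap.range ε)) ⟨ε y, y, rfl⟩, ⟨_, rfl⟩, rfl⟩
    · rintro ⟨_, ⟨⟨_, y, rfl⟩, rfl⟩, rfl⟩
      exact ⟨y, rfl⟩
  have h2 := Submodule.finrank_map_subtype_eq (LinearMap.range ε) (LinearMap.range (h.unip - 1))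
  rw [← h1] at h2
  rw [h2]
  exact h0

omit [IsAlgClosed F] [Module.Finite F V] in
theorem exists_isLogarithm_unip : ∃ N : Module.End F (LinearMap.range ε),
    Module.End.IsLogarithm h.unip N ∧ LinearMap.ker (h.unip - 1) = LinearMap.ker N ∧
      N * h.frob = (ℓ : F) • (h.frob * N) := by
  obtain ⟨N, y, hlog, hy, hNy⟩ := Module.End.exists_isLogarithm h.isNilpotent
  refine ⟨N, hlog, ?_, ?_⟩
  · ext x
    obtain ⟨y, rfl⟩ := hy
    rw [hNy, LinearMap.mem_ker, LinearMap.mem_ker, Module.End.mul_apply]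
    constructor
    · intro hx; rw [hx, map_zero]
    · intro hx
      have := congrArg (↑y⁻¹ : Module.End F (LinearMap.range ε)) hx
      rwa [← Module.End.mul_apply, Units.inv_mul, map_zero] at this
  · refine hlog.intertwine hlog (a := h.frob) (b := h.frob) (c := ℓ) fun k => ?_
    change h.unip ^ k * h.frob = h.frob * h.unip ^ (ℓ * k)
    induction k with
    | zero => simp
    | succ k ih =>
      rw [pow_succ, mul_assoc, h.unip_mul_frob, ← mul_assoc, ih, mul_assoc, ← pow_add, mul_add_one]

open Classical in
/-- If the invariants are as small as the eigenvalues of Frobenius allow, then these eigenvalues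
determine the eigenvalues of Frobenius on the invariants. -/
theorem roots_charpoly_ker_add (S : Set F)
    (hdim : Module.finrank F (LinearMap.ker (h.unip - 1)) +
      Multiset.card (h.frob.charpoly.roots.filter ((ℓ : F) * · ∈ S)) ≤
      Multiset.card (h.frob.charpoly.roots.filter (· ∈ S))) :
    (h.frob.restrict h.frob_mem_ker).charpoly.roots +
      (h.frob.charpoly.roots.filter ((ℓ : F) * · ∈ S)).map ((ℓ : F) * ·) =
      h.frob.charpoly.roots.filter (· ∈ S) := by
  obtain ⟨N, -, hker, hN⟩ := h.exists_isLogarithm_unip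
  exact Module.End.roots_charpoly_ker_add
    (Nat.cast_ne_zero.2 (Fact.out : ℓ.Prime).ne_zero) hN S hker _ hdim

end

omit h in
open Classical in
/-- For a pure representation, the invariants are as small as the eigenvalues of Frobenius allow. -/
theorem exists_finrank_ker_add {p : ℕ} [Fact p.Prime] (hℓp : ℓ ≠ p)
    (hinj : Function.Injective (algebraMap ℤ_[p] (PadicAlgCl p))) {V : Type w}
    [AddCommGroup V] [Module (PadicAlgCl p) V] [Module.Finite (PadicAlgCl p) V]
    {r : Representation (PadicAlgCl p) (LocalGaloisGroup ℓ) V} {ε : Module.End (PadicAlgCl p) V}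
    (h : IsUnipotentProjector r σ τ ε m) (hσ : IsGeometricFrobenius σ)
    {t : inertiaGroup ℓ → ℤ_[p]} (s : TameSystem t) (hτ : t τ ≠ 0)
    {N : Module.End (PadicAlgCl p) V} (hN : IsMonodromyOperator r t N)
    {M : ℤ → Submodule (PadicAlgCl p) V} (hM : IsMonodromyFiltration N M) {w : ℤ}
    (hw : ∀ (j : ℤ) (α : PadicAlgCl p),
      (∃ x ∈ M j, x ∉ M (j - 1) ∧ r σ x - α • x ∈ M (j - 1)) → IsWeilNumber ℓ (w + j) α) :
    ∃ S : Set (PadicAlgCl p), Module.finrank (PadicAlgCl p) (LinearMap.ker (h.unip - 1)) +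
      Multiset.card (h.frob.charpoly.roots.filter ((ℓ : PadicAlgCl p) * · ∈ S)) =
      Multiset.card (h.frob.charpoly.roots.filter (· ∈ S)) := by
  have hm : (m : PadicAlgCl p) ≠ 0 := Nat.cast_ne_zero.2 h.ne_zero
  -- `ε` belongs to the ring generated by inertia, which commutes with `N`.
  have hcomm : Commute N ε := by
    have h1 : ∀ a ∈ augmentedInertia (E := Module.End (PadicAlgCl p) V) r, Commute N a.1 := by
      intro a ha
      induction ha using Algebra.adjoin_induction with
      | mem a ha =>
        obtain ⟨γ, rfl⟩ := ha
        exact hN.commute_inertia s hℓp hinj hσ γ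
      | algebraMap n => simp
      | add a b _ _ ha hb => exact ha.add_right hb
      | mul a b _ _ ha hb => exact ha.mul_right hb
    exact h1 _ h.mem
  have hNW := LinearMap.apply_mem_range_of_commute hcomm.symm
  have hM' := hM.restrict (W := LinearMap.range ε) (π := (m : PadicAlgCl p)⁻¹ • ε)
    (fun x => Submodule.smul_mem _ _ ⟨x, rfl⟩) (fun x hx => by
      rw [LinearMap.smul_apply, h.apply_of_mem_range hx, smul_smul, inv_mul_cancel₀ hm, one_smul])
    (hcomm.smul_right _) hNW
  refine ⟨{α | ∃ j ≤ 0, IsWeilNumber ℓ (w + j) α}, ?_⟩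
  -- Comparing the logarithms of the `k`-th power of `τ` on the range of `ε` and on `V` shows that
  -- the logarithm of `unip` is `t(τ) N` there, with `t(τ) ≠ 0`.
  have hker : LinearMap.ker (h.unip - 1) = LinearMap.ker (N.restrict hNW) := by
    obtain ⟨N₁, hlog, hker, -⟩ := h.exists_isLogarithm_unip
    obtain ⟨k, hk, hlog'⟩ := hN.exists_isLogarithm s hℓp
    have hk' : (k : PadicAlgCl p) ≠ 0 := Nat.cast_ne_zero.2 hk
    have h2 := hlog.intertwine (hlog' τ) (a := (LinearMap.range ε).subtype)
      (b := (LinearMap.range ε).subtype) (c := k) (fun j => by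
        apply LinearMap.ext
        intro x
        rw [LinearMap.comp_apply, LinearMap.comp_apply, ← pow_mul]
        exact (h.coe_unip_pow _ x).symm)
    rw [hker]
    ext x
    have h3 := congrArg (fun f : _ →ₗ[PadicAlgCl p] V => f x) h2
    simp only [LinearMap.comp_apply, LinearMap.smul_apply, Submodule.subtype_apply, mul_smul] at h3
    have h4 := smul_right_injective V hk' h3
    rw [LinearMap.mem_ker, LinearMap.mem_ker, ← Submodule.coe_eq_zero, ← h4, smul_eq_zero,
      or_iff_right ((map_ne_zero_iff _ hinj).2 hτ)]
    exact Submodule.coe_eq_zero (x := N.restrict hNW x)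
  rw [hker]
  refine hM'.finrank_ker_add (Fact.out : ℓ.Prime).one_lt ?_ ?_
  · apply LinearMap.ext
    intro x
    apply Subtype.ext
    exact congrArg (fun f : Module.End (PadicAlgCl p) V => f x) (hN.mul_frobenius s hℓp hinj hσ)
  · rintro j α ⟨x, hx, hx', hsx⟩
    exact hw j α ⟨x, hx, hx', hsx⟩

end IsUnipotentProjector

/-! ### Comparison of Frobenius eigenvalues at different points of the family -/

theorem Multiset.exists_map_eq {α β : Type*} {f : α → β} {s : Multiset β}
    (h : ∀ b ∈ s, ∃ a, f a = b) : ∃ s' : Multiset α, s'.map f = s := by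
  induction s using Multiset.induction with
  | empty => exact ⟨0, rfl⟩
  | cons b s ih =>
    obtain ⟨a, rfl⟩ := h b (Multiset.mem_cons_self b s)
    obtain ⟨s', rfl⟩ := ih fun b hb => h b (Multiset.mem_cons_of_mem hb)
    exact ⟨a ::ₘ s', Multiset.map_cons f a s'⟩

theorem Polynomial.map_X_pow_mul_prod {A B : Type*} [CommRing A] [CommRing B] (f : A →+* B)
    (d m : ℕ) (s : Multiset A) :
    (Polynomial.X ^ d * (s.map fun α => Polynomial.X - Polynomial.C ((m : A) * α)).prod).map f =
      Polynomial.X ^ d *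
        ((s.map f).map fun β => Polynomial.X - Polynomial.C ((m : B) * β)).prod := by
  simp [Polynomial.map_multiset_prod, Multiset.map_map]

/-- A point of the family, with values in the field `F`, where the element `x` of the group algebra
acts as a unipotent projector. -/
structure FrobeniusPoint {R : Type u} [CommRing R] {G : Type v} [Group G] {n : ℕ}
    (D : Determinant R G n) {ℓ : ℕ} [Fact ℓ.Prime] (res : LocalGaloisGroup ℓ →* G)
    (σ : LocalGaloisGroup ℓ) (τ : inertiaGroup ℓ) (x : R[G]) (m : ℕ)
    {A : Type*} [CommRing A] (a : R →+* A) {F : Type w} [Field F] (h : A →+* F)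
    {V : Type*} [AddCommGroup V] [Module F V] [Module.Finite F V]
    (ρ : Representation F G V) : Prop where
  attached : D.IsAttachedAlong (h.comp a) ρ
  projector : IsUnipotentProjector (MonoidHom.comp ρ res) σ τ (Determinant.act (h.comp a) ρ x) m

namespace FrobeniusPoint

variable {R : Type u} [CommRing R] {G : Type v} [Group G] {n : ℕ}
  {D : Determinant R G n} {ℓ : ℕ} [Fact ℓ.Prime] {res : LocalGaloisGroup ℓ →* G}
  {σ : LocalGaloisGroup ℓ} {τ : inertiaGroup ℓ} {x : R[G]} {m : ℕ}
  {A : Type*} [CommRing A] {a : R →+* A}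

section

variable {F : Type w} [Field F] {h : A →+* F}
  {V : Type*} [AddCommGroup V] [Module F V] [Module.Finite F V] {ρ : Representation F G V}
  (P : FrobeniusPoint D res σ τ x m a h ρ)

include P

/-- The eigenvalues of Frobenius on the unipotent part. -/
noncomputable def eigenvalues : Multiset F := P.projector.frob.charpoly.roots

/-- The eigenvalues of Frobenius on the invariants of inertia. -/
noncomputable def invariantEigenvalues : Multiset F :=
  (P.projector.frob.restrict P.projector.frob_mem_ker).charpoly.roots

variable [CharZero F]

/-- `m - x` acts as a multiple of the complementary projector. This makes the corank of `x` a rank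
as well, so that it too cannot increase. -/
theorem finrank_range_natCast_sub :
    Module.finrank F (Determinant.act (h.comp a) ρ (m - x)).range =
      Module.finrank F (LinearMap.ker (Determinant.act (h.comp a) ρ x)) := by
  have hm : (m : F) ≠ 0 := Nat.cast_ne_zero.2 P.projector.ne_zero
  rw [map_sub, map_natCast]
  suffices hr : LinearMap.range ((m : Module.End F V) - Determinant.act (h.comp a) ρ x) =
      LinearMap.ker (Determinant.act (h.comp a) ρ x) by rw [hr]
  ext y
  constructor
  · rintro ⟨y, rfl⟩
    rw [LinearMap.mem_ker, ← Module.End.mul_apply, mul_sub, P.projector.mul_self,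
      (Nat.cast_commute _ _).eq, sub_self, LinearMap.zero_apply]
  · intro hy
    refine ⟨(m : F)⁻¹ • y, ?_⟩
    rw [map_smul, LinearMap.sub_apply, LinearMap.mem_ker.1 hy, sub_zero, Module.End.natCast_apply,
      ← Nat.cast_smul_eq_nsmul F, smul_smul, inv_mul_cancel₀ hm, one_smul]

variable [IsAlgClosed F]

omit [CharZero F] [IsAlgClosed F] in
theorem finrank_range_monodromy :
    Module.finrank F (Determinant.act (h.comp a) ρ
      ((MonoidAlgebra.single (res τ) 1 - 1) * x)).range +
      Module.finrank F (LinearMap.ker (P.projector.unip - 1)) =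
      Module.finrank F (Determinant.act (h.comp a) ρ x).range := by
  have := P.projector.finrank_range_add_finrank_ker
  rw [map_mul, map_sub, map_one, Determinant.act_single, map_one, one_smul]
  exact this

theorem map_algebraCharpoly :
    (D.algebraCharpoly (MonoidAlgebra.single (res σ) 1 * x)).map (h.comp a) =
      Polynomial.X ^ (Module.finrank F (LinearMap.ker (Determinant.act (h.comp a) ρ x))) *
      (P.eigenvalues.map fun β => Polynomial.X - Polynomial.C ((m : F) * β)).prod := by
  rw [← P.attached.charpoly_act, map_mul, Determinant.act_single, map_one, one_smul]
  exact P.projector.charpoly_frob_mul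

omit [CharZero F] [IsAlgClosed F] in
theorem isRoot_of_mem_eigenvalues {β : F} (hβ : β ∈ P.eigenvalues) :
    ((D.algebraCharpoly (MonoidAlgebra.single (res σ) 1)).map (h.comp a)).IsRoot β := by
  rw [← P.attached.charpoly_act, Determinant.act_single, map_one, one_smul,
    ← Module.End.hasEigenvalue_iff_isRoot_charpoly]
  rw [eigenvalues, Polynomial.mem_roots (LinearMap.charpoly_monic _).ne_zero,
    ← Module.End.hasEigenvalue_iff_isRoot_charpoly] at hβ
  obtain ⟨v, hv⟩ := hβ.exists_hasEigenvector
  exact Module.End.hasEigenvalue_of_hasEigenvector (x := (v : V)) (Module.End.hasEigenvector_iff.2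
    ⟨Module.End.mem_eigenspace_iff.2 (congrArg Subtype.val hv.apply_eq_smul),
      fun h0 => hv.2 (Subtype.ext h0)⟩)

omit [CharZero F] [IsAlgClosed F] in
theorem exists_eigenvalues (hint : ∀ β, ((D.algebraCharpoly (MonoidAlgebra.single (res σ) 1)).map
    (h.comp a)).IsRoot β → ∃ α : A, h α = β) : ∃ s : Multiset A, s.map h = P.eigenvalues :=
  Multiset.exists_map_eq fun β hβ => hint β (P.isRoot_of_mem_eigenvalues hβ)

end

section

variable {F : Type w} [Field F] [CharZero F] [IsAlgClosed F] {h : A →+* F}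
  {V : Type*} [AddCommGroup V] [Module F V] [Module.Finite F V] {ρ : Representation F G V}
  (P : FrobeniusPoint D res σ τ x m a h ρ)
  {F' : Type*} [Field F'] [CharZero F'] [IsAlgClosed F'] {h' : A →+* F'}
  {V' : Type*} [AddCommGroup V'] [Module F' V'] [Module.Finite F' V'] {ρ' : Representation F' G V'}
  (P' : FrobeniusPoint D res σ τ x m a h' ρ')

include P P'

-- The ranks of `x` and of `m - x` do not increase, and their sum is the dimension of the
-- representation; so both are constant.
omit [IsAlgClosed F] [IsAlgClosed F'] in
theorem finrank_range_eq (hh' : RingHom.ker (h.comp a) ≤ RingHom.ker (h'.comp a))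
    (hV : Module.finrank F V = Module.finrank F' V') :
    Module.finrank F (Determinant.act (h.comp a) ρ x).range =
      Module.finrank F' (Determinant.act (h'.comp a) ρ' x).range := by
  have h1 := Determinant.finrank_range_act_le P.attached P'.attached hh' x
  have h2 := Determinant.finrank_range_act_le P.attached P'.attached hh' (m - x)
  rw [P.finrank_range_natCast_sub, P'.finrank_range_natCast_sub] at h2
  have h3 := LinearMap.finrank_range_add_finrank_ker (Determinant.act (h.comp a) ρ x)
  have h4 := LinearMap.finrank_range_add_finrank_ker (Determinant.act (h'.comp a) ρ' x)
  lia

-- The rank of `(τ - 1) x` does not increase while that of `x` is constant, so the invariants can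
-- only grow.
omit [IsAlgClosed F] [IsAlgClosed F'] in
theorem finrank_ker_le (hh' : RingHom.ker (h.comp a) ≤ RingHom.ker (h'.comp a))
    (hV : Module.finrank F V = Module.finrank F' V') :
    Module.finrank F (LinearMap.ker (P.projector.unip - 1)) ≤
      Module.finrank F' (LinearMap.ker (P'.projector.unip - 1)) := by
  have h1 := Determinant.finrank_range_act_le P.attached P'.attached hh'
    ((MonoidAlgebra.single (res τ) 1 - 1) * x)
  have h2 := P.finrank_range_eq P' hh' hV
  have h3 := P.finrank_range_monodromy
  have h4 := P'.finrank_range_monodromy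
  lia

/-- The characteristic polynomial of `σ x` has coefficients in `R`. At both points it is the product
of the same power of `X` and of the factors `X - m β`, with `β` running over the eigenvalues. -/
theorem eigenvalues_eq_map (hinj : Function.Injective h)
    (hV : Module.finrank F V = Module.finrank F' V') {s : Multiset A}
    (hs : s.map h = P.eigenvalues) : s.map h' = P'.eigenvalues := by
  have hh' : RingHom.ker (h.comp a) ≤ RingHom.ker (h'.comp a) := by
    intro y hy
    have : a y = 0 := hinj (by rw [map_zero]; exact hy)
    rw [RingHom.mem_ker, RingHom.comp_apply, this, map_zero]
  have hm : (m : F') ≠ 0 := Nat.cast_ne_zero.2 P.projector.ne_zero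
  have h2 := P.finrank_range_eq P' hh' hV
  have h3 := LinearMap.finrank_range_add_finrank_ker (Determinant.act (h.comp a) ρ x)
  have h4 := LinearMap.finrank_range_add_finrank_ker (Determinant.act (h'.comp a) ρ' x)
  have hd : Module.finrank F (LinearMap.ker (Determinant.act (h.comp a) ρ x)) =
    Module.finrank F' (LinearMap.ker (Determinant.act (h'.comp a) ρ' x)) := by lia
  set d := Module.finrank F (LinearMap.ker (Determinant.act (h.comp a) ρ x))
  let Q : A[X] := Polynomial.X ^ d *
    (s.map fun α => Polynomial.X - Polynomial.C ((m : A) * α)).prod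
  have hQA : (D.algebraCharpoly (MonoidAlgebra.single (res σ) 1 * x)).map a = Q := by
    apply Polynomial.map_injective h hinj
    rw [Polynomial.map_map, P.map_algebraCharpoly, Polynomial.map_X_pow_mul_prod, hs]
  have h5 := P'.map_algebraCharpoly
  rw [← Polynomial.map_map, hQA, ← hd] at h5
  rw [Polynomial.map_X_pow_mul_prod] at h5
  have h6 := mul_left_cancel₀ (pow_ne_zero d Polynomial.X_ne_zero) h5
  have h7 (s : Multiset F') : (s.map fun β => Polynomial.X - Polynomial.C ((m : F') * β)).prod =
      ((s.map ((m : F') * ·)).map fun β => Polynomial.X - Polynomial.C β).prod := by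
    rw [Multiset.map_map]; rfl
  rw [h7, h7] at h6
  have h8 := congrArg Polynomial.roots h6
  rw [Polynomial.roots_multiset_prod_X_sub_C, Polynomial.roots_multiset_prod_X_sub_C] at h8
  exact Multiset.map_injective (mul_right_injective₀ hm) h8

open Classical in
omit [IsAlgClosed F'] in
/-- The eigenvalues of Frobenius on the invariants, from purity at a second point. -/
theorem invariantEigenvalues_add (hker : RingHom.ker h ≤ RingHom.ker h')
    (hV : Module.finrank F V = Module.finrank F' V') {s : Multiset A}
    (hs : s.map h = P.eigenvalues) (hs' : s.map h' = P'.eigenvalues) (S : Set F')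
    (hS : Module.finrank F' (LinearMap.ker (P'.projector.unip - 1)) +
      Multiset.card (P'.eigenvalues.filter ((ℓ : F') * · ∈ S)) =
      Multiset.card (P'.eigenvalues.filter (· ∈ S))) :
    P.invariantEigenvalues + ((s.filter fun α => h' (ℓ * α) ∈ S).map ((ℓ : A) * ·)).map h =
      (s.filter fun α => h' α ∈ S).map h := by
  -- The set `S` transported from the second point to the first through `A`; membership of `h α`
  -- depends only on `h' α` because `ker h ≤ ker h'`.
  let SF : Set F := {β | ∃ α : A, h α = β ∧ h' α ∈ S}
  have hSF (α : A) : h α ∈ SF ↔ h' α ∈ S := by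
    constructor
    · rintro ⟨α', hα, hα'⟩
      have : α - α' ∈ RingHom.ker h' := hker (by rw [RingHom.mem_ker, map_sub, hα, sub_self])
      rw [RingHom.mem_ker, map_sub, sub_eq_zero] at this
      rwa [this]
    · exact fun hα => ⟨α, rfl, hα⟩
  have e1 : P.eigenvalues.filter (· ∈ SF) = (s.filter fun α => h' α ∈ S).map h := by
    rw [← hs, Multiset.filter_map]
    congr 1
    exact Multiset.filter_congr fun α _ => hSF α
  have e2 : P.eigenvalues.filter ((ℓ : F) * · ∈ SF) =
      (s.filter fun α => h' (ℓ * α) ∈ S).map h := by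
    rw [← hs, Multiset.filter_map]
    congr 1
    refine Multiset.filter_congr fun α _ => ?_
    rw [← hSF, map_mul, map_natCast]; rfl
  have e1' : P'.eigenvalues.filter (· ∈ S) = (s.filter fun α => h' α ∈ S).map h' := by
    rw [← hs', Multiset.filter_map]
    rfl
  have e2' : P'.eigenvalues.filter ((ℓ : F') * · ∈ S) =
      (s.filter fun α => h' (ℓ * α) ∈ S).map h' := by
    rw [← hs', Multiset.filter_map]
    congr 1
    refine Multiset.filter_congr fun α _ => ?_
    rw [map_mul, map_natCast]; rfl
  -- The kernel at the first point is at most the kernel at the second, whose dimension is given by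
  -- `hS`; the selected multisets have the same cardinals at both points.
  have hle := P.finrank_ker_le P' (fun y hy => hker hy) hV
  have := P.projector.roots_charpoly_ker_add SF (by
    change _ + Multiset.card (P.eigenvalues.filter ((ℓ : F) * · ∈ SF)) ≤
      Multiset.card (P.eigenvalues.filter (· ∈ SF))
    rw [e1, e2, Multiset.card_map, Multiset.card_map]
    rw [e1', e2', Multiset.card_map, Multiset.card_map] at hS
    lia)
  change P.invariantEigenvalues + (P.eigenvalues.filter ((ℓ : F) * · ∈ SF)).map ((ℓ : F) * ·) =
    P.eigenvalues.filter (· ∈ SF) at this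
  rw [e1, e2] at this
  rw [← this]
  congr 1
  rw [Multiset.map_map, Multiset.map_map]
  exact Multiset.map_congr rfl fun α _ => by simp

end

section

variable {F : Type w} [Field F] [CharZero F] [IsAlgClosed F] {h : A →+* F}
  {V : Type*} [AddCommGroup V] [Module F V] [Module.Finite F V] {ρ : Representation F G V}
  (P : FrobeniusPoint D res σ τ x m a h ρ)
  {F' : Type*} [Field F'] [CharZero F'] [IsAlgClosed F'] {h' : A →+* F'}
  {V' : Type*} [AddCommGroup V'] [Module F' V'] [Module.Finite F' V'] {ρ' : Representation F' G V'}
  (P' : FrobeniusPoint D res σ τ x m a h' ρ')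
  {L : Type*} [Field L] [CharZero L] [IsAlgClosed L] {hL : A →+* L}
  {VL : Type*} [AddCommGroup VL] [Module L VL] [Module.Finite L VL] {ρL : Representation L G VL}
  (PL : FrobeniusPoint D res σ τ x m a hL ρL)

include P P'

open Classical in
/-- The eigenvalues of Frobenius on the invariants of inertia at the generic point specialize well
to all the points that lie between the generic point and a pure point. -/
theorem exists_invariantEigenvalues (hinj : Function.Injective h)
    (hV : Module.finrank F V = Module.finrank F' V')
    (hint : ∀ β, ((D.algebraCharpoly (MonoidAlgebra.single (res σ) 1)).map
      (h.comp a)).IsRoot β → ∃ α : A, h α = β) (S : Set F')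
    (hS : Module.finrank F' (LinearMap.ker (P'.projector.unip - 1)) +
      Multiset.card (P'.eigenvalues.filter ((ℓ : F') * · ∈ S)) =
      Multiset.card (P'.eigenvalues.filter (· ∈ S))) :
    ∃ b : Multiset A, b.map h = P.invariantEigenvalues := by
  obtain ⟨s, hs⟩ := P.exists_eigenvalues hint
  have h1 := P.invariantEigenvalues_add P'
    (by rw [(RingHom.injective_iff_ker_eq_bot h).1 hinj]; exact bot_le) hV hs
    (P.eigenvalues_eq_map P' hinj hV hs) S hS
  refine Multiset.exists_map_eq fun β hβ => ?_
  have h2 : β ∈ (s.filter fun α => h' α ∈ S).map h := by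
    rw [← h1]; exact Multiset.mem_add.2 (Or.inl hβ)
  obtain ⟨α, -, hα⟩ := Multiset.mem_map.1 h2
  exact ⟨α, hα⟩

-- The multisets selected in `A` depend only on the pure point `h'`. So the same identity in `A`
-- computes the invariants at the generic point and at `hL`, and it can be cancelled in `A` because
-- `h` is injective.
open Classical in
theorem invariantEigenvalues_eq_map (hinj : Function.Injective h)
    (hV : Module.finrank F V = Module.finrank F' V')
    (hVL : Module.finrank F V = Module.finrank L VL)
    (hint : ∀ β, ((D.algebraCharpoly (MonoidAlgebra.single (res σ) 1)).map
      (h.comp a)).IsRoot β → ∃ α : A, h α = β) (S : Set F')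
    (hS : Module.finrank F' (LinearMap.ker (P'.projector.unip - 1)) +
      Multiset.card (P'.eigenvalues.filter ((ℓ : F') * · ∈ S)) =
      Multiset.card (P'.eigenvalues.filter (· ∈ S)))
    (hker : RingHom.ker hL ≤ RingHom.ker h') {b : Multiset A}
    (hb : b.map h = P.invariantEigenvalues) : b.map hL = PL.invariantEigenvalues := by
  obtain ⟨s, hs⟩ := P.exists_eigenvalues hint
  have h1 := P.invariantEigenvalues_add P'
    (by rw [(RingHom.injective_iff_ker_eq_bot h).1 hinj]; exact bot_le) hV hs
    (P.eigenvalues_eq_map P' hinj hV hs) S hS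
  have h2 := PL.invariantEigenvalues_add P' hker (hVL.symm.trans hV)
    (P.eigenvalues_eq_map PL hinj hVL hs) (P.eigenvalues_eq_map P' hinj hV hs) S hS
  rw [← hb, ← Multiset.map_add] at h1
  have h3 := Multiset.map_injective hinj h1
  rw [← h3, Multiset.map_add] at h2
  exact (add_right_cancel h2).symm

end

end FrobeniusPoint

/-! ### Extension of morphisms to an integral closure, and descent -/

section Extension

variable {B A : Type*} [CommRing B] [CommRing A] [Algebra B A] [Algebra.IsIntegral B A]

/-- A morphism to an algebraically closed field extends to an integral extension, with prescribed
elements in the kernel. -/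
theorem Algebra.IsIntegral.exists_ringHom_extending {F : Type*} [Field F] [IsAlgClosed F]
    (g : B →+* F) (Q : Ideal A) [Q.IsPrime] (hQ : Q.comap (algebraMap B A) = RingHom.ker g) :
    ∃ g' : A →+* F, g'.comp (algebraMap B A) = g ∧ Q ≤ RingHom.ker g' := by
  have : (RingHom.ker g).IsPrime := RingHom.ker_isPrime g
  have : Q.LiesOver (RingHom.ker g) := ⟨hQ.symm⟩
  let : Algebra (B ⧸ RingHom.ker g) F := (RingHom.kerLift g).toAlgebra
  have hinj : Function.Injective (algebraMap (B ⧸ RingHom.ker g) F) := RingHom.kerLift_injective g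
  have : Module.IsTorsionFree (B ⧸ RingHom.ker g) F :=
    Module.isTorsionFree_iff_algebraMap_injective.2 hinj
  have : Module.IsTorsionFree (B ⧸ RingHom.ker g) (A ⧸ Q) :=
    Module.isTorsionFree_iff_faithfulSMul.2 inferInstance
  have : Algebra.IsAlgebraic (B ⧸ RingHom.ker g) (A ⧸ Q) := inferInstance
  let j : A ⧸ Q →ₐ[B ⧸ RingHom.ker g] F := IsAlgClosed.lift
  refine ⟨j.toRingHom.comp (Ideal.Quotient.mk Q), ?_, ?_⟩
  · ext b
    exact j.commutes (Ideal.Quotient.mk _ b)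
  · intro a ha
    rw [RingHom.mem_ker, RingHom.comp_apply, Ideal.Quotient.eq_zero_iff_mem.2 ha, map_zero]

/-- Lying over for `ker g`, then going up from `ker f` to a prime above `ker g'`, so that the
inclusion of the kernels is kept. -/
theorem Algebra.IsIntegral.exists_ringHom_pair [IsDomain A] {F F' : Type*} [Field F] [IsAlgClosed F]
    [Field F'] [IsAlgClosed F'] (hBA : Function.Injective (algebraMap B A))
    (g : B →+* F) (g' : B →+* F') (h : RingHom.ker g ≤ RingHom.ker g') :
    ∃ (f : A →+* F) (f' : A →+* F'), f.comp (algebraMap B A) = g ∧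
      f'.comp (algebraMap B A) = g' ∧ RingHom.ker f ≤ RingHom.ker f' := by
  have : (RingHom.ker g).IsPrime := RingHom.ker_isPrime g
  have : (RingHom.ker g').IsPrime := RingHom.ker_isPrime g'
  obtain ⟨Q, hQ, hQg⟩ := Ideal.exists_ideal_over_prime_of_isIntegral_of_isDomain (S := A)
    (RingHom.ker g) (by rw [(RingHom.injective_iff_ker_eq_bot _).1 hBA]; exact bot_le)
  obtain ⟨f, hf, -⟩ := exists_ringHom_extending g Q hQg
  have hfg : (RingHom.ker f).comap (algebraMap B A) = RingHom.ker g := by rw [← hf]; rfl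
  obtain ⟨Q', hQ'f, hQ', hQ'g⟩ := Ideal.exists_ideal_over_prime_of_isIntegral (RingHom.ker g')
    (RingHom.ker f) (hfg.trans_le h)
  obtain ⟨f', hf', hQf'⟩ := exists_ringHom_extending g' Q' hQ'g
  exact ⟨f, f', hf, hf', hQ'f.trans hQf'⟩

end Extension

section Descent

variable {B : Type*} [CommRing B] [IsDomain B] [IsIntegrallyClosed B]
  [CharZero (FractionRing B)]

/-- A polynomial with integral coefficients that are fixed by the Galois group has coefficients in
the integrally closed base ring. -/
theorem Polynomial.exists_map_eq_of_galois_invariant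
    (Q : (integralClosure B (GeometricField B))[X])
    (hQ : ∀ g : Gal(GeometricField B/FractionRing B),
      Q.map ((g : GeometricField B →+* GeometricField B).comp
        (algebraMap (integralClosure B (GeometricField B)) (GeometricField B))) =
      Q.map (algebraMap (integralClosure B (GeometricField B)) (GeometricField B))) :
    ∃ P : B[X], P.map (algebraMap B (integralClosure B (GeometricField B))) = Q := by
  refine (Polynomial.mem_lifts _).1 ((Polynomial.lifts_iff_coeff_lifts _).2 fun i => ?_)
  obtain ⟨y, hy⟩ := (InfiniteGalois.mem_range_algebraMap_iff_fixed (k := FractionRing B)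
    (Q.coeff i : GeometricField B)).2 fun g => by
      have := congrArg (fun q => Polynomial.coeff q i) (hQ g)
      simpa [Polynomial.coeff_map] using this
  have hint : IsIntegral B y := by
    rw [← isIntegral_algebraMap_iff (algebraMap (FractionRing B) (GeometricField B)).injective, hy]
    exact (Q.coeff i).2
  obtain ⟨z, rfl⟩ := IsIntegrallyClosed.isIntegral_iff.1 hint
  exact ⟨z, Subtype.ext (by rw [← hy]; rfl)⟩

end Descent

instance (R : Type*) [CommRing R] [IsDomain R] : IsIntegrallyClosed (Normalization R) :=
  integralClosure.isIntegrallyClosedOfFiniteExtension (FractionRing R)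

namespace FrobeniusPoint

variable {R : Type u} [CommRing R] {G : Type v} [Group G] {n : ℕ}
  {D : Determinant R G n} {ℓ : ℕ} [Fact ℓ.Prime] {res : LocalGaloisGroup ℓ →* G}
  {σ : LocalGaloisGroup ℓ} {τ : inertiaGroup ℓ} {x : R[G]} {m : ℕ}
  {A : Type*} [CommRing A] {a : R →+* A}
  {F : Type w} [Field F] [CharZero F] [IsAlgClosed F] {h : A →+* F}
  {V : Type*} [AddCommGroup V] [Module F V] [Module.Finite F V] {ρ : Representation F G V}

theorem map_prod_one_sub (P : FrobeniusPoint D res σ τ x m a h ρ) {b : Multiset A}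
    (hb : b.map h = P.invariantEigenvalues) :
    (b.map fun β => 1 - Polynomial.C β * Polynomial.X).prod.map h =
      (inertiaDeterminant (MonoidHom.comp ρ res)).charpoly
        (σ : LocalGaloisGroup ℓ ⧸ inertiaGroup ℓ) := by
  rw [P.projector.charpoly_inertiaDeterminant, Polynomial.map_multiset_prod, Multiset.map_map]
  change _ = (P.invariantEigenvalues.map _).prod
  rw [← hb, Multiset.map_map]
  congr 1
  exact Multiset.map_congr rfl fun β _ => by simp

-- A projector built once in the image algebra serves at all the specializations, since this algebra
-- acts there.
omit [CharZero F] [IsAlgClosed F] in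
theorem of_ker_le {f : R →+* F} (hρ : D.IsAttachedAlong f ρ)
    (hx : IsUnipotentProjector ((Determinant.toImageAlgebra f ρ).comp res) σ τ
      (Ideal.Quotient.mk _ x) m)
    {L : Type*} [Field L] {hL : A →+* L} {VL : Type*} [AddCommGroup VL] [Module L VL]
    [Module.Finite L VL] {ρL : Representation L G VL} (hρL : D.IsAttachedAlong (hL.comp a) ρL)
    (hker : RingHom.ker f ≤ RingHom.ker (hL.comp a)) :
    FrobeniusPoint D res σ τ x m a hL ρL where
  attached := hρL
  projector := hx.map (Determinant.imageAct (Determinant.ker_act_le hρ hρL hker)) fun _ =>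
    Determinant.imageAct_toImageAlgebra _ _

end FrobeniusPoint

theorem Polynomial.coeff_zero_prod_one_sub {A : Type*} [CommRing A] (b : Multiset A) :
    (b.map fun β => 1 - C β * X).prod.coeff 0 = 1 := by
  rw [coeff_zero_eq_eval_zero, eval_multiset_prod, Multiset.map_map]
  exact Multiset.prod_eq_one fun _ h => by
    obtain ⟨β, -, rfl⟩ := Multiset.mem_map.1 h
    simp

/-! ### Euler factors with coefficients in a normal domain -/

section EulerFactors

variable {ℓ : ℕ} [Fact ℓ.Prime] {K : Type*} [Field K] {V : Type*} [AddCommGroup V] [Module K V]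
  [Module.Finite K V]

theorem IsEulerFactor.isEulerFactor_eulerFactor {A : Type*} [CommRing A] [Algebra A K]
    {r : Representation K (LocalGaloisGroup ℓ) V} {σ : LocalGaloisGroup ℓ} {P : A[X]}
    (h : IsEulerFactor r σ P) : IsEulerFactor r σ (eulerFactor A r σ) := by
  have h' : ∃ P : A[X], IsEulerFactor r σ P := ⟨P, h⟩
  rw [eulerFactor, dif_pos h']
  exact h'.choose_spec

theorem IsEulerFactor.eulerFactor_eq {A : Type*} [CommRing A] [Algebra A K]
    (hA : Function.Injective (algebraMap A K)) {r : Representation K (LocalGaloisGroup ℓ) V} {σ : LocalGaloisGroup ℓ} {P : A[X]}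
    (h : IsEulerFactor r σ P) : eulerFactor A r σ = P :=
  Polynomial.map_injective _ hA
    (h.isEulerFactor_eulerFactor.trans h.symm)

end EulerFactors

theorem GeometricField.algebraMap_injective (B : Type*) [CommRing B] [IsDomain B] :
    Function.Injective (algebraMap B (GeometricField B)) := by
  rw [IsScalarTower.algebraMap_eq B (FractionRing B)]
  exact (algebraMap (FractionRing B) (GeometricField B)).injective.comp
    (IsFractionRing.injective B (FractionRing B))

theorem PadicAlgCl.algebraMap_padicInt_injective (p : ℕ) [Fact p.Prime] :
    Function.Injective (algebraMap ℤ_[p] (PadicAlgCl p)) := by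
  rw [IsScalarTower.algebraMap_eq ℤ_[p] ℚ_[p] (PadicAlgCl p)]
  exact (algebraMap ℚ_[p] (PadicAlgCl p)).injective.comp (FaithfulSMul.algebraMap_injective _ _)

/-- The roots in `F` of the characteristic polynomials of the determinant are integral. -/
theorem Determinant.IsAttachedAlong.isIntegral {R : Type u} [CommRing R] {G : Type v} [Group G]
    {n : ℕ} {D : Determinant R G n} {F : Type w} [Field F] {f : R →+* F}
    {V : Type*} [AddCommGroup V] [Module F V] [Module.Finite F V] {ρ : Representation F G V}
    (hρ : D.IsAttachedAlong f ρ) (hf : Function.Injective f) (x : R[G]) {β : F}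
    (hβ : ((D.algebraCharpoly x).map f).IsRoot β) : f.IsIntegralElem β := by
  refine ⟨D.algebraCharpoly x, ?_, by rwa [← Polynomial.eval_map]⟩
  refine Polynomial.monic_of_injective hf ?_
  rw [← hρ.charpoly_act]
  exact LinearMap.charpoly_monic _

section

open Classical

variable {p ℓ : ℕ} [Fact p.Prime] [Fact ℓ.Prime]

theorem exists_isEulerFactor_map (hℓp : ℓ ≠ p)
    {R : Type u} [CommRing R] [IsDomain R] [IsLocalRing R] [IsNoetherianRing R]
    [CharP (IsLocalRing.ResidueField R) p] {G : Type v} [Group G] [TopologicalSpace G]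
    [IsTopologicalGroup G] {n : ℕ} {D : Determinant R G n}
    (hD : D.IsContinuous) {res : LocalGaloisGroup ℓ →* G} (hres : Continuous res)
    {σ : LocalGaloisGroup ℓ} (hσ : IsGeometricFrobenius σ)
    {B : Type u} [CommRing B] [IsDomain B] [IsIntegrallyClosed B] [Algebra R B]
    [FaithfulSMul R B] (ψ : B →+* PadicAlgCl p)
    {ρψ : Representation (PadicAlgCl p) G (Fin n → PadicAlgCl p)}
    (hρψ : D.IsAttachedAlong (ψ.comp (algebraMap R B)) ρψ) (hpure : IsPure (p := p) (MonoidHom.comp ρψ res))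
    {L : Type w} [Field L] [IsAlgClosed L] (φ : B →+* L)
    (hφψ : RingHom.ker φ ≤ RingHom.ker ψ)
    {ρ : Representation (GeometricField B) G (Fin n → GeometricField B)}
    (hρ : D.IsAttachedAlong ((algebraMap B (GeometricField B)).comp (algebraMap R B)) ρ)
    {ρφ : Representation L G (Fin n → L)}
    (hρφ : D.IsAttachedAlong (φ.comp (algebraMap R B)) ρφ) :
    ∃ P : B[X], P.coeff 0 = 1 ∧ IsEulerFactor (MonoidHom.comp ρ res) σ P ∧
      P.map φ = (inertiaDeterminant (MonoidHom.comp ρφ res)).charpoly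
        (σ : LocalGaloisGroup ℓ ⧸ inertiaGroup ℓ) := by
  have hBψ (k : ℕ) (hk : (k : PadicAlgCl p) = 0) : k = 0 := by exact_mod_cast hk
  have : CharZero B := charZero_of_inj_zero fun k hk => hBψ k (by rw [← map_natCast ψ, hk, map_zero])
  have : CharZero L := charZero_of_inj_zero fun k hk => hBψ k <| by
    rw [← map_natCast ψ]
    exact hφψ (by rw [RingHom.mem_ker, map_natCast, hk])
  have : CharZero (FractionRing B) :=
    charZero_of_injective_algebraMap (IsFractionRing.injective B (FractionRing B))
  have : CharZero (GeometricField B) :=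
    charZero_of_injective_algebraMap (algebraMap (FractionRing B) (GeometricField B)).injective
  -- All the Frobenius eigenvalues at the generic point are integral over `B`, so they lie in `A`.
  let A := integralClosure B (GeometricField B)
  have hBK : Function.Injective (algebraMap B (GeometricField B)) :=
    GeometricField.algebraMap_injective B
  let h : A →+* GeometricField B := algebraMap A (GeometricField B)
  have hh : Function.Injective h := Subtype.val_injective
  have hBA : Function.Injective (algebraMap B A) := fun x y hxy => hBK (congrArg h hxy)
  let a : R →+* A := (algebraMap B A).comp (algebraMap R B)
  have hRB : Function.Injective (algebraMap R B) := FaithfulSMul.algebraMap_injective _ _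
  have ha : Function.Injective (h.comp a) := hBK.comp hRB
  have hρ' : D.IsAttachedAlong (h.comp a) ρ := hρ
  -- The specializations are extended to `A`, where eigenvalues can be compared, with the inclusion
  -- of kernels preserved.
  obtain ⟨f, f', rfl, rfl, hff'⟩ := Algebra.IsIntegral.exists_ringHom_pair hBA φ ψ hφψ
  obtain ⟨t, N, M, w, ht, hN, hM, hw⟩ := hpure
  obtain ⟨s⟩ := ht.nonempty_tameSystem
  have := hρ'.finite_imageAlgebra ha
  obtain ⟨τ, ε, m, hτ, hε⟩ := exists_isUnipotentProjector s hℓp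
    (IsLocalRing.natCast_mem_maximalIdeal R p) ((hρ'.isAdicContinuous hD ha).comp hres) hσ
    _ Determinant.imageAct_injective
  obtain ⟨x, rfl⟩ := Ideal.Quotient.mk_surjective ε
  have P := FrobeniusPoint.of_ker_le hρ' hε hρ' le_rfl
  have P' := FrobeniusPoint.of_ker_le (hL := f') (a := a) hρ' hε hρψ
    (by rw [(RingHom.injective_iff_ker_eq_bot _).1 ha]; exact bot_le)
  have PL := FrobeniusPoint.of_ker_le (hL := f) (a := a) hρ' hε hρφ
    (by rw [(RingHom.injective_iff_ker_eq_bot _).1 ha]; exact bot_le)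
  obtain ⟨S, hS⟩ := P'.projector.exists_finrank_ker_add hℓp
    (PadicAlgCl.algebraMap_padicInt_injective p) hσ s hτ hN hM (hw σ hσ)
  have hint (β : GeometricField B)
      (hβ : ((D.algebraCharpoly (MonoidAlgebra.single (res σ) 1)).map (h.comp a)).IsRoot β) :
      ∃ α : A, h α = β :=
    ⟨⟨β, by
      obtain ⟨q, hq, hq0⟩ := hρ'.isIntegral ha _ hβ
      exact ⟨q.map (algebraMap R B), hq.map _, by rw [Polynomial.eval₂_map]; exact hq0⟩⟩, rfl⟩
  obtain ⟨b, hb⟩ := P.exists_invariantEigenvalues P' hh (by simp) hint S hS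
  have hgal (g : Gal(GeometricField B/FractionRing B)) :
      ((g : GeometricField B →+* GeometricField B).comp h).comp a = h.comp a :=
    RingHom.ext fun r => g.commutes (algebraMap B (FractionRing B) (algebraMap R B r))
  -- The conjugate of `h` by `g` is again an injective point with the same attached representation
  -- `ρ`. The specialization statement for it says that the Euler factor is invariant under `g`.
  obtain ⟨Q, hQ⟩ := Polynomial.exists_map_eq_of_galois_invariant
    (b.map fun β => 1 - Polynomial.C β * Polynomial.X).prod fun g => by
      have Pg := FrobeniusPoint.of_ker_le (a := a)
        (hL := (g : GeometricField B →+* GeometricField B).comp h) hρ' hε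
        ((hgal g).symm ▸ hρ') (by rw [hgal])
      have hg : Function.Injective ((g : GeometricField B →+* GeometricField B).comp h) :=
        g.injective.comp hh
      rw [Pg.map_prod_one_sub (P.invariantEigenvalues_eq_map P' Pg hh (by simp) (by simp) hint S hS
        (by rw [(RingHom.injective_iff_ker_eq_bot _).1 hg]; exact bot_le) hb)]
      exact (P.map_prod_one_sub hb).symm
  refine ⟨Q, hBA ?_, ?_, ?_⟩
  · rw [← Polynomial.coeff_map, hQ, Polynomial.coeff_zero_prod_one_sub, map_one]
  · rw [IsEulerFactor, ← P.map_prod_one_sub hb, ← hQ, Polynomial.map_map]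
    rfl
  · rw [← Polynomial.map_map, hQ]
    exact PL.map_prod_one_sub
      (P.invariantEigenvalues_eq_map P' PL hh (by simp) (by simp) hint S hS hff' hb)

end

/-! ### Canonical isomorphisms of polynomial determinants -/

namespace PolynomialDet

variable {A B : Type*} [CommRing A] [CommRing B]

/-- The determinant of the complex `A[X] → A[X]` is free of rank one. -/
noncomputable def equiv (P : A[X]) : PolynomialDet P ≃ₗ[A[X]] A[X] :=
  TensorProduct.congr (exteriorPower.oneEquiv A[X] A[X])
    ((exteriorPower.oneEquiv A[X] A[X]).dualMap.symm ≪≫ₗ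
      LinearMap.ringLmapEquivSelf A[X] A[X] A[X]) ≪≫ₗ TensorProduct.lid A[X] A[X]

theorem can_apply (P : A[X]) (x : PolynomialDet P) : can P x = P * equiv P x := by
  induction x using TensorProduct.induction_on with
  | zero => simp
  | add x y hx hy => rw [map_add, map_add, hx, hy, mul_add]
  | tmul x u =>
    obtain ⟨u, rfl⟩ := (exteriorPower.oneEquiv A[X] A[X]).dualMap.surjective u
    have h1 : exteriorPower.oneEquiv A[X] A[X]
        (exteriorPower.map 1 (LinearMap.mulLeft A[X] P) x) =
        P * exteriorPower.oneEquiv A[X] A[X] x :=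
      LinearMap.congr_fun (exteriorPower.oneEquiv_naturality (LinearMap.mulLeft A[X] P)) x
    have h2 (y : A[X]) : u y = y * u 1 := by
      rw [← smul_eq_mul, ← map_smul, smul_eq_mul, mul_one]
    have h3 : can P (x ⊗ₜ (exteriorPower.oneEquiv A[X] A[X]).dualMap u) =
        u (exteriorPower.oneEquiv A[X] A[X]
          (exteriorPower.map 1 (LinearMap.mulLeft A[X] P) x)) := rfl
    have h4 : equiv P (x ⊗ₜ (exteriorPower.oneEquiv A[X] A[X]).dualMap u) =
        exteriorPower.oneEquiv A[X] A[X] x * u 1 := by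
      simp [equiv]
    rw [h3, h4, h1, h2, mul_assoc]

theorem can_injective [IsDomain A] {P : A[X]} (hP : P ≠ 0) : Function.Injective (can P) :=
  fun x y hxy => by
    rw [can_apply, can_apply] at hxy
    exact (equiv P).injective (mul_left_cancel₀ hP hxy)

/-- Both modules are free of rank one, and in these trivializations the canonical maps are
multiplication by `P` and by its image. The latter is injective over a domain, which gives
uniqueness. -/
theorem hasCanonicalIso_map [IsDomain B] (φ : A →+* B) (P : A[X]) (hP : P.map φ ≠ 0) :
    HasCanonicalIso φ P (P.map φ) := by
  let : Algebra A[X] B[X] := (Polynomial.mapRingHom φ).toAlgebra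
  let θ : B[X] ⊗[A[X]] PolynomialDet P ≃ₗ[B[X]] PolynomialDet (P.map φ) :=
    (equiv P).baseChange A[X] B[X] _ _ ≪≫ₗ
      TensorProduct.AlgebraTensorModule.rid A[X] B[X] B[X] ≪≫ₗ (equiv (P.map φ)).symm
  have hθ (x : PolynomialDet P) : can (P.map φ) (θ (1 ⊗ₜ x)) = (can P x).map φ := by
    have h1 : θ (1 ⊗ₜ x) = (equiv (P.map φ)).symm (equiv P x • (1 : B[X])) := rfl
    rw [can_apply, can_apply, h1, LinearEquiv.apply_symm_apply, Polynomial.map_mul,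
      Algebra.smul_def, mul_one]
    rfl
  refine ⟨θ.symm, hθ, fun θ' hθ' => ?_⟩
  rw [← LinearEquiv.symm_symm θ']
  congr 1
  refine LinearEquiv.toLinearMap_injective (TensorProduct.AlgebraTensorModule.ext fun b x => ?_)
  rw [← mul_one b, ← smul_eq_mul, ← TensorProduct.smul_tmul']
  refine (map_smul _ _ _).trans (Eq.trans ?_ (map_smul θ.toLinearMap _ _).symm)
  congr 1
  exact can_injective hP ((hθ' x).trans (hθ x).symm)

end PolynomialDet

theorem mainTheorem3 {p ℓ : ℕ} [Fact p.Prime] [Fact ℓ.Prime] (hℓp : ℓ ≠ p)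
    -- the coefficient ring of the family, with its structure of algebra over the `p`-adic integers
    {R : Type u} [CommRing R] [IsDomain R] [IsLocalRing R] [IsNoetherianRing R]
    [IsAdicComplete (IsLocalRing.maximalIdeal R) R] [Finite (IsLocalRing.ResidueField R)]
    [CharP (IsLocalRing.ResidueField R) p] [Algebra ℤ_[p] R]
    -- the family, given by its determinant
    (S : Finset ℕ) (hpS : p ∈ S) {n : ℕ} (D : Determinant R (GlobalGaloisGroup S) n)
    (hD : D.IsContinuous)
    -- the embedding that defines the decomposition group at `ℓ`, and a lift of the Frobenius
    (ι : AlgebraicClosure ℚ →ₐ[ℚ] PadicAlgCl ℓ) (σ : LocalGaloisGroup ℓ)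
    (hσ : IsGeometricFrobenius σ)
    -- a pure specialization
    (ψ : Normalization R →ₐ[ℤ_[p]] PadicAlgCl p)
    (hψ : (D.baseChange (algebraMap R (Normalization R))).IsPureSpecialization ι ψ.toRingHom)
    -- a morphism to a normal domain
    {T : Type v} [CommRing T] [IsDomain T] [IsIntegrallyClosed T] (φ : Normalization R →+* T)
    (hφψ : RingHom.ker φ ≤ RingHom.ker ψ.toRingHom)
    -- the semisimple representations attached to the determinant and to its image by `φ`
    (ρ : Representation (GeometricField (Normalization R)) (GlobalGaloisGroup S)
      (Fin n → GeometricField (Normalization R)))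
    (hρ : (D.baseChange (algebraMap R (Normalization R))).IsAttachedTo ρ)
    (ρφ : Representation (GeometricField T) (GlobalGaloisGroup S) (Fin n → GeometricField T))
    (hρφ : ((D.baseChange (algebraMap R (Normalization R))).baseChange φ).IsAttachedTo ρφ) :
    -- the Euler factors have coefficients in the two normal domains
    IsEulerFactor (ρ.comp (localToGlobal S ι)) σ
      (eulerFactor (Normalization R) (ρ.comp (localToGlobal S ι)) σ) ∧
    IsEulerFactor (ρφ.comp (localToGlobal S ι)) σ
      (eulerFactor T (ρφ.comp (localToGlobal S ι)) σ) ∧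
    -- the local polynomial determinants commute with base change
    PolynomialDet.HasCanonicalIso φ
      (eulerFactor (Normalization R) (ρ.comp (localToGlobal S ι)) σ)
      (eulerFactor T (ρφ.comp (localToGlobal S ι)) σ) ∧
    -- and so do the Euler factors
    eulerFactor T (ρφ.comp (localToGlobal S ι)) σ =
      (eulerFactor (Normalization R) (ρ.comp (localToGlobal S ι)) σ).map φ := by
  have hL : RingHom.ker ((algebraMap T (GeometricField T)).comp φ) = RingHom.ker φ :=
    RingHom.ker_comp_of_injective φ (GeometricField.algebraMap_injective T)
  obtain ⟨ρψ, hρψ, hpure⟩ := hψ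
  have hρψ : D.IsAttachedAlong (ψ.toRingHom.comp (algebraMap R (Normalization R))) ρψ :=
    hρψ.isAttachedAlong.of_baseChange.of_baseChange
  obtain ⟨P, hP0, hP, hPφ⟩ := exists_isEulerFactor_map hℓp hD (continuous_localToGlobal S ι) hσ
    ψ.toRingHom hρψ hpure
    ((algebraMap T (GeometricField T)).comp φ) (hL.trans_le hφψ)
    hρ.isAttachedAlong.of_baseChange hρφ.isAttachedAlong.of_baseChange.of_baseChange
  rw [← Polynomial.map_map] at hPφ
  have hPφ : IsEulerFactor (ρφ.comp (localToGlobal S ι)) σ (P.map φ) := hPφ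
  rw [hP.eulerFactor_eq (GeometricField.algebraMap_injective _),
    hPφ.eulerFactor_eq (GeometricField.algebraMap_injective T)]
  -- The image of `P` is nonzero because its constant coefficient is `1`.
  refine ⟨hP, hPφ, PolynomialDet.hasCanonicalIso_map φ P fun h0 => ?_, rfl⟩
  have := congrArg (fun q => q.coeff 0) h0
  simp [Polynomial.coeff_map, hP0] at this
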